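/- Let $\Sigma$ be a finite alphabet and let $Q\subseteq\Sigma^*\times\mathbb{N}$ be a parameterized problem; the size of an instance $(x,k)$ is $|(x,k)|:=|x|+k$. The following statements are equivalent. (1) $Q$ is strongly uniformly fixed-parameter tractable: there are a single algorithm (Turing machine), a computable function $f\colon\mathbb{N}\to\mathbb{N}$ and a polynomial $p$ such that the algorithm decides whether $(x,k)\in Q$ in at most $f(k)\cdot p(|x|)$ steps, for all $(x,k)\in\Sigma^*\times\mathbb{N}$. (2) $Q$ is decidable and has a kernel of computable size: there are a computable function $f\colon\mathbb{N}\to\mathbb{N}$ and a map $K\colon\Sigma^*\times\mathbb{N}\to\Sigma^*\times\mathbb{N}$, computable in time polynomial in $|x|+k$, such that for every $(x,k)$ we have $|K(x,k)|\le f(k)$ and $(x,k)\in Q\Leftrightarrow K(x,k)\in Q$. (3) $Q$ is decidable, and there are a quasi-order (a reflexive and transitive relation) $\preceq$ on $\Sigma^*\times\mathbb{N}$, such that $a\preceq b$ can be decided in time polynomial in $|a|+|b|$, and a computable function $f\colon\mathbb{N}\to\mathbb{N}$ such that (a) $Q$ is a lower ideal under $\preceq$, i.e. $a\in Q$ and $a'\preceq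 a$ imply $a'\in Q$; and (b) for every $(x,k)\notin Q$ there is an instance $(x',k')\notin Q$ of size at most $f(k)$ with $(x',k')\preceq(x,k)$. -/

import Mathlib

namespace ParamComplexity

open Computability Turing

/-- Instances of a parameterized problem over the alphabet `A`: pairs `(x, k)` of a word `x` and a
parameter `k`. -/
abbrev Instance (A : Type) : Type := List A × ℕ

/-- The size `|(x, k)| = |x| + k` of an instance. -/
def Instance.size {A : Type} (a : Instance A) : ℕ := a.1.length + a.2

/-- The encoding of an instance `(x, k)` as a word: `x` followed by `k` in unary. -/
def instanceEncoding (A : Type) : Encoding (Instance A) (A ⊕ Bool) :=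
  encodingProd (encodingList A) unaryEncodingNat

/-- The encoding of a pair of instances as a word. -/
def pairEncoding (A : Type) : Encoding (Instance A × Instance A) ((A ⊕ Bool) ⊕ (A ⊕ Bool)) :=
  encodingProd (instanceEncoding A) (instanceEncoding A)

/-- The code word of an instance has the size of the instance as its length, so that polynomial
time in the length of the input means polynomial time in `|x| + k`. -/
theorem length_instanceEncoding {A : Type} (a : Instance A) :
    ((instanceEncoding A).encode a).length = a.size := by
  have h : ∀ n : ℕ, (unaryEncodeNat n).length = n := unary_decode_encode_nat
  simp [instanceEncoding, encodingProd, encodingList, unaryEncodingNat, Instance.size, h]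

/-- The code word of a pair of instances has the sum of the two sizes as its length. -/
theorem length_pairEncoding {A : Type} (a b : Instance A) :
    ((pairEncoding A).encode (a, b)).length = a.size + b.size := by
  rw [← length_instanceEncoding a, ← length_instanceEncoding b]
  simp [pairEncoding, encodingProd]

open Classical in
/-- `Q` is decidable: some Turing machine halts on every instance and outputs whether the instance
belongs to `Q`. -/
def IsDecidable {A : Type} (Q : Set (Instance A)) : Prop :=
  Nonempty (TM2Computable (instanceEncoding A).encode encodeBool (fun a => decide (a ∈ Q)))

open Classical in
/-- `Q` is strongly uniformly fixed-parameter tractable: a single Turing machine decides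
`(x, k) ∈ Q` within `f k * p |x|` steps, for a computable function `f` and a polynomial `p`. -/
def IsStronglyUniformlyFPT {A : Type} (Q : Set (Instance A)) : Prop :=
  ∃ (M : TM2ComputableAux (A ⊕ Bool) Bool) (f : ℕ → ℕ) (p : Polynomial ℕ), Computable f ∧
    ∀ (x : List A) (k : ℕ),
      Nonempty (TM2OutputsInTime M.tm
        (((instanceEncoding A).encode (x, k)).map M.inputAlphabet.invFun)
        (some ((encodeBool (decide ((x, k) ∈ Q))).map M.outputAlphabet.invFun))
        (f k * p.eval x.length))

/-- `K` is a kernelization algorithm of size `f` for `Q`: it is computable in polynomial time, and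
it maps every instance `(x, k)` to an equivalent instance of size at most `f k`. -/
structure IsKernel {A : Type} (Q : Set (Instance A)) (f : ℕ → ℕ)
    (K : Instance A → Instance A) : Prop where
  polyTime : Nonempty
    (TM2ComputableInPolyTime (instanceEncoding A).encode (instanceEncoding A).encode K)
  size_le : ∀ (x : List A) (k : ℕ), (K (x, k)).size ≤ f k
  mem_iff : ∀ a : Instance A, a ∈ Q ↔ K a ∈ Q

open Classical in
/-- `r` is a polynomial-time quasi-order on the set of instances: it is reflexive and transitive,
and some Turing machine decides `r a b` in time polynomial in `|a| + |b|`. -/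
structure IsPolyTimeQuasiOrder {A : Type} (r : Instance A → Instance A → Prop) : Prop where
  refl : ∀ a, r a a
  trans : ∀ a b c, r a b → r b c → r a c
  polyTime : Nonempty
    (TM2ComputableInPolyTime (pairEncoding A).encode encodeBool (fun q => decide (r q.1 q.2)))

/-- `Q` is a lower ideal under `r`: it contains every instance that precedes a member of `Q`. -/
def IsLowerIdeal {A : Type} (r : Instance A → Instance A → Prop) (Q : Set (Instance A)) : Prop :=
  ∀ a b, a ∈ Q → r b a → b ∈ Q

end ParamComplexity

/-! ### Structured stack programs with step counts. -/

namespace ParamComplexity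

open Function

/-! The heart of (1) ⇒ (2) and (1) ⇒ (3) is a clocked run. Given a machine that decides `Q` within
f(k)·p(|x|) steps, simulate it for |x|·p(|x|) steps, a clock that does not involve `f`. If the
machine halts, the answer is known and one of two fixed instances `y`, `z` can be output. If it does
not, then |x|·p(|x|) < f(k)·p(|x|), hence |x| < f(k), and the instance is small enough to be its own
kernel. The resulting map K is idempotent (`IsStronglyUniformlyFPT.exists_kernel`). Therefore K a =
K b is a polynomial-time equivalence relation whose classes respect `Q`, and K(x,k) is itself the
small instance below (x,k) that (3) asks for (`IsKernel.exists_quasiOrder`).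

For (2) ⇒ (1), apply the kernelization and then any decision procedure. The latter only meets
instances of size at most f(k), finitely many for each k, so its running time is bounded by a
computable function of k (`IsKernel.isStronglyUniformlyFPT`). For (3) ⇒ (1), compute from k the list
of all non-members of size at most f(k), and test each of them against (x,k): some entry precedes
(x,k) exactly if (x,k) is not in `Q` (`IsPolyTimeQuasiOrder.isStronglyUniformlyFPT`). Both times are
polynomial in |x| + g(k) with `g` computable, and `isStronglyUniformlyFPT_of_runs` turns such a
bound into a product.

The bulk of the work is to realise these algorithms by multi-stack machines. Structured programs
over stacks of numbers mediate. They compile to machines (`Runs.outputsInTime`). Conversely,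
machines can be simulated, with constant overhead, as subroutines of programs
(`exists_runs_callProg`) or under a clock (`Coding.exists_runs_clockedProg`). Execution of a
program, including its step count, is partial recursive (`exists_partrec_of_exec`), which makes
running times computable. Finally, a computable function from numbers to words has a program with
computable running time (`exists_prog_of_computable`), obtained by translating Mathlib's
`ToPartrec.Code`. -/

/-- Structured programs over a family of stacks of natural numbers, indexed by `K`. -/
inductive Prog (K : Type) : Type
  | skip : Prog K
  | push (k : K) (a : ℕ) : Prog K
  | pop (k : K) : Prog K
  | seq (p q : Prog K) : Prog K
  /-- `ite k o p q` runs `p` if the top of stack `k` is `o`, and `q` otherwise. -/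
  | ite (k : K) (o : Option ℕ) (p q : Prog K) : Prog K
  /-- `loop k b o p` repeats `p` as long as the truth value of "the top of stack `k` is `o`"
  is `b`. -/
  | loop (k : K) (b : Bool) (o : Option ℕ) (p : Prog K) : Prog K

/-- The contents of the stacks. -/
abbrev Store (K : Type) : Type := K → List ℕ

section Semantics

variable {K : Type} [DecidableEq K]

/-- `Exec p s t s'`: started in `s`, the program `p` halts after exactly `t` steps in `s'`. -/
inductive Exec : Prog K → Store K → ℕ → Store K → Prop
  | skip (s : Store K) : Exec .skip s 1 s
  | push (s : Store K) (k : K) (a : ℕ) : Exec (.push k a) s 1 (update s k (a :: s k))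
  | pop (s : Store K) (k : K) : Exec (.pop k) s 1 (update s k (s k).tail)
  | seq {p q : Prog K} {s s' s'' : Store K} {t t' : ℕ} :
      Exec p s t s' → Exec q s' t' s'' → Exec (.seq p q) s (t + t') s''
  | ite_true {p q : Prog K} {s s' : Store K} {t : ℕ} {k : K} {o : Option ℕ} :
      (s k).head? = o → Exec p s t s' → Exec (.ite k o p q) s (t + 1) s'
  | ite_false {p q : Prog K} {s s' : Store K} {t : ℕ} {k : K} {o : Option ℕ} :
      (s k).head? ≠ o → Exec q s t s' → Exec (.ite k o p q) s (t + 1) s'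
  | loop_exit {p : Prog K} {s : Store K} {k : K} {b : Bool} {o : Option ℕ} :
      decide ((s k).head? = o) ≠ b → Exec (.loop k b o p) s 1 s
  | loop_step {p : Prog K} {s s' s'' : Store K} {t t' : ℕ} {k : K} {b : Bool} {o : Option ℕ} :
      decide ((s k).head? = o) = b → Exec p s t s' → Exec (.loop k b o p) s' t' s'' →
      Exec (.loop k b o p) s (t + t' + 1) s''

/-- `Runs p s T s'`: started in `s`, the program `p` halts after at most `T` steps in `s'`. -/
def Runs (p : Prog K) (s : Store K) (T : ℕ) (s' : Store K) : Prop := ∃ t ≤ T, Exec p s t s'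

variable {p q : Prog K} {s s' s'' : Store K} {t t' T T' : ℕ} {k : K} {b : Bool} {o : Option ℕ}

theorem Exec.runs (h : Exec p s t s') : Runs p s t s' := ⟨t, le_rfl, h⟩

theorem Runs.mono (h : Runs p s T s') (hT : T ≤ T') : Runs p s T' s' :=
  let ⟨t, ht, e⟩ := h; ⟨t, ht.trans hT, e⟩

theorem Runs.congr (h : Runs p s T s') (hT : T ≤ T') (hs : s' = s'') : Runs p s T' s'' :=
  hs ▸ h.mono hT

theorem Runs.skip : Runs .skip s 1 s := (Exec.skip s).runs

theorem Runs.push {a : ℕ} : Runs (.push k a) s 1 (update s k (a :: s k)) := (Exec.push s k a).runs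

theorem Runs.pop : Runs (.pop k) s 1 (update s k (s k).tail) := (Exec.pop s k).runs

theorem Runs.seq (h : Runs p s T s') (h' : Runs q s' T' s'') : Runs (.seq p q) s (T + T') s'' :=
  let ⟨_, ht, e⟩ := h; let ⟨_, ht', e'⟩ := h'; ⟨_, add_le_add ht ht', e.seq e'⟩

theorem Runs.ite_true (ho : (s k).head? = o) (h : Runs p s T s') :
    Runs (.ite k o p q) s (T + 1) s' :=
  let ⟨_, ht, e⟩ := h; ⟨_, Nat.succ_le_succ ht, e.ite_true ho⟩

theorem Runs.ite_false (ho : (s k).head? ≠ o) (h : Runs q s T s') :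
    Runs (.ite k o p q) s (T + 1) s' :=
  let ⟨_, ht, e⟩ := h; ⟨_, Nat.succ_le_succ ht, e.ite_false ho⟩

theorem Runs.loop_exit (ho : decide ((s k).head? = o) ≠ b) : Runs (.loop k b o p) s 1 s :=
  (Exec.loop_exit ho).runs

theorem Runs.loop_step (ho : decide ((s k).head? = o) = b) (h : Runs p s T s')
    (h' : Runs (.loop k b o p) s' T' s'') : Runs (.loop k b o p) s (T + T' + 1) s'' :=
  let ⟨_, ht, e⟩ := h; let ⟨_, ht', e'⟩ := h'
  ⟨_, Nat.succ_le_succ (add_le_add ht ht'), Exec.loop_step ho e e'⟩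

/-- A stack grows by at most one symbol per step. -/
theorem Exec.length_le (h : Exec p s t s') (k : K) : (s' k).length ≤ (s k).length + t := by
  induction h with
  | skip => omega
  | push s k' a =>
    by_cases hk : k = k'
    · subst hk; simp
    · simp [hk]
  | pop s k' =>
    by_cases hk : k = k'
    · subst hk; simp; omega
    · simp [hk]
  | loop_exit => omega
  | _ => omega

theorem Runs.length_le (h : Runs p s T s') (k : K) : (s' k).length ≤ (s k).length + T :=
  let ⟨_, ht, e⟩ := h; (e.length_le k).trans (by omega)

/-- `switch k l f` runs `f a`, where `a` is the top of stack `k`, provided that `a ∈ l`. -/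
def switch (k : K) (l : List ℕ) (f : ℕ → Prog K) : Prog K :=
  l.foldr (fun a p => .ite k (some a) (f a) p) .skip

theorem Runs.switch {l : List ℕ} {f : ℕ → Prog K} {a : ℕ} (ha : a ∈ l) (hs : (s k).head? = some a)
    (h : Runs (f a) s T s') : Runs (switch k l f) s (T + l.length) s' := by
  induction l with
  | nil => simp at ha
  | cons c l ih =>
    by_cases hc : a = c
    · subst hc
      exact (Runs.ite_true hs h).mono (by simp)
    · have := Runs.ite_false (s := s) (k := k) (p := f c) (o := some c) (by simp [hs, hc])
        (ih (by simpa [hc] using ha))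
      exact this.mono (by simp)

/-- Push a list of symbols, each on its stack. -/
def pushAll (L : List (K × ℕ)) : Prog K := L.foldr (fun x p => .seq (.push x.1 x.2) p) .skip

/-- The symbols of `L` that are destined for stack `k`. -/
def destined (k : K) (L : List (K × ℕ)) : List ℕ :=
  L.filterMap fun x => if x.1 = k then some x.2 else none

@[simp] theorem destined_nil : destined k [] = [] := rfl

@[simp] theorem destined_cons (x : K × ℕ) (L : List (K × ℕ)) :
    destined k (x :: L) = if x.1 = k then x.2 :: destined k L else destined k L := by
  by_cases h : x.1 = k <;> simp [destined, h]

theorem destined_append (L L' : List (K × ℕ)) :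
    destined k (L ++ L') = destined k L ++ destined k L' := by
  simp [destined]

theorem Runs.pushAll (L : List (K × ℕ)) (s : Store K) :
    Runs (pushAll L) s (L.length + 1) (fun k => (destined k L).reverse ++ s k) := by
  induction L generalizing s with
  | nil => exact Runs.skip
  | cons x L ih =>
    refine (Runs.push.seq (ih _)).congr (by simp; omega) ?_
    funext k
    by_cases h : x.1 = k
    · subst h; simp
    · simp [h, Ne.symm h]

/-- As long as the truth value of "the top of stack `k` is `o`" is `b`, pop stack `k`, and for the
popped symbol `a` push the symbols of `f a`. Only symbols from `syms` are expected. -/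
def scan (k : K) (b : Bool) (o : Option ℕ) (syms : List ℕ) (f : ℕ → List (K × ℕ)) : Prog K :=
  .loop k b o (switch k syms fun a => .seq (.pop k) (pushAll (f a)))

/-- `l` is the segment that gets consumed and `r` the remainder at whose top the loop test fails.
Since `f` never pushes onto the scanned stack, that stack only shrinks; every other stack receives
its symbols in reverse, the last one read ending up on top. The constant `c` bounds the pushes per
symbol, and `syms.length` pays for `switch`. -/
theorem Runs.scan (syms : List ℕ) (f : ℕ → List (K × ℕ)) (c : ℕ)
    (hf : ∀ a ∈ syms, ∀ x ∈ f a, x.1 ≠ k) (hc : ∀ a ∈ syms, (f a).length ≤ c)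
    (l r : List ℕ) (s : Store K) (hs : s k = l ++ r) (hl : ∀ a ∈ l, a ∈ syms)
    (hlb : ∀ a ∈ l, decide (some a = o) = b) (hr : decide (r.head? = o) ≠ b) :
    Runs (scan k b o syms f) s (l.length * (c + syms.length + 3) + 1)
      (fun k' => if k' = k then r else (destined k' (l.flatMap f)).reverse ++ s k') := by
  induction l generalizing s with
  | nil =>
    refine (Runs.loop_exit (by simpa [hs] using hr)).congr (by simp) ?_
    funext k'
    by_cases h : k' = k
    · subst h; simpa using hs
    · simp [h]
  | cons a l ih =>
    have ha : a ∈ syms := hl a (by simp)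
    have hbody : Runs (ParamComplexity.switch k syms fun a => .seq (.pop k) (ParamComplexity.pushAll (f a))) s
        (1 + ((f a).length + 1) + syms.length)
        (fun k' => (destined k' (f a)).reverse ++ update s k (s k).tail k') :=
      Runs.switch ha (by simp [hs]) (Runs.pop.seq (Runs.pushAll _ _))
    have hk : destined k (f a) = [] := by
      simp only [destined, List.filterMap_eq_nil_iff]
      intro x hx
      simp [hf a ha x hx]
    have := hc a ha
    refine (Runs.loop_step (by simpa [hs] using hlb a (by simp)) hbody
      (ih _ (by simp [hk, hs]) (fun x hx => hl x (by simp [hx]))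
        (fun x hx => hlb x (by simp [hx])))).congr ?_ ?_
    · simp only [List.length_cons]; nlinarith
    · funext k'
      by_cases h : k' = k
      · simp [h]
      · simp [h, destined_append]

/-- `scan` until the stack is empty. -/
abbrev scanAll (k : K) (syms : List ℕ) (f : ℕ → List (K × ℕ)) : Prog K := scan k false none syms f

theorem Runs.scanAll (syms : List ℕ) (f : ℕ → List (K × ℕ)) (c : ℕ)
    (hf : ∀ a ∈ syms, ∀ x ∈ f a, x.1 ≠ k) (hc : ∀ a ∈ syms, (f a).length ≤ c)
    (s : Store K) (hl : ∀ a ∈ s k, a ∈ syms) :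
    Runs (scanAll k syms f) s ((s k).length * (c + syms.length + 3) + 1)
      (fun k' => if k' = k then [] else (destined k' ((s k).flatMap f)).reverse ++ s k') :=
  Runs.scan syms f c hf hc (s k) [] s (by simp) hl (by simp) (by simp)

end Semantics

/-! ### Renaming stacks, as a frame rule. -/

section Renaming

variable {K L : Type}

/-- Rename the stacks of a program. -/
def Prog.map (j : K → L) : Prog K → Prog L
  | .skip => .skip
  | .push k a => .push (j k) a
  | .pop k => .pop (j k)
  | .seq p q => .seq (p.map j) (q.map j)
  | .ite k o p q => .ite (j k) o (p.map j) (q.map j)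
  | .loop k b o p => .loop (j k) b o (p.map j)

theorem extend_update [DecidableEq K] [DecidableEq L] {j : K → L} (hj : Injective j) (s : Store K)
    (S : Store L) (k : K) (x : List ℕ) :
    update (extend j s S) (j k) x = extend j (update s k x) S := by
  funext l
  by_cases h : ∃ k', j k' = l
  · obtain ⟨k', rfl⟩ := h
    by_cases hk : k' = k
    · subst hk; simp [hj.extend_apply]
    · simp [hj.extend_apply, hj.ne hk, hk]
  · rw [extend_apply' _ _ _ h, update_of_ne (fun e => h ⟨k, e.symm⟩), extend_apply' _ _ _ h]

/-- A renamed program only looks at stacks in the range of `j`, so the contents `S` of all the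
others are arbitrary and preserved. Injectivity keeps distinct stacks apart. -/
theorem Exec.map [DecidableEq K] [DecidableEq L] {j : K → L} (hj : Injective j) {p : Prog K}
    {s s' : Store K} {t : ℕ} (h : Exec p s t s') (S : Store L) :
    Exec (p.map j) (extend j s S) t (extend j s' S) := by
  induction h with
  | skip s => exact Exec.skip _
  | push s k a =>
    rw [← extend_update hj]
    simpa [Prog.map, hj.extend_apply] using Exec.push (extend j s S) (j k) a
  | pop s k =>
    rw [← extend_update hj]
    simpa [Prog.map, hj.extend_apply] using Exec.pop (extend j s S) (j k)
  | seq _ _ ih ih' => exact ih.seq ih'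
  | ite_true h _ ih => exact ih.ite_true (by rwa [hj.extend_apply])
  | ite_false h _ ih => exact ih.ite_false (by rwa [hj.extend_apply])
  | loop_exit h => exact Exec.loop_exit (by rwa [hj.extend_apply])
  | loop_step h _ _ ih ih' => exact Exec.loop_step (by rwa [hj.extend_apply]) ih ih'

theorem Runs.map [DecidableEq K] [DecidableEq L] {j : K → L} (hj : Injective j) {p : Prog K}
    {s s' : Store K} {T : ℕ} (h : Runs p s T s') (S : Store L) :
    Runs (p.map j) (extend j s S) T (extend j s' S) :=
  let ⟨t, ht, e⟩ := h; ⟨t, ht, e.map hj S⟩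

theorem extend_inl {K' : Type} (s : Store K) (r : Store (K ⊕ K')) :
    extend Sum.inl s r = Sum.elim s (fun k => r (.inr k)) := by
  funext k
  rcases k with k | k
  · simp [Sum.inl_injective.extend_apply]
  · rw [extend_apply' _ _ _ (by simp)]; rfl

theorem extend_inr {K' : Type} (s : Store K') (r : Store (K ⊕ K')) :
    extend Sum.inr s r = Sum.elim (fun k => r (.inl k)) s := by
  funext k
  rcases k with k | k
  · rw [extend_apply' _ _ _ (by simp)]; rfl
  · simp [Sum.inr_injective.extend_apply]

/-- The store in which only stack `k` is not empty. -/
def single [DecidableEq K] (k : K) (w : List ℕ) : Store K := update (fun _ => []) k w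

end Renaming

end ParamComplexity

/-! ### Compiling programs into machines. -/

namespace ParamComplexity

open Function Turing

/-- `Steps f t c c'`: the transition function `f` leads from `c` to `c'` in `t` steps. -/
def Steps {σ : Type*} (f : σ → Option σ) (t : ℕ) (c c' : σ) : Prop :=
  (flip bind f)^[t] (some c) = some c'

theorem Steps.single {σ : Type*} {f : σ → Option σ} {c c' : σ} (h : f c = some c') :
    Steps f 1 c c' := by
  simpa [Steps, flip] using h

theorem Steps.trans {σ : Type*} {f : σ → Option σ} {t t' : ℕ} {c c' c'' : σ}
    (h : Steps f t c c') (h' : Steps f t' c' c'') : Steps f (t + t') c c'' := by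
  rw [Steps, Nat.add_comm, iterate_add_apply, h, h']

section Compile

variable {K : Type}

/-- The labels of the machine that executes a program. -/
def Lbl : Prog K → Type
  | .skip => Unit
  | .push _ _ => Unit
  | .pop _ => Unit
  | .seq p q => Lbl p ⊕ Lbl q
  | .ite _ _ p q => Option (Lbl p ⊕ Lbl q)
  | .loop _ _ _ p => Option (Lbl p)

/-- The initial label of a program. -/
def entry : (p : Prog K) → Lbl p
  | .skip => ()
  | .push _ _ => ()
  | .pop _ => ()
  | .seq p _ => .inl (entry p)
  | .ite _ _ _ _ => none
  | .loop _ _ _ _ => none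

theorem finite_lbl : ∀ p : Prog K, Finite (Lbl p)
  | .skip => inferInstanceAs (Finite Unit)
  | .push _ _ => inferInstanceAs (Finite Unit)
  | .pop _ => inferInstanceAs (Finite Unit)
  | .seq p q =>
    have := finite_lbl p
    have := finite_lbl q
    inferInstanceAs (Finite (Lbl p ⊕ Lbl q))
  | .ite _ _ p q =>
    have := finite_lbl p
    have := finite_lbl q
    inferInstanceAs (Finite (Option (Lbl p ⊕ Lbl q)))
  | .loop _ _ _ p =>
    have := finite_lbl p
    inferInstanceAs (Finite (Option (Lbl p)))

variable (K) in
/-- The stack alphabets of the machine that executes a program: besides the stacks of the program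
there are an input stack and an output stack. -/
abbrev StackSym (Γ₀ Γ₁ : Type) : K ⊕ Bool → Type
  | .inl _ => ℕ
  | .inr false => Γ₀
  | .inr true => Γ₁

/-- The internal states of the machine that executes a program. -/
abbrev Reg (Γ₀ Γ₁ : Type) : Type := Bool × Option Γ₀ × Option Γ₁

/-- The initial state of the machine that executes a program. -/
abbrev reg0 {Γ₀ Γ₁ : Type} : Reg Γ₀ Γ₁ := (false, none, none)

variable {Γ₀ Γ₁ Λ : Type}

/-- Test whether the top of stack `k` is `o`, and branch. -/
def testStmt (k : K) (o : Option ℕ) (l l' : Λ) : TM2.Stmt (StackSym K Γ₀ Γ₁) Λ (Reg Γ₀ Γ₁) :=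
  .peek (.inl k) (fun v (x : Option ℕ) => (decide (x = o), v.2))
    (.branch (fun v => v.1) (.load (fun _ => reg0) (.goto fun _ => l))
      (.load (fun _ => reg0) (.goto fun _ => l')))

/-- The statements of the machine that executes a program. -/
def code : (p : Prog K) → (Lbl p → Λ) → Λ → Lbl p → TM2.Stmt (StackSym K Γ₀ Γ₁) Λ (Reg Γ₀ Γ₁)
  | .skip, _, exit => fun _ => .goto fun _ => exit
  | .push k a, _, exit => fun _ => .push (.inl k) (fun _ => a) (.goto fun _ => exit)
  | .pop k, _, exit => fun _ => .pop (.inl k) (fun v _ => v) (.goto fun _ => exit)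
  | .seq p q, emb, exit => fun l => match l with
    | .inl l => code p (fun l => emb (.inl l)) (emb (.inr (entry q))) l
    | .inr l => code q (fun l => emb (.inr l)) exit l
  | .ite k o p q, emb, exit => fun l => match l with
    | none => testStmt k o (emb (some (.inl (entry p)))) (emb (some (.inr (entry q))))
    | some (.inl l) => code p (fun l => emb (some (.inl l))) exit l
    | some (.inr l) => code q (fun l => emb (some (.inr l))) exit l
  | .loop k b o p, emb, exit => fun l => match l with
    | none => testStmt k o (if b then emb (some (entry p)) else exit)
        (if b then exit else emb (some (entry p)))
    | some l => code p (fun l => emb (some l)) (emb none) l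

/-- The stacks of the machine that executes a program. -/
def machineStk (x : List Γ₀) (y : List Γ₁) (s : Store K) : ∀ k, List (StackSym K Γ₀ Γ₁ k)
  | .inl k => s k
  | .inr false => x
  | .inr true => y

variable [DecidableEq K]

theorem update_machineStk_inl (x : List Γ₀) (y : List Γ₁) (s : Store K) (k : K) (w : List ℕ) :
    update (machineStk x y s) (.inl k) w = machineStk x y (update s k w) := by
  funext k'
  rcases k' with k' | b
  · by_cases h : k' = k
    · subst h; simp [machineStk]
    · rw [update_of_ne (by simpa using h)]
      simp [machineStk, h]
  · rw [update_of_ne (by simp)]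
    cases b <;> rfl

theorem update_machineStk_inr_false (x x' : List Γ₀) (y : List Γ₁) (s : Store K) :
    update (machineStk x y s) (.inr false) x' = machineStk x' y s := by
  funext k'
  rcases k' with k' | _ | _
  · rw [update_of_ne (by simp)]; rfl
  · rw [update_self]; rfl
  · rw [update_of_ne (by simp)]; rfl

theorem update_machineStk_inr_true (x : List Γ₀) (y y' : List Γ₁) (s : Store K) :
    update (machineStk x y s) (.inr true) y' = machineStk x y' s := by
  funext k'
  rcases k' with k' | _ | _
  · rw [update_of_ne (by simp)]; rfl
  · rw [update_of_ne (by simp)]; rfl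
  · rw [update_self]; rfl

theorem stepAux_testStmt (k : K) (o : Option ℕ) (l l' : Λ) (x : List Γ₀) (y : List Γ₁)
    (s : Store K) : TM2.stepAux (testStmt k o l l') reg0 (machineStk x y s) =
      ⟨some (if (s k).head? = o then l else l'), reg0, machineStk x y s⟩ := by
  by_cases h : (s k).head? = o <;> simp [testStmt, machineStk, h]

/-- One step of a program costs exactly one step of the machine. The code may be embedded at any
labels `emb` of a larger machine `m` and continues at `exit`, which is what makes the induction go
through sequencing and loops. The register is back at `reg0` between steps, so all information is in
the label and the stacks. -/
theorem Exec.steps {p : Prog K} {s s' : Store K} {t : ℕ} (h : Exec p s t s') (x : List Γ₀)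
    (y : List Γ₁) (m : Λ → TM2.Stmt (StackSym K Γ₀ Γ₁) Λ (Reg Γ₀ Γ₁)) (emb : Lbl p → Λ) (exit : Λ)
    (hm : ∀ l, m (emb l) = code p emb exit l) :
    Steps (TM2.step m) t ⟨some (emb (entry p)), reg0, machineStk x y s⟩
      ⟨some exit, reg0, machineStk x y s'⟩ := by
  induction h generalizing exit with
  | skip s => exact Steps.single (by rw [TM2.step, hm]; rfl)
  | push s k a =>
    refine Steps.single ?_
    rw [TM2.step, hm]
    simp only [code, TM2.stepAux]
    rw [update_machineStk_inl]; rfl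
  | pop s k =>
    refine Steps.single ?_
    rw [TM2.step, hm]
    simp only [code, TM2.stepAux]
    rw [update_machineStk_inl]; rfl
  | @seq p q s s' s'' t t' _ _ ih ih' =>
    exact (ih (fun l => emb (.inl l)) _ (fun l => hm (.inl l))).trans
      (ih' (fun l => emb (.inr l)) _ (fun l => hm (.inr l)))
  | @ite_true p q s s' t k o ho _ ih =>
    rw [Nat.add_comm]
    refine (Steps.single ?_).trans (ih (fun l => emb (some (.inl l))) _ (fun l => hm (some (.inl l))))
    rw [TM2.step, hm]
    simp only [code, entry, stepAux_testStmt, ho, if_true]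
  | @ite_false p q s s' t k o ho _ ih =>
    rw [Nat.add_comm]
    refine (Steps.single ?_).trans (ih (fun l => emb (some (.inr l))) _ (fun l => hm (some (.inr l))))
    rw [TM2.step, hm]
    simp only [code, entry, stepAux_testStmt, ho, if_false]
  | @loop_exit p s k b o ho =>
    refine Steps.single ?_
    rw [TM2.step, hm]
    simp only [code, entry, stepAux_testStmt]
    cases b <;> simp_all
  | @loop_step p s s' s'' t t' k b o ho _ _ ih ih' =>
    rw [Nat.add_comm, ← Nat.add_assoc, Nat.add_comm 1]
    rw [show t + 1 + t' = 1 + t + t' by omega]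
    refine ((Steps.single ?_).trans (ih (fun l => emb (some l)) (emb none) (fun l => hm (some l)))).trans
      (ih' emb exit hm)
    rw [TM2.step, hm]
    simp only [code, entry, stepAux_testStmt]
    cases b <;> simp_all

variable [Inhabited Γ₁]

/-- The statements of a machine that reads its input, executes a program, and writes its output. -/
def ioCode (p : Prog K) (i o : K) (e₀ : Γ₀ → ℕ) (d₁ : ℕ → Γ₁) :
    Bool ⊕ Lbl p → TM2.Stmt (StackSym K Γ₀ Γ₁) (Bool ⊕ Lbl p) (Reg Γ₀ Γ₁)
  | .inl false => .pop (.inr false) (fun v (x : Option Γ₀) => (v.1, x, v.2.2))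
      (.branch (fun v => v.2.1.isSome)
        (.push (.inl i) (fun v => (v.2.1.map e₀).getD 0)
          (.load (fun _ => reg0) (.goto fun _ => .inl false)))
        (.load (fun _ => reg0) (.goto fun _ => .inr (entry p))))
  | .inl true => .pop (.inl o) (fun v (x : Option ℕ) => (v.1, v.2.1, x.map d₁))
      (.branch (fun v => v.2.2.isSome)
        (.push (.inr true) (fun v => v.2.2.getD default)
          (.load (fun _ => reg0) (.goto fun _ => .inl true)))
        (.load (fun _ => reg0) .halt))
  | .inr l => code p .inr (.inl true) l

/-- A machine that reads its input, executes a program, and writes its output. -/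
noncomputable def ioMachine [Fintype K] [Fintype Γ₀] [Fintype Γ₁] (p : Prog K) (i o : K) (e₀ : Γ₀ → ℕ) (d₁ : ℕ → Γ₁) :
    TM2ComputableAux Γ₀ Γ₁ where
  tm :=
    { K := K ⊕ Bool
      k₀ := .inr false
      k₁ := .inr true
      Γ := StackSym K Γ₀ Γ₁
      Λ := Bool ⊕ Lbl p
      main := .inl false
      ΛFin := by have := finite_lbl p; exact Fintype.ofFinite _
      σ := Reg Γ₀ Γ₁
      initialState := reg0
      Γk₀Fin := inferInstanceAs (Fintype Γ₀)
      m := ioCode p i o e₀ d₁ }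
  inputAlphabet := Equiv.refl Γ₀
  outputAlphabet := Equiv.refl Γ₁

/-- Popping from one stack and pushing on another reverses the word, which is why programs receive
their input reversed. The extra step discovers that the input stack is empty. -/
theorem steps_read (p : Prog K) (i o : K) (e₀ : Γ₀ → ℕ) (d₁ : ℕ → Γ₁) (w : List Γ₀)
    (y : List Γ₁) (s : Store K) :
    Steps (TM2.step (ioCode p i o e₀ d₁)) (w.length + 1) ⟨some (.inl false), reg0, machineStk w y s⟩
      ⟨some (.inr (entry p)), reg0, machineStk [] y (update s i ((w.map e₀).reverse ++ s i))⟩ := by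
  induction w generalizing s with
  | nil =>
    refine Steps.single ?_
    simp [ioCode, machineStk, update_machineStk_inr_false]
  | cons a w ih =>
    rw [List.length_cons, Nat.add_comm]
    have := ih (update s i (e₀ a :: s i))
    simp only [update_self, update_idem] at this
    refine (Steps.single ?_).trans (by simpa using this)
    simp [ioCode, machineStk, update_machineStk_inr_false, update_machineStk_inl]

/-- The second reversal: a program has to leave its output reversed in order that the machine
outputs it in the right order. -/
theorem steps_write (p : Prog K) (i o : K) (e₀ : Γ₀ → ℕ) (d₁ : ℕ → Γ₁) (x : List Γ₀)
    (y : List Γ₁) (w : List ℕ) (s : Store K) (hw : s o = w) :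
    Steps (TM2.step (ioCode p i o e₀ d₁)) (w.length + 1) ⟨some (.inl true), reg0, machineStk x y s⟩
      ⟨none, reg0, machineStk x ((w.map d₁).reverse ++ y) (update s o [])⟩ := by
  induction w generalizing s y with
  | nil =>
    refine Steps.single ?_
    simp [ioCode, machineStk, update_machineStk_inl, hw]
  | cons a w ih =>
    rw [List.length_cons, Nat.add_comm]
    have := ih (d₁ a :: y) (update s o w) (by simp)
    simp only [update_idem] at this
    refine (Steps.single ?_).trans (by simpa using this)
    simp [ioCode, machineStk, update_machineStk_inr_true, update_machineStk_inl, hw]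

/-- Programs can be executed by machines. -/
theorem Runs.outputsInTime [Fintype K] [Fintype Γ₀] [Fintype Γ₁] {p : Prog K} {i o : K} {e₀ : Γ₀ → ℕ} {e₁ : Γ₁ → ℕ} {d₁ : ℕ → Γ₁}
    (hd : LeftInverse d₁ e₁) {w : List Γ₀} {w' : List Γ₁} {T : ℕ}
    (h : Runs p (single i (w.map e₀).reverse) T (single o (w'.map e₁).reverse)) :
    Nonempty (TM2OutputsInTime (ioMachine p i o e₀ d₁).tm
      (w.map (ioMachine p i o e₀ d₁).inputAlphabet.invFun)
      (some (w'.map (ioMachine p i o e₀ d₁).outputAlphabet.invFun))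
      (T + w.length + w'.length + 2)) := by
  obtain ⟨t, ht, h⟩ := h
  have h1 := steps_read p i o e₀ d₁ w ([] : List Γ₁) (fun _ => [])
  have h2 := h.steps ([] : List Γ₀) ([] : List Γ₁) (ioCode p i o e₀ d₁) .inr (.inl true)
    (fun _ => rfl)
  have h3 := steps_write p i o e₀ d₁ ([] : List Γ₀) [] (w'.map e₁).reverse
    (single o (w'.map e₁).reverse) (by simp [single])
  simp only [List.append_nil] at h1
  have h4 := (h1.trans h2).trans h3
  have hi : initList (ioMachine p i o e₀ d₁).tm
      (w.map (ioMachine p i o e₀ d₁).inputAlphabet.invFun) =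
      ⟨some (.inl false), reg0, machineStk w [] fun _ => []⟩ := by
    unfold initList
    congr 1
    funext k
    rcases k with k | _ | _ <;> simp [machineStk, ioMachine]
    rfl
  have ho : haltList (ioMachine p i o e₀ d₁).tm
      (w'.map (ioMachine p i o e₀ d₁).outputAlphabet.invFun) =
      ⟨none, reg0, machineStk [] ((List.map d₁ (List.map e₁ w').reverse).reverse ++ [])
        (update (single o (List.map e₁ w').reverse) o [])⟩ := by
    unfold haltList
    congr 1
    funext k
    rcases k with k | _ | _
    · by_cases hk : k = o
      · subst hk; simp [machineStk, ioMachine]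
      · simp [machineStk, ioMachine, single, hk]
    · simp [machineStk, ioMachine]
    · simp [machineStk, ioMachine, hd.comp_eq_id]
      rfl
  -- Reading, executing and writing; the two copying phases each need one more step than there are
  -- symbols, hence the `+ 2` in the bound.
  refine ⟨⟨⟨w.length + 1 + t + ((w'.map e₁).reverse.length + 1), ?_⟩, by simp; omega⟩⟩
  simp only [Option.map_some]
  rw [hi, ho]
  exact h4

end Compile

end ParamComplexity

/-! ### Simulating machines by programs. -/

namespace ParamComplexity

open Function Turing

section Coding

variable {K Λ σ : Type} {Γ : K → Type}

/-- All symbols that a statement may push are `good`. -/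
def StmtGood (good : ∀ k, Γ k → Prop) : TM2.Stmt Γ Λ σ → Prop
  | .push k f q => (∀ v, good k (f v)) ∧ StmtGood good q
  | .peek _ _ q => StmtGood good q
  | .pop _ _ q => StmtGood good q
  | .load _ q => StmtGood good q
  | .branch _ q q' => StmtGood good q ∧ StmtGood good q'
  | .goto _ => True
  | .halt => True

theorem StmtGood.mono {good good' : ∀ k, Γ k → Prop} (h : ∀ k a, good k a → good' k a)
    (q : TM2.Stmt Γ Λ σ) (hq : StmtGood good q) : StmtGood good' q := by
  induction q with
  | push k f q ih => exact ⟨fun v => h _ _ (hq.1 v), ih hq.2⟩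
  | peek k f q ih => exact ih hq
  | pop k f q ih => exact ih hq
  | load f q ih => exact ih hq
  | branch f q q' ih ih' => exact ⟨ih hq.1, ih' hq.2⟩
  | goto => trivial
  | halt => trivial

/-- Only the input alphabet of a `FinTM2` has to be finite. Nevertheless a statement can push only
finitely many symbols, because the pushed symbol is a function of an internal state and there are
finitely many of these. -/
theorem exists_finite_stmtGood [Finite σ] (q : TM2.Stmt Γ Λ σ) :
    ∃ S : Set (Σ k, Γ k), S.Finite ∧ StmtGood (fun k a => ⟨k, a⟩ ∈ S) q := by
  induction q with
  | push k f q ih =>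
    obtain ⟨S, hS, hq⟩ := ih
    refine ⟨S ∪ Set.range fun v => ⟨k, f v⟩, hS.union (Set.finite_range _), fun v => .inr ⟨v, rfl⟩,
      hq.mono fun k a h => .inl h⟩
  | peek k f q ih => exact ih
  | pop k f q ih => exact ih
  | load f q ih => exact ih
  | branch f q q' ih ih' =>
    obtain ⟨S, hS, hq⟩ := ih
    obtain ⟨S', hS', hq'⟩ := ih'
    exact ⟨S ∪ S', hS.union hS', hq.mono fun k a h => .inl h, hq'.mono fun k a h => .inr h⟩
  | goto => exact ⟨∅, Set.finite_empty, trivial⟩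
  | halt => exact ⟨∅, Set.finite_empty, trivial⟩

/-- Codes for the symbols and the internal states of a machine. -/
structure Coding (M : Λ → TM2.Stmt Γ Λ σ) where
  /-- the symbols that may occur -/
  good : ∀ k, Γ k → Prop
  /-- the code of a symbol -/
  enc : ∀ k, Γ k → ℕ
  /-- the symbol with a given code -/
  dec : ∀ k, ℕ → Option (Γ k)
  /-- the code of a label and an internal state -/
  encC : Λ × σ → ℕ
  /-- the label and the internal state with a given code -/
  decC : ℕ → Option (Λ × σ)
  /-- all codes -/
  codes : List ℕ
  dec_enc : ∀ {k a}, good k a → dec k (enc k a) = some a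
  enc_mem : ∀ {k a}, good k a → enc k a ∈ codes
  decC_encC : ∀ c, decC (encC c) = some c
  encC_mem : ∀ c, encC c ∈ codes
  stmtGood : ∀ l, StmtGood good (M l)

/-- The symbols that can ever occur are those pushed by one of the finitely many statements and the
letters of the input alphabet. They form a finite set, so numerical codes exist and can be listed,
which `switch` requires. -/
theorem exists_coding [Finite Λ] [Finite σ] (M : Λ → TM2.Stmt Γ Λ σ) (k₀ : K) [Finite (Γ k₀)] :
    ∃ cd : Coding M, ∀ a, cd.good k₀ a := by
  classical
  choose S hS hM using fun l => exists_finite_stmtGood (M l)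
  set T : Set (Σ k, Γ k) := (⋃ l, S l) ∪ Set.range fun a => ⟨k₀, a⟩ with hT
  have hfin : T.Finite := (Set.finite_iUnion hS).union (Set.finite_range _)
  obtain ⟨f, hf⟩ := Set.countable_iff_exists_injOn.1 hfin.countable
  obtain ⟨g, hg⟩ := exists_injective_nat (Λ × σ)
  refine ⟨
    { good := fun k a => ⟨k, a⟩ ∈ T
      enc := fun k a => f ⟨k, a⟩
      dec := fun k n => if h : ∃ a : Γ k, ⟨k, a⟩ ∈ T ∧ f ⟨k, a⟩ = n then some h.choose else none
      encC := g
      decC := partialInv g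
      codes := (hfin.image f).toFinset.toList ++ (Set.finite_range g).toFinset.toList
      dec_enc := ?_
      enc_mem := ?_
      decC_encC := fun c => partialInv_left hg c
      encC_mem := fun c => by simp
      stmtGood := fun l => (hM l).mono fun k a h => .inl (Set.mem_iUnion.2 ⟨l, h⟩) },
    fun a => .inr ⟨a, rfl⟩⟩
  · intro k a ha
    have h : ∃ a' : Γ k, ⟨k, a'⟩ ∈ T ∧ f ⟨k, a'⟩ = f ⟨k, a⟩ := ⟨a, ha, rfl⟩
    rw [dif_pos h]
    have := hf h.choose_spec.1 ha h.choose_spec.2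
    simpa using this
  · intro k a ha
    refine List.mem_append_left _ ?_
    simp only [Finset.mem_toList, Set.Finite.mem_toFinset]
    exact ⟨_, ha, rfl⟩

variable {M : Λ → TM2.Stmt Γ Λ σ} (cd : Coding M)

/-- Run `F x`, where `x` is the top of stack `k`. -/
def Coding.inspect (k : K) (F : Option (Γ k) → Prog (Option K)) : Prog (Option K) :=
  .ite (some k) none (F none) (switch (some k) cd.codes fun n => F (cd.dec k n))

/-- Translate a statement, in a given internal state, into a program. The additional stack `none`
holds the label and the internal state. -/
def Coding.transl : TM2.Stmt Γ Λ σ → σ → Prog (Option K)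
  | .push k f q, v => .seq (.push (some k) (cd.enc k (f v))) (Coding.transl q v)
  | .peek k f q, v => cd.inspect k fun x => Coding.transl q (f v x)
  | .pop k f q, v => cd.inspect k fun x => .seq (.pop (some k)) (Coding.transl q (f v x))
  | .load f q, v => Coding.transl q (f v)
  | .branch f q q', v => if f v then Coding.transl q v else Coding.transl q' v
  | .goto f, v => .push none (cd.encC (f v, v))
  | .halt, _ => .skip

/-- A bound for the running time of the translation of a statement. -/
def Coding.cost : TM2.Stmt Γ Λ σ → ℕ
  | .push _ _ q => Coding.cost q + 1
  | .peek _ _ q => Coding.cost q + cd.codes.length + 1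
  | .pop _ _ q => Coding.cost q + cd.codes.length + 2
  | .load _ q => Coding.cost q
  | .branch _ q q' => Coding.cost q + Coding.cost q'
  | .goto _ => 1
  | .halt => 1

/-- The stacks of the program that simulates a machine. -/
def Coding.store (c : List ℕ) (S : ∀ k, List (Γ k)) : Store (Option K)
  | none => c
  | some k => (S k).map (cd.enc k)

/-- All symbols on the stacks are good. -/
def Coding.GoodStk (S : ∀ k, List (Γ k)) : Prop := ∀ k, ∀ a ∈ S k, cd.good k a

/-- The stacks of the program that correspond to a configuration of the machine. -/
def Coding.cfgStore (c : TM2.Cfg Γ Λ σ) : Store (Option K) :=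
  cd.store (c.l.elim [] fun l => [cd.encC (l, c.var)]) c.stk

variable [DecidableEq K]

theorem Coding.update_store (c : List ℕ) (S : ∀ k, List (Γ k)) (k : K) (w : List (Γ k)) :
    update (cd.store c S) (some k) (w.map (cd.enc k)) = cd.store c (update S k w) := by
  funext k'
  rcases k' with _ | k'
  · rw [update_of_ne (by simp)]; rfl
  · by_cases h : k' = k
    · subst h; simp [Coding.store]
    · rw [update_of_ne (by simpa using h)]
      simp [Coding.store, h]

theorem Coding.goodStk_update {S : ∀ k, List (Γ k)} (hS : cd.GoodStk S) (k : K) (w : List (Γ k))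
    (hw : ∀ a ∈ w, cd.good k a) : cd.GoodStk (update S k w) := by
  intro k' a ha
  by_cases h : k' = k
  · subst h; exact hw a (by simpa using ha)
  · exact hS k' a (by simpa [h] using ha)

theorem Coding.runs_inspect {k : K} {F : Option (Γ k) → Prog (Option K)} {c : List ℕ}
    {S : ∀ k, List (Γ k)} (hS : cd.GoodStk S) {T : ℕ} {s' : Store (Option K)}
    (h : Runs (F (S k).head?) (cd.store c S) T s') :
    Runs (cd.inspect k F) (cd.store c S) (T + cd.codes.length + 1) s' := by
  rcases hk : S k with _ | ⟨a, w⟩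
  · rw [hk] at h
    exact (Runs.ite_true (by simp [Coding.store, hk]) h).mono (by omega)
  · rw [hk] at h
    have ha : cd.good k a := hS k a (by simp [hk])
    refine Runs.ite_false (by simp [Coding.store, hk])
      (Runs.switch (cd.enc_mem ha) (by simp [Coding.store, hk]) ?_)
    rw [cd.dec_enc ha]
    exact h

/-- The internal state is a parameter of the translation, not data of the program. Hence `load` and
`branch` are evaluated at translation time and cost nothing, and the new label and state are written
to stack `none` only at a `goto`. After `halt` that stack stays empty. -/
theorem Coding.runs_transl (q : TM2.Stmt Γ Λ σ) (hq : StmtGood cd.good q) (v : σ)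
    (S : ∀ k, List (Γ k)) (hS : cd.GoodStk S) :
    Runs (cd.transl q v) (cd.store [] S) (cd.cost q) (cd.cfgStore (TM2.stepAux q v S)) ∧
      cd.GoodStk (TM2.stepAux q v S).stk := by
  induction q generalizing v S with
  | push k f q ih =>
    have hS' := cd.goodStk_update hS k (f v :: S k) (by
      rintro a (_ | ⟨_, ha⟩)
      exacts [hq.1 v, hS k a ha])
    refine ⟨?_, (ih hq.2 v _ hS').2⟩
    refine (Runs.push.seq ?_).mono (by simp [Coding.cost, add_comm] : 1 + cd.cost q ≤ _)
    have := (ih hq.2 v _ hS').1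
    rw [← cd.update_store] at this
    exact this
  | peek k f q ih => exact ⟨cd.runs_inspect hS (ih hq _ _ hS).1, (ih hq _ _ hS).2⟩
  | pop k f q ih =>
    have hS' := cd.goodStk_update hS k (S k).tail fun a ha => hS k a (List.mem_of_mem_tail ha)
    refine ⟨?_, (ih hq _ _ hS').2⟩
    refine (cd.runs_inspect hS (Runs.pop.seq ?_)).mono
      (by simp only [Coding.cost]; omega : 1 + cd.cost q + cd.codes.length + 1 ≤ _)
    have := (ih hq (f v (S k).head?) _ hS').1
    rw [← cd.update_store] at this
    simpa [Coding.store] using this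
  | load f q ih => exact ih hq _ _ hS
  | branch f q q' ih ih' =>
    cases hf : f v
    · have := ih' hq.2 v S hS
      simp only [TM2.stepAux, hf, Coding.transl, Coding.cost]
      exact ⟨this.1.mono (by omega), this.2⟩
    · have := ih hq.1 v S hS
      simp only [TM2.stepAux, hf, Coding.transl, Coding.cost]
      exact ⟨this.1.mono (by omega), this.2⟩
  | goto f =>
    refine ⟨Runs.push.congr le_rfl ?_, hS⟩
    funext k
    rcases k with _ | k
    · simp [Coding.cfgStore, Coding.store]
    · rw [update_of_ne (by simp)]; rfl
  | halt => exact ⟨Runs.skip, hS⟩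

/-- The program that simulates one step of a machine. -/
def Coding.stepProg : Prog (Option K) :=
  switch none cd.codes fun n => (cd.decC n).elim .skip fun c =>
    .seq (.pop none) (cd.transl (M c.1) c.2)

/-- There are finitely many labels, so the costs of the translated statements have a common bound,
independent of the configuration. -/
theorem Coding.exists_runs_stepProg [Finite Λ] : ∃ C, ∀ c c' : TM2.Cfg Γ Λ σ, cd.GoodStk c.stk →
    TM2.step M c = some c' →
    Runs cd.stepProg (cd.cfgStore c) C (cd.cfgStore c') ∧ cd.GoodStk c'.stk := by
  obtain ⟨C, hC⟩ := (Set.finite_range fun l => cd.cost (M l)).bddAbove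
  refine ⟨1 + C + cd.codes.length, ?_⟩
  rintro ⟨_ | l, v, S⟩ c' hS h
  · simp at h
  · simp only [TM2.step, Option.some.injEq] at h
    subst h
    obtain ⟨h1, h2⟩ := cd.runs_transl (M l) (cd.stmtGood l) v S hS
    refine ⟨Runs.switch (cd.encC_mem (l, v)) (by simp [Coding.cfgStore, Coding.store]) ?_, h2⟩
    rw [cd.decC_encC]
    refine Runs.pop.seq ?_
    convert h1.mono (hC ⟨l, rfl⟩) using 1
    funext k
    rcases k with _ | k
    · simp [Coding.cfgStore, Coding.store]
    · rw [update_of_ne (by simp)]; rfl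

/-- The program that simulates a machine until it halts. -/
def Coding.runProg : Prog (Option K) := .loop none false none cd.stepProg

/-- Stack `none` is empty exactly in halted configurations, so the loop test of `runProg` detects
halting, and each machine step costs at most a constant. -/
theorem Coding.exists_runs_runProg [Finite Λ] : ∃ C, ∀ (t : ℕ) (c c' : TM2.Cfg Γ Λ σ),
    cd.GoodStk c.stk → Steps (TM2.step M) t c c' → c'.l = none →
    Runs cd.runProg (cd.cfgStore c) (C * t + 1) (cd.cfgStore c') ∧ cd.GoodStk c'.stk := by
  obtain ⟨C, hC⟩ := cd.exists_runs_stepProg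
  refine ⟨C + 1, fun t => ?_⟩
  induction t with
  | zero =>
    intro c c' hc h hl
    obtain rfl : c = c' := by simpa [Steps] using h
    exact ⟨(Runs.loop_exit (by simp [Coding.cfgStore, Coding.store, hl])).mono (by simp), hc⟩
  | succ t ih =>
    intro c c' hc h hl
    rw [Steps, iterate_succ_apply] at h
    rcases h1 : TM2.step M c with _ | c1
    · have : ∀ n, (flip bind (TM2.step M))^[n] none = none := fun n =>
        iterate_fixed rfl n
      rw [show flip bind (TM2.step M) (some c) = none from h1, this] at h
      simp at h
    · rw [show flip bind (TM2.step M) (some c) = some c1 from h1] at h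
      obtain ⟨h2, h3⟩ := hC c c1 hc h1
      obtain ⟨h4, h5⟩ := ih c1 c' h3 h hl
      refine ⟨(Runs.loop_step ?_ h2 h4).mono (by ring_nf; omega), h5⟩
      rcases c with ⟨_ | l, v, S⟩
      · simp at h1
      · simp [Coding.cfgStore, Coding.store]

end Coding

end ParamComplexity

/-! ### Machines as subroutines of programs. -/

namespace ParamComplexity

open Function Turing

theorem initList_eq (tm : FinTM2) (w : List (tm.Γ tm.k₀)) :
    initList tm w = ⟨some tm.main, tm.initialState, update (fun _ => []) tm.k₀ w⟩ := by
  unfold initList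
  congr 1
  funext k
  by_cases h : k = tm.k₀
  · subst h; simp
  · simp [h]

theorem haltList_eq (tm : FinTM2) (w : List (tm.Γ tm.k₁)) :
    haltList tm w = ⟨none, tm.initialState, update (fun _ => []) tm.k₁ w⟩ := by
  unfold haltList
  congr 1
  funext k
  by_cases h : k = tm.k₁
  · subst h; simp
  · simp [h]

/-- All codes of the letters of a finite alphabet. -/
noncomputable def letterCodes {Γ : Type} [Fintype Γ] (e : Γ → ℕ) : List ℕ :=
  (Finset.univ : Finset Γ).toList.map e

theorem mem_letterCodes {Γ : Type} [Fintype Γ] (e : Γ → ℕ) (a : Γ) : e a ∈ letterCodes e :=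
  List.mem_map_of_mem (by simp)

theorem destined_flatMap_single {I : Type} [DecidableEq I] (i j : I) (g : ℕ → ℕ) (l : List ℕ) :
    destined j (l.flatMap fun n => [(i, g n)]) = if i = j then l.map g else [] := by
  induction l with
  | nil => simp
  | cons a l ih => by_cases h : i = j <;> simp_all

section Call

variable {Γ₀ Γ₁ I : Type} [Fintype Γ₀] (M : TM2ComputableAux Γ₀ Γ₁) (cd : Coding M.tm.m)
  (j : Option M.tm.K → I)

/-- Move the (reversed) input word from stack `i` to the input stack of a simulated machine. -/
noncomputable def loadProg (e₀ : Γ₀ → ℕ) (d₀ : ℕ → Γ₀) (i : I) : Prog I :=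
  scanAll i (letterCodes e₀) fun n =>
    [(j (some M.tm.k₀), cd.enc M.tm.k₀ (M.inputAlphabet.symm (d₀ n)))]

/-- Move the output of a simulated machine to stack `i`, reversed. -/
def unloadProg (e₁ : Γ₁ → ℕ) (i : I) : Prog I :=
  scanAll (j (some M.tm.k₁)) cd.codes fun n =>
    [(i, ((cd.dec M.tm.k₁ n).map fun a => e₁ (M.outputAlphabet a)).getD 0)]

/-- Put a simulated machine into its initial state. -/
def startProg : Prog I := .push (j none) (cd.encC (M.tm.main, M.tm.initialState))

/-- Run a machine on the (reversed) word on stack `i`, and push its output, reversed, on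
stack `o`. -/
noncomputable def callProg (e₀ : Γ₀ → ℕ) (d₀ : ℕ → Γ₀) (e₁ : Γ₁ → ℕ) (i o : I) : Prog I :=
  .seq (.seq (loadProg M cd j e₀ d₀ i) (startProg M cd j))
    (.seq (cd.runProg.map j) (unloadProg M cd j e₁ o))

variable {M cd j} [DecidableEq I] (hj : Injective j)
include hj

theorem runs_loadProg {e₀ : Γ₀ → ℕ} {d₀ : ℕ → Γ₀} (hd : LeftInverse d₀ e₀) {i : I}
    (hi : ∀ k, j k ≠ i) (w : List Γ₀) (S : Store I) (hS : ∀ k, S (j k) = [])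
    (hw : S i = (w.map e₀).reverse) :
    Runs (loadProg M cd j e₀ d₀ i) S (w.length * (1 + (letterCodes e₀).length + 3) + 1)
      (extend j (cd.store [] (update (fun _ => []) M.tm.k₀ (w.map M.inputAlphabet.symm)))
        (update S i [])) := by
  refine (Runs.scanAll (s := S) _ _ 1 (by simp [hi]) (by simp) ?_).congr (by simp [hw]) ?_
  · simp only [hw, List.mem_reverse, List.mem_map]
    rintro _ ⟨a, -, rfl⟩
    exact mem_letterCodes e₀ a
  · funext l
    rw [destined_flatMap_single, hw]
    by_cases hl : ∃ k, j k = l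
    · obtain ⟨k, rfl⟩ := hl
      rw [if_neg (hi k), hj.extend_apply, hS]
      rcases k with _ | k
      · simp [hj.eq_iff, Coding.store]
      · by_cases hk : k = M.tm.k₀
        · subst hk
          simp [Coding.store, hd.eq]
        · simp [hj.eq_iff, Coding.store, hk, Ne.symm hk]
    · rw [extend_apply' _ _ _ hl]
      by_cases h : l = i
      · simp [h]
      · simp [h, show j (some M.tm.k₀) ≠ l from fun e => hl ⟨_, e⟩]

omit [Fintype Γ₀] in
theorem runs_startProg (S : ∀ k, List (M.tm.Γ k)) (X : Store I) :
    Runs (startProg M cd j) (extend j (cd.store [] S) X) 1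
      (extend j (cd.cfgStore ⟨some M.tm.main, M.tm.initialState, S⟩) X) := by
  refine Runs.push.congr le_rfl ?_
  rw [extend_update hj, hj.extend_apply]
  congr 1
  funext k
  rcases k with _ | k
  · simp [Coding.cfgStore, Coding.store]
  · rw [update_of_ne (by simp)]; rfl

omit [Fintype Γ₀] in
theorem runs_unloadProg {e₁ : Γ₁ → ℕ} {o : I}
    (ho : ∀ k, j k ≠ o) (w : List Γ₁) (v : M.tm.σ) (X : Store I) (hX : ∀ k, X (j k) = [])
    (hg : cd.GoodStk (update (fun _ => []) M.tm.k₁ (w.map M.outputAlphabet.symm))) :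
    Runs (unloadProg M cd j e₁ o) (extend j (cd.cfgStore
        ⟨none, v, update (fun _ => []) M.tm.k₁ (w.map M.outputAlphabet.symm)⟩) X)
      (w.length * (1 + cd.codes.length + 3) + 1)
      (update X o ((w.map e₁).reverse ++ X o)) := by
  have hw : extend j (cd.cfgStore
        ⟨none, v, update (fun _ => []) M.tm.k₁ (w.map M.outputAlphabet.symm)⟩) X
        (j (some M.tm.k₁)) = w.map fun a => cd.enc _ (M.outputAlphabet.symm a) := by
    simp [hj.extend_apply, Coding.cfgStore, Coding.store]
  have hgood : ∀ a ∈ w, cd.good _ (M.outputAlphabet.symm a) := fun a ha =>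
    hg M.tm.k₁ _ (by simpa using ha)
  refine Runs.congr (Runs.scanAll _ _ 1 (by simp [fun k => (ho k).symm]) (by simp) _ ?_)
    (by simp [hw]) ?_
  · rw [hw]
    simp only [List.mem_map]
    rintro _ ⟨a, ha, rfl⟩
    exact cd.enc_mem (hgood a ha)
  · funext l
    rw [destined_flatMap_single, hw]
    by_cases hl : ∃ k, j k = l
    · obtain ⟨k, rfl⟩ := hl
      rw [hj.extend_apply, update_of_ne (ho k), hX]
      by_cases hk : k = some M.tm.k₁
      · simp [hk]
      · rw [if_neg (by simpa [hj.eq_iff] using hk), if_neg (ho k).symm]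
        rcases k with _ | k
        · simp [Coding.cfgStore, Coding.store]
        · simp [Coding.cfgStore, Coding.store, show k ≠ M.tm.k₁ by simpa using hk]
    · rw [extend_apply' _ _ _ hl, if_neg (fun e => hl ⟨_, e.symm⟩)]
      by_cases h : l = o
      · subst h
        simp only [if_true, update_self, List.map_map]
        congr 2
        refine List.map_congr_left fun a ha => ?_
        simp [cd.dec_enc (hgood a ha)]
      · simp [h, Ne.symm h]

/-- Load, start, simulate, unload. The stacks of the simulated machine are empty before and after,
so calls can be repeated, and `i = o` is permitted, which replaces a word by its image. The running
time of the machine enters linearly, with a constant that depends neither on the input nor on the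
stacks `i` and `o`. -/
theorem exists_runs_callProg (hcd : ∀ a, cd.good M.tm.k₀ a) {e₀ : Γ₀ → ℕ} {d₀ : ℕ → Γ₀}
    (hd : LeftInverse d₀ e₀) (e₁ : Γ₁ → ℕ) : ∃ C, ∀ {i o : I}, (∀ k, j k ≠ i) → (∀ k, j k ≠ o) →
    ∀ (w : List Γ₀) (w' : List Γ₁) (t : ℕ), Nonempty (TM2OutputsInTime M.tm
      (w.map M.inputAlphabet.invFun) (some (w'.map M.outputAlphabet.invFun)) t) →
    ∀ S : Store I, (∀ k, S (j k) = []) → S i = (w.map e₀).reverse →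
      Runs (callProg M cd j e₀ d₀ e₁ i o) S (C * (t + w.length + 1))
        (update (update S i []) o ((w'.map e₁).reverse ++ update S i [] o)) := by
  have := M.tm.ΛFin
  obtain ⟨C, hC⟩ := cd.exists_runs_runProg
  -- The product pays for the simulation and for unloading up to `w.length + C * t + 1` output
  -- symbols at `codes.length + 4` steps each; the other summands pay for loading and for additive
  -- constants.
  refine ⟨(C + 1) * (cd.codes.length + 5) + (letterCodes e₀).length + 7,
    fun {i o} hi ho w w' t ⟨⟨⟨t', ht'⟩, htt⟩⟩ S hS hw => ?_⟩
  simp only at htt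
  have h1 := runs_loadProg (cd := cd) hj hd hi w S hS hw
  have h2 := runs_startProg (cd := cd) hj
    (update (fun _ => []) M.tm.k₀ (w.map M.inputAlphabet.symm)) (update S i [])
  have ht : Steps (TM2.step M.tm.m) t' _ _ := ht'
  erw [initList_eq, haltList_eq] at ht
  have hS' : ∀ k, update S i [] (j k) = [] := fun k => by rw [update_of_ne (hi k), hS]
  obtain ⟨h3, h4⟩ := hC _ _ _ (fun k a ha => by
    by_cases hk : k = M.tm.k₀
    · subst hk; exact hcd a
    · simp [hk] at ha) ht rfl
  have h5 := runs_unloadProg hj ho w' M.tm.initialState _ hS' h4 (e₁ := e₁)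
  have h6 := h3.length_le (some M.tm.k₁)
  -- No bound for the output is assumed: a stack grows by at most one symbol per step, so the
  -- simulation time limits the length.
  have h7 : w'.length ≤ w.length + (C * t' + 1) := by
    refine le_trans (le_of_eq ?_) (h6.trans ?_)
    · simp [Coding.cfgStore, Coding.store]
    · simp only [Coding.cfgStore, Coding.store, List.length_map]
      by_cases hk : M.tm.k₁ = M.tm.k₀
      · rw [hk]; simp
      · rw [update_of_ne hk]; simp
  refine ((h1.seq h2).seq ((h3.map hj _).seq h5)).mono ?_
  have h8 : C * t' ≤ C * t := Nat.mul_le_mul_left _ htt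
  have h9 : w'.length * (1 + cd.codes.length + 3) ≤
    (w.length + (C * t + 1)) * (1 + cd.codes.length + 3) := Nat.mul_le_mul_right _ (by omega)
  refine (add_le_add (le_refl _) (add_le_add (Nat.succ_le_succ h8) (Nat.succ_le_succ h9))).trans ?_
  zify
  rw [← sub_nonneg]
  ring_nf
  positivity

end Call

end ParamComplexity

/-! ### Effectiveness of program execution. -/

namespace ParamComplexity

open Function

section Computability

theorem primrec_store_apply {n : ℕ} (k : Fin n) : Primrec fun s : Store (Fin n) => s k :=
  Primrec.fin_app.comp Primrec.id (Primrec.const k)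

theorem primrec_store_update {n : ℕ} (k : Fin n) {α : Type} [Primcodable α]
    {f : α → Store (Fin n)} {g : α → List ℕ} (hf : Primrec f) (hg : Primrec g) :
    Primrec fun a => update (f a) k (g a) := by
  rw [Primrec.fin_curry]
  refine Primrec₂.swap (Primrec.fin_curry₁.2 fun i => ?_)
  by_cases h : i = k
  · subst h; simpa using hg
  · simpa [h] using (primrec_store_apply i).comp hf

theorem primrec_test {n : ℕ} (k : Fin n) (b : Bool) (o : Option ℕ) :
    Primrec fun s : Store (Fin n) => decide (decide ((s k).head? = o) = b) :=
  (Primrec.eq.comp (Primrec.eq.decide.comp (Primrec.list_head?.comp (primrec_store_apply k))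
    (Primrec.const o)) (Primrec.const b)).decide

/-- The final store and the running time of a program are partial recursive functions of the
initial store. -/
theorem exists_partrec_of_exec {n : ℕ} (p : Prog (Fin n)) :
    ∃ F : Store (Fin n) →. Store (Fin n) × ℕ, Partrec F ∧
      ∀ s t s', Exec p s t s' → (s', t) ∈ F s := by
  induction p with
  | skip =>
    refine ⟨fun s => Part.some (s, 1), (Computable.pair .id (.const 1)).partrec, ?_⟩
    rintro s t s' ⟨⟩
    exact Part.mem_some _
  | push k a =>
    refine ⟨fun s => Part.some (update s k (a :: s k), 1), Computable.partrec (Computable.pair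
      (primrec_store_update k .id ((Primrec.list_cons.comp (.const a)
        (primrec_store_apply k)))).to_comp (.const 1)), ?_⟩
    rintro s t s' ⟨⟩
    exact Part.mem_some _
  | pop k =>
    refine ⟨fun s => Part.some (update s k (s k).tail, 1), Computable.partrec (Computable.pair
      (primrec_store_update k .id ((Primrec.list_tail.comp
        (primrec_store_apply k)))).to_comp (.const 1)), ?_⟩
    rintro s t s' ⟨⟩
    exact Part.mem_some _
  | seq p q ihp ihq =>
    obtain ⟨F, hF, hp⟩ := ihp
    obtain ⟨G, hG, hq⟩ := ihq
    refine ⟨fun s => (F s).bind fun x => (G x.1).map fun y => (y.1, x.2 + y.2),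
      hF.bind (Partrec.to₂ (Partrec.map (f := fun z : Store (Fin n) × Store (Fin n) × ℕ => G z.2.1)
        (g := fun z y => (y.1, z.2.2 + y.2)) (hG.comp (Computable.fst.comp .snd)) ?_)), ?_⟩
    · exact ((Computable.fst.comp .snd).pair (Primrec.nat_add.to_comp.comp
        (Computable.snd.comp (Computable.snd.comp .fst)) (Computable.snd.comp .snd))).to₂
    · rintro s _ s' ⟨⟩
      rename_i s1 t t' h h'
      exact Part.mem_bind (hp _ _ _ h) (Part.mem_map _ (hq _ _ _ h'))
  | ite k o p q ihp ihq =>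
    obtain ⟨F, hF, hp⟩ := ihp
    obtain ⟨G, hG, hq⟩ := ihq
    have hm : Computable₂ fun (_ : Store (Fin n)) (x : Store (Fin n) × ℕ) => (x.1, x.2 + 1) :=
      ((Computable.fst.comp .snd).pair (Computable.succ.comp (Computable.snd.comp .snd))).to₂
    refine ⟨_, Partrec.cond (primrec_test k true o).to_comp (hF.map hm) (hG.map hm), ?_⟩
    rintro s _ s' ⟨⟩
    · rename_i t ho h
      simpa [ho] using hp _ _ _ h
    · rename_i t ho h
      simpa [ho] using hq _ _ _ h
  | loop k b o p ihp =>
    obtain ⟨F, hF, hp⟩ := ihp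
    -- A loop is the fixed point of its body; the second component accumulates the elapsed time,
    -- including one unit for every test.
    let G : Store (Fin n) × ℕ →. (Store (Fin n) × ℕ) ⊕ (Store (Fin n) × ℕ) := fun x =>
      bif decide (decide ((x.1 k).head? = o) = b) then
        (F x.1).map fun y => Sum.inr (y.1, x.2 + y.2 + 1) else Part.some (Sum.inl (x.1, x.2 + 1))
    have hG : Partrec G := by
      refine Partrec.cond ((primrec_test k b o).to_comp.comp .fst)
        ((hF.comp .fst).map ?_) (Computable.partrec ?_)
      · exact Computable.to₂ (Computable.sumInr.comp ((Computable.fst.comp .snd).pair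
          (Computable.succ.comp (Primrec.nat_add.to_comp.comp (Computable.snd.comp .fst)
            (Computable.snd.comp .snd)))))
      · exact Computable.sumInl.comp (Computable.fst.pair (Computable.succ.comp .snd))
    -- The accumulated time `c` must be arbitrary for the induction. The program is a variable tied
    -- by an equation, so that induction on the execution remains possible although its index is a
    -- compound term.
    have key : ∀ q s t s', Exec q s t s' → q = .loop k b o p → ∀ c, (s', c + t) ∈ G.fix (s, c) := by
      intro q s t s' h
      induction h with
      | @loop_exit p' s k' b' o' ho =>
        rintro ⟨⟩ c
        refine PFun.mem_fix_iff.2 (.inl ?_)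
        simp [G, ho]
      | @loop_step p' s s1 s2 t t' k' b' o' ho h1 h2 _ ih =>
        rintro ⟨⟩ c
        refine PFun.mem_fix_iff.2 (.inr ⟨(s1, c + t + 1), ?_, ?_⟩)
        · simpa [G, ho] using hp _ _ _ h1
        · have := ih rfl (c + t + 1)
          rwa [show c + (t + t' + 1) = c + t + 1 + t' by omega]
      | _ => rintro ⟨⟩
    refine ⟨fun s => G.fix (s, 0), hG.fix.comp (Computable.id.pair (.const 0)), fun s t s' h => ?_⟩
    simpa using key _ _ _ _ h rfl 0

end Computability

end ParamComplexity

/-! ### Partial recursive functions as programs. -/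

namespace ParamComplexity

open Function Turing

section Leads

variable {K : Type} [DecidableEq K]

/-- `Leads p s s'`: started in `s`, the program `p` halts in `s'`. -/
def Leads (p : Prog K) (s s' : Store K) : Prop := ∃ t, Exec p s t s'

variable {p q : Prog K} {s s' s'' : Store K} {T : ℕ} {k : K} {b : Bool} {o : Option ℕ}

theorem Runs.leads (h : Runs p s T s') : Leads p s s' := let ⟨t, _, e⟩ := h; ⟨t, e⟩

theorem Runs.leads_of_eq (h : Runs p s T s') (hs : s' = s'') : Leads p s s'' := hs ▸ h.leads

theorem Leads.seq (h : Leads p s s') (h' : Leads q s' s'') : Leads (.seq p q) s s'' :=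
  let ⟨_, e⟩ := h; let ⟨_, e'⟩ := h'; ⟨_, e.seq e'⟩

theorem Leads.ite_true (ho : (s k).head? = o) (h : Leads p s s') : Leads (.ite k o p q) s s' :=
  let ⟨_, e⟩ := h; ⟨_, e.ite_true ho⟩

theorem Leads.ite_false (ho : (s k).head? ≠ o) (h : Leads q s s') : Leads (.ite k o p q) s s' :=
  let ⟨_, e⟩ := h; ⟨_, e.ite_false ho⟩

theorem Leads.loop_exit (ho : decide ((s k).head? = o) ≠ b) : Leads (.loop k b o p) s s :=
  ⟨_, .loop_exit ho⟩

theorem Leads.loop_step (ho : decide ((s k).head? = o) = b) (h : Leads p s s')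
    (h' : Leads (.loop k b o p) s' s'') : Leads (.loop k b o p) s s'' :=
  let ⟨_, e⟩ := h; let ⟨_, e'⟩ := h'; ⟨_, .loop_step ho e e'⟩

end Leads

section CodeProg

/-- The unary code of a list of natural numbers. -/
def unaryList (v : List ℕ) : List ℕ := v.flatMap fun n => List.replicate n 1 ++ [2]

/-- This form covers the empty list as well, where `headI` is `0` and `r` is empty; in both cases
the ones on top of the stack give the head, and popping `r` gives the tail. -/
theorem unaryList_eq (v : List ℕ) : ∃ r, unaryList v = List.replicate v.headI 1 ++ r ∧
    r.head? ≠ some 1 ∧ r.tail = unaryList v.tail := by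
  rcases v with _ | ⟨n, v⟩
  · exact ⟨[], by simp [unaryList]⟩
  · exact ⟨2 :: unaryList v, by simp [unaryList]⟩

theorem mem_unaryList {v : List ℕ} {a : ℕ} (h : a ∈ unaryList v) : a ∈ [1, 2] := by
  simp only [unaryList, List.mem_flatMap, List.mem_append, List.mem_replicate] at h
  obtain ⟨n, -, h | h⟩ := h
  · simp [h.2]
  · simpa using Or.inr (List.mem_singleton.1 h)

/-- As long as the truth value of "the top of stack `k` is `o`" is `b`, move symbols from stack `k`
to stack `k'`. -/
def moveProg (k k' : Fin 4) (b : Bool) (o : Option ℕ) : Prog (Fin 4) :=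
  scan k b o [1, 2] fun a => [(k', a)]

/-- As long as the truth value of "the top of stack `k` is `o`" is `b`, pop stack `k`. -/
def dropProg (k : Fin 4) (b : Bool) (o : Option ℕ) : Prog (Fin 4) := scan k b o [1, 2] fun _ => []

theorem leads_moveProg {k k' : Fin 4} (hk : k' ≠ k) {b : Bool} {o : Option ℕ} {s s' : Store (Fin 4)}
    (l r : List ℕ) (hs : s k = l ++ r) (hl : ∀ a ∈ l, a ∈ [1, 2])
    (hlb : ∀ a ∈ l, decide (some a = o) = b) (hr : decide (r.head? = o) ≠ b)
    (hs' : s' = update (update s k r) k' (l.reverse ++ s k')) : Leads (moveProg k k' b o) s s' := by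
  refine (Runs.scan _ _ 1 (by simp [hk]) (by simp) l r s hs hl hlb hr).leads_of_eq ?_
  rw [hs']
  funext i
  have hd := destined_flatMap_single k' i id l
  simp only [id] at hd
  rw [hd]
  by_cases h : i = k
  · subst h; simp [hk.symm]
  · by_cases h' : i = k'
    · subst h'; simp [h]
    · simp [h, h', Ne.symm h']

theorem leads_dropProg {k : Fin 4} {b : Bool} {o : Option ℕ} {s s' : Store (Fin 4)}
    (l r : List ℕ) (hs : s k = l ++ r) (hl : ∀ a ∈ l, a ∈ [1, 2])
    (hlb : ∀ a ∈ l, decide (some a = o) = b) (hr : decide (r.head? = o) ≠ b)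
    (hs' : s' = update s k r) : Leads (dropProg k b o) s s' := by
  refine (Runs.scan _ _ 1 (by simp) (by simp) l r s hs hl hlb hr).leads_of_eq ?_
  rw [hs']
  funext i
  have : l.flatMap (fun _ => ([] : List (Fin 4 × ℕ))) = [] := by simp
  rw [this]
  by_cases h : i = k
  · subst h; simp
  · simp [h]

theorem leads_copy {s s' : Store (Fin 4)} (hs : ∀ a ∈ s 2, a ∈ [1, 2])
    (hs' : s' = ![(s 2).reverse ++ s 0, (s 2).reverse ++ s 1, [], s 3]) :
    Leads (scanAll (2 : Fin 4) [1, 2] fun a => [(0, a), (1, a)]) s s' := by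
  refine (Runs.scanAll _ _ 2 (by simp) (by simp) s hs).leads_of_eq ?_
  have h : ∀ (i : Fin 4) (l : List ℕ), destined i (l.flatMap fun a => [((0 : Fin 4), a), (1, a)]) =
      if i = 0 ∨ i = 1 then l else [] := by
    intro i l
    induction l with
    | nil => simp
    | cons a l ih => fin_cases i <;> simp_all
  rw [hs']
  funext i
  rw [h]
  fin_cases i <;> simp

theorem leads_push {k : Fin 4} {a : ℕ} {s s' : Store (Fin 4)} (hs' : s' = update s k (a :: s k)) :
    Leads (.push k a) s s' := Runs.push.leads_of_eq hs'.symm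

theorem leads_pop {k : Fin 4} {s s' : Store (Fin 4)} (hs' : s' = update s k (s k).tail) :
    Leads (.pop k) s s' := Runs.pop.leads_of_eq hs'.symm

open ToPartrec (Code)

/-- Remove the first number of the list on stack `0`. -/
def tailProg : Prog (Fin 4) := .seq (dropProg 0 true (some 1)) (.pop 0)

/-- Translate a code for a partial recursive function on lists into a program. The list is kept
on stack `0`, and stack `1` stores intermediate results. -/
def codeProg : Code → Prog (Fin 4)
  | .zero' => .push 0 2
  | .succ => .seq (.seq (moveProg 0 2 true (some 1)) (dropProg 0 false none))
      (.seq (.seq (.push 0 2) (.push 0 1)) (moveProg 2 0 false none))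
  | .tail => tailProg
  | .cons f g =>
    .seq (.seq (.seq (.push 1 0) (moveProg 0 2 false none))
        (scanAll (2 : Fin 4) [1, 2] fun a => [(0, a), (1, a)]))
      (.seq (codeProg f)
        (.seq (.seq (.seq (moveProg 0 2 true (some 1)) (dropProg 0 false none))
            (.seq (moveProg 1 3 false (some 0)) (moveProg 3 0 false none)))
          (.seq (moveProg 2 1 false none)
            (.seq (codeProg g)
              (.seq (.push 0 2) (.seq (moveProg 1 0 true (some 1)) (.pop 1)))))))
  | .comp f g => .seq (codeProg g) (codeProg f)
  | .case f g => .ite 0 (some 1) (.seq (.pop 0) (codeProg g)) (.seq (.pop 0) (codeProg f))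
  | .fix f => .seq (.push 1 3) (.seq (.loop 1 true (some 3) (.seq (codeProg f)
      (.ite 0 (some 1) tailProg (.seq (.pop 0) (.seq (.pop 1) (.push 1 0)))))) (.pop 1))

theorem leads_tailProg (v : List ℕ) (s : List ℕ) :
    Leads tailProg ![unaryList v, s, [], []] ![unaryList v.tail, s, [], []] := by
  obtain ⟨r, h1, h2, h3⟩ := unaryList_eq v
  refine (leads_dropProg (s' := ![r, s, [], []]) _ r h1 ?_ ?_ (by simpa using h2) ?_).seq
    (leads_pop ?_)
  · simp +contextual
  · simp +contextual
  · funext i; fin_cases i <;> simp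
  · funext i; fin_cases i <;> simp [h3]

/-- The invariant that makes the induction compositional: the argument is alone on stack `0`, stacks
`2` and `3` are empty before and after, and whatever is on stack `1` is preserved, so that stack `1`
serves as a call stack. Only arguments where the evaluation is defined are considered, and no time
bound is claimed. -/
theorem leads_codeProg (c : Code) : ∀ v, ∀ v' ∈ c.eval v, ∀ s : List ℕ,
    Leads (codeProg c) ![unaryList v, s, [], []] ![unaryList v', s, [], []] := by
  induction c with
  | zero' =>
    intro v v' h s
    obtain rfl : v' = 0 :: v := by simpa using h
    refine leads_push ?_
    funext i; fin_cases i <;> simp [unaryList]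
  | succ =>
    intro v v' h s
    obtain rfl : v' = [v.headI.succ] := by simpa using h
    obtain ⟨r, h1, h2, h3⟩ := unaryList_eq v
    have hr : ∀ a ∈ r, a ∈ [1, 2] := fun a ha => mem_unaryList (v := v) (by simp [h1, ha])
    refine ((leads_moveProg (s' := ![r, s, List.replicate v.headI 1, []]) (by simp) _ r h1
      ?_ ?_ (by simpa using h2) ?_).seq
      (leads_dropProg (s' := ![[], s, List.replicate v.headI 1, []]) r [] (by simp) hr
        (by simp) (by simp) ?_)).seq
      (((leads_push (s' := ![[2], s, List.replicate v.headI 1, []]) ?_).seq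
      (leads_push (s' := ![[1, 2], s, List.replicate v.headI 1, []]) ?_)).seq
      (leads_moveProg (by simp) (List.replicate v.headI 1) [] (by simp) ?_ (by simp) (by simp) ?_))
    · simp +contextual
    · simp +contextual
    · funext i; fin_cases i <;> simp
    · funext i; fin_cases i <;> simp
    · funext i; fin_cases i <;> simp
    · funext i; fin_cases i <;> simp
    · simp +contextual
    · funext i; fin_cases i <;> simp [unaryList, List.replicate_succ']
  | tail =>
    intro v v' h s
    obtain rfl : v' = v.tail := by simpa using h
    exact leads_tailProg v s
  | cons f g ihf ihg =>
    intro v v' h s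
    obtain ⟨w, hw, u, hu, rfl⟩ : ∃ w ∈ f.eval v, ∃ u ∈ g.eval v, v' = w.headI :: u := by
      simpa [Part.mem_bind_iff, Part.bind_eq_bind, Part.pure_eq_some] using h
    obtain ⟨r, h1, h2, h3⟩ := unaryList_eq w
    have hr : ∀ a ∈ r, a ∈ [1, 2] := fun a ha => mem_unaryList (v := w) (by simp [h1, ha])
    have hn : ∀ a ∈ List.replicate w.headI 1, a ∈ [1, 2] := by simp +contextual
    have hv : ∀ a ∈ unaryList v, a ∈ [1, 2] := fun a => mem_unaryList
    set E := unaryList v with hE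
    set n := List.replicate w.headI 1 with hn'
    -- The argument `E` is saved on stack `1` above the separator `0` while `f` runs. Then the head
    -- `n` of the result is extracted, `E` is brought back to stack `0`, and `n` takes its place
    -- above the separator while `g` runs; finally `n` is put in front of the result.
    refine (((leads_push (s' := ![E, 0 :: s, [], []]) ?_).seq
      (leads_moveProg (s' := ![[], 0 :: s, E.reverse, []]) (by simp) E [] (by simp) hv (by simp)
        (by simp) ?_)).seq
      (leads_copy (s' := ![E, E ++ 0 :: s, [], []]) (by simpa using hv) ?_)).seq
      ((ihf v w hw _).seq
      ((((leads_moveProg (s' := ![r, E ++ 0 :: s, n, []]) (by simp) n r h1 hn ?_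
        (by simpa using h2) ?_).seq
      (leads_dropProg (s' := ![[], E ++ 0 :: s, n, []]) r [] (by simp) hr (by simp)
        (by simp) ?_)).seq
      ((leads_moveProg (s' := ![[], 0 :: s, n, E.reverse]) (by simp) E (0 :: s) (by simp) hv ?_
        (by simp) ?_).seq
      (leads_moveProg (s' := ![E, 0 :: s, n, []]) (by simp) E.reverse [] (by simp)
        (by simpa using hv) (by simp) (by simp) ?_))).seq
      ((leads_moveProg (s' := ![E, n ++ 0 :: s, [], []]) (by simp) n [] (by simp) hn (by simp)
        (by simp) ?_).seq
      ((ihg v u hu _).seq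
      ((leads_push (s' := ![2 :: unaryList u, n ++ 0 :: s, [], []]) ?_).seq
      ((leads_moveProg (s' := ![n ++ 2 :: unaryList u, 0 :: s, [], []]) (by simp) n (0 :: s)
        (by simp) hn ?_ (by simp) ?_).seq
      (leads_pop ?_)))))))
    · funext i; fin_cases i <;> simp
    · funext i; fin_cases i <;> simp
    · funext i; fin_cases i <;> simp
    · simp +contextual [hn']
    · funext i; fin_cases i <;> simp [hn']
    · funext i; fin_cases i <;> simp
    · intro a ha
      have := hv a ha
      simp only [List.mem_cons, List.not_mem_nil, or_false] at this
      rcases this with rfl | rfl <;> simp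
    · funext i; fin_cases i <;> simp
    · funext i; fin_cases i <;> simp
    · funext i; fin_cases i <;> simp [hn']
    · funext i; fin_cases i <;> simp
    · simp +contextual [hn']
    · funext i; fin_cases i <;> simp [hn']
    · funext i; fin_cases i <;> simp [unaryList, hn']
  | comp f g ihf ihg =>
    intro v v' h s
    rw [ToPartrec.Code.comp_eval] at h
    obtain ⟨w, hw, hu⟩ := Part.mem_bind_iff.1 h
    exact (ihg v w hw s).seq (ihf w v' hu s)
  | case f g ihf ihg =>
    intro v v' h s
    rw [ToPartrec.Code.case_eval] at h
    rcases v with _ | ⟨_ | n, v⟩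
    · refine Leads.ite_false (by simp [unaryList])
        ((leads_pop (s' := ![unaryList [], s, [], []]) ?_).seq (ihf _ _ h s))
      funext i; fin_cases i <;> simp [unaryList]
    · refine Leads.ite_false (by simp [unaryList])
        ((leads_pop (s' := ![unaryList v, s, [], []]) ?_).seq (ihf _ _ h s))
      funext i; fin_cases i <;> simp [unaryList]
    · refine Leads.ite_true (by simp [unaryList, List.replicate_succ])
        ((leads_pop (s' := ![unaryList (n :: v), s, [], []]) ?_).seq (ihg _ _ h s))
      funext i; fin_cases i <;> simp [unaryList, List.replicate_succ]
  | fix f ih =>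
    intro v v' h s
    rw [ToPartrec.Code.fix_eval] at h
    -- The loop flag lives on top of stack `1`: `3` means that another iteration is due, and `0`
    -- replaces it as soon as `f` returns a list with head `0`.
    have key : Leads (.loop 1 true (some 3) (.seq (codeProg f)
        (.ite 0 (some 1) tailProg (.seq (.pop 0) (.seq (.pop 1) (.push 1 0))))))
        ![unaryList v, 3 :: s, [], []] ![unaryList v', 0 :: s, [], []] := by
      refine PFun.fixInduction' (C := fun v => Leads _ ![unaryList v, 3 :: s, [], []]
        ![unaryList v', 0 :: s, [], []]) h ?_ ?_
      · intro w hw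
        obtain ⟨u, hu, hu'⟩ := (Part.mem_map_iff _).1 hw
        obtain ⟨r, h1, h2, h3⟩ := unaryList_eq u
        split_ifs at hu' with h0
        obtain rfl : u.tail = v' := by simpa using hu'
        rw [h0] at h1
        refine Leads.loop_step (s' := ![unaryList u.tail, 0 :: s, [], []]) (by simp)
          ((ih w u hu _).seq (Leads.ite_false (by simpa [h1] using h2)
          ((leads_pop (s' := ![unaryList u.tail, 3 :: s, [], []]) ?_).seq
          ((leads_pop (s' := ![unaryList u.tail, s, [], []]) ?_).seq (leads_push ?_)))))
          (Leads.loop_exit (by simp))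
        · funext i; fin_cases i <;> simp [h1, h3]
        · funext i; fin_cases i <;> simp
        · funext i; fin_cases i <;> simp
      · intro w w' hw' hw ihw
        obtain ⟨u, hu, hu'⟩ := (Part.mem_map_iff _).1 hw
        obtain ⟨r, h1, h2, h3⟩ := unaryList_eq u
        split_ifs at hu' with h0
        obtain rfl : u.tail = w' := by simpa using hu'
        refine Leads.loop_step (by simp) ((ih w u hu _).seq
          (Leads.ite_true ?_ (leads_tailProg u _))) ihw
        obtain ⟨n, hn⟩ := Nat.exists_eq_succ_of_ne_zero h0
        simp [h1, hn, List.replicate_succ]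
    refine (leads_push ?_).seq (key.seq (leads_pop ?_))
    · funext i; fin_cases i <;> simp
    · funext i; fin_cases i <;> simp

end CodeProg

end ParamComplexity

/-! ### Programs for computable functions from numbers to words. -/

namespace ParamComplexity

open Function Turing

theorem extend_single {K L : Type} [DecidableEq K] [DecidableEq L] {j : K → L} (hj : Injective j)
    (k : K) (w : List ℕ) : extend j (single k w) (fun _ => []) = single (j k) w := by
  rw [single, ← extend_update hj, single]
  congr 1
  funext l
  by_cases h : ∃ k, j k = l
  · obtain ⟨k, rfl⟩ := h; rw [hj.extend_apply]
  · rw [extend_apply' _ _ _ h]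

section Digits

/-- One step of counting modulo `B`: the residue is on stack `inr 1`, the quotient on
stack `inl 2`. -/
def countProg (B : ℕ) : Prog (Fin 4 ⊕ Fin 3) :=
  .seq (.pop (.inr 0)) (switch (.inr 1) (List.range B) fun r => .seq (.pop (.inr 1))
    (if r + 1 < B then .push (.inr 1) (r + 1) else .seq (.push (.inr 1) 0) (.push (.inl 2) 1)))

/-- Write the reversed list of the digits, to the base `B`, of the unary number on stack `inr 0` to
stack `inr 2`. -/
def digitsProg (B : ℕ) : Prog (Fin 4 ⊕ Fin 3) :=
  .loop (.inr 0) false none (.seq (.seq (.push (.inr 1) 0) (.loop (.inr 0) false none (countProg B)))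
    (.seq (scanAll (.inr 1) (List.range B) fun r => [(.inr 2, r)])
      (scanAll (.inl 2) [1] fun _ => [(.inr 0, 1)])))

/-- Loop invariant: the total `B * q + n + r` never changes. A carry happens when the residue would
reach `B`. -/
theorem leads_countLoop {B : ℕ} (hB : 1 < B) (O : List ℕ) (n r q : ℕ) (hr : r < B) :
    Leads (.loop (.inr 0) false none (countProg B))
      (Sum.elim ![[], [], List.replicate q 1, []] ![List.replicate n 1, [r], O])
      (Sum.elim ![[], [], List.replicate (q + (n + r) / B) 1, []] ![[], [(n + r) % B], O]) := by
  induction n generalizing r q with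
  | zero =>
    rw [Nat.zero_add, Nat.div_eq_of_lt hr, Nat.mod_eq_of_lt hr]
    exact Leads.loop_exit (by simp)
  | succ n ih =>
    have h1 : Leads (K := Fin 4 ⊕ Fin 3) (.pop (.inr 0))
        (Sum.elim ![[], [], List.replicate q 1, []] ![List.replicate (n + 1) 1, [r], O])
        (Sum.elim ![[], [], List.replicate q 1, []] ![List.replicate n 1, [r], O]) := by
      refine Runs.pop.leads_of_eq ?_
      funext i; rcases i with i | i <;> fin_cases i <;> simp [List.replicate_succ]
    by_cases h : r + 1 < B
    · have := ih (r + 1) q h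
      rw [show n + 1 + r = n + (r + 1) by omega]
      refine Leads.loop_step (by simp) (h1.seq ?_) this
      refine Runs.leads (T := 1 + 1 + (List.range B).length) (Runs.switch (a := r)
        (by simpa using hr) (by simp) ((Runs.pop.congr (s'' := Sum.elim ![[], [],
        List.replicate q 1, []] ![List.replicate n 1, [], O]) le_rfl ?_).seq ?_))
      · funext i; rcases i with i | i <;> fin_cases i <;> simp
      · rw [if_pos h]
        refine Runs.push.congr le_rfl ?_
        funext i; rcases i with i | i <;> fin_cases i <;> simp
    · have := ih 0 (q + 1) (by omega)
      obtain rfl : B = r + 1 := by omega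
      rw [show n + 1 + r = n + (r + 1) by omega, Nat.add_mod_right, Nat.add_div_right _ (by omega)]
      rw [Nat.add_zero, Nat.add_right_comm q 1] at this
      refine Leads.loop_step (by simp) (h1.seq ?_) this
      refine Runs.leads (T := 1 + (1 + 1) + (List.range (r + 1)).length) (Runs.switch (a := r)
        (by simp) (by simp) ((Runs.pop.congr (s'' := Sum.elim ![[], [],
        List.replicate q 1, []] ![List.replicate n 1, [], O]) le_rfl ?_).seq ?_))
      · funext i; rcases i with i | i <;> fin_cases i <;> simp
      · rw [if_neg h]
        refine (Runs.push.congr (s'' := Sum.elim ![[], [],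
          List.replicate q 1, []] ![List.replicate n 1, [0], O]) le_rfl ?_).seq
          (Runs.push.congr le_rfl ?_)
        · funext i; rcases i with i | i <;> fin_cases i <;> simp
        · funext i; rcases i with i | i <;> fin_cases i <;> simp [List.replicate_succ]

/-- Repeated division: the residue is the lowest digit and is pushed first, so the highest digit
ends on top, and the quotient takes the place of the number. -/
theorem leads_digitsProg {B : ℕ} (hB : 1 < B) (n : ℕ) (O : List ℕ) :
    Leads (digitsProg B) (Sum.elim ![[], [], [], []] ![List.replicate n 1, [], O])
      (Sum.elim ![[], [], [], []] ![[], [], (Nat.digits B n).reverse ++ O]) := by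
  induction n using Nat.strong_induction_on generalizing O with
  | _ n ih =>
    rcases Nat.eq_zero_or_pos n with rfl | hn
    · rw [Nat.digits_zero]
      exact Leads.loop_exit (by simp)
    · rw [Nat.digits_def' hB hn, List.reverse_cons, List.append_assoc]
      refine Leads.loop_step ?_ (((Runs.push.leads_of_eq (s'' := Sum.elim ![[], [], [], []]
        ![List.replicate n 1, [0], O]) ?_).seq (leads_countLoop hB O n 0 0 (by omega))).seq
        (((Runs.scanAll _ _ 1 (by simp) (by simp) _ ?_).leads_of_eq (s'' := Sum.elim
          ![[], [], List.replicate (n / B) 1, []] ![[], [], n % B :: O]) ?_).seq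
        ((Runs.scanAll _ _ 1 (by simp) (by simp) _ ?_).leads_of_eq ?_)))
        (ih (n / B) (Nat.div_lt_self hn hB) (n % B :: O))
      · obtain ⟨m, rfl⟩ := Nat.exists_eq_succ_of_ne_zero hn.ne'
        simp [List.replicate_succ]
      · funext i; rcases i with i | i <;> fin_cases i <;> simp
      · simp [Nat.mod_lt _ (show 0 < B by omega)]
      · funext i; rcases i with i | i <;> fin_cases i <;> simp
      · simp +contextual
      · have h := fun i l => destined_flatMap_single (I := Fin 4 ⊕ Fin 3) (.inr 0) i (fun _ => 1) l
        funext i; rw [h]; rcases i with i | i <;> fin_cases i <;> simp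

end Digits

theorem primrec_replicate_one : Primrec fun n => List.replicate n 1 :=
  (Primrec.list_map Primrec.list_range (Primrec.const 1).to₂).of_eq fun n => by simp

theorem primrec_ofDigits (B : ℕ) : Primrec fun l : List ℕ => Nat.ofDigits B l :=
  (Primrec.list_foldr (h := fun _ (x : ℕ × ℕ) => x.1 + B * x.2) Primrec.id (Primrec.const 0)
    (Primrec.nat_add.comp (Primrec.fst.comp .snd)
      (Primrec.nat_mul.comp (.const B) (Primrec.snd.comp .snd))).to₂).of_eq fun l => by
    simp [Nat.ofDigits_eq_foldr]

/-- Computable functions from numbers to words can be computed by programs, in computable time. -/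
theorem exists_prog_of_computable {h : ℕ → List ℕ} (hh : Computable h) {B : ℕ} (hB : 1 < B)
    (hd : ∀ k, ∀ a ∈ h k, 0 < a ∧ a < B) :
    ∃ (n : ℕ) (i o : Fin n) (p : Prog (Fin n)) (T : ℕ → ℕ), i ≠ o ∧ Computable T ∧
      ∀ k, Exec p (single i (List.replicate k 1)) (T k) (single o (h k)) := by
  have hg : Computable fun k => Nat.ofDigits B (h k).reverse :=
    (primrec_ofDigits B).to_comp.comp (Computable.list_reverse.comp hh)
  obtain ⟨c, hc⟩ := ToPartrec.Code.exists_code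
    (Nat.Partrec'.part_iff₁.2 (Computable.partrec hg))
  let e := finSumFinEquiv (m := 4) (n := 3)
  let p : Prog (Fin 4 ⊕ Fin 3) :=
    .seq (.seq (.push (.inl 0) 2) (scanAll (.inr 0) [1] fun _ => [(.inl 0, 1)]))
      (.seq ((codeProg c).map .inl)
        (.seq (.seq (scan (.inl 0) true (some 1) [1] fun _ => [(.inr 0, 1)]) (.pop (.inl 0)))
          (digitsProg B)))
  have hp : ∀ k, Leads p (single (.inr 0) (List.replicate k 1)) (single (.inr 2) (h k)) := by
    intro k
    set m := Nat.ofDigits B (h k).reverse with hm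
    -- A word is recovered from the number it denotes because its symbols are below `B` and there is
    -- no leading zero; the latter is why all symbols are required to be positive.
    have hdig : (Nat.digits B m).reverse = h k := by
      rw [hm, Nat.digits_ofDigits B hB _ (fun a ha => (hd k a (by simpa using ha)).2)
        (fun hne => (hd k _ (by simp)).1.ne'), List.reverse_reverse]
    have hs0 : single (.inr 0) (List.replicate k 1) =
        Sum.elim (![[], [], [], []] : Store (Fin 4)) ![List.replicate k 1, [], []] := by
      funext i; rcases i with i | i <;> fin_cases i <;> simp [single]
    have hs1 : single (.inr 2) (h k) =
        Sum.elim (![[], [], [], []] : Store (Fin 4)) ![[], [], h k] := by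
      funext i; rcases i with i | i <;> fin_cases i <;> simp [single]
    have hcode : Leads ((codeProg c).map (Sum.inl : Fin 4 → Fin 4 ⊕ Fin 3))
        (Sum.elim ![unaryList [k], [], [], []] ![[], [], []])
        (Sum.elim ![unaryList [m], [], [], []] ![[], [], []]) := by
      have h1 : [m] ∈ c.eval [k] := by
        have := hc ⟨[k], rfl⟩
        simp only at this
        rw [this]
        simp [hm]
        rfl
      obtain ⟨t, ht⟩ := leads_codeProg c [k] [m] h1 []
      have := ht.map Sum.inl_injective
        (Sum.elim ![[], [], [], []] ![[], [], []] : Store (Fin 4 ⊕ Fin 3))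
      rw [extend_inl, extend_inl] at this
      exact ⟨t, this⟩
    have hdst := fun (i j : Fin 4 ⊕ Fin 3) l => destined_flatMap_single i j (fun _ => 1) l
    rw [hs0, hs1]
    refine ((Runs.push.leads_of_eq (s'' := Sum.elim ![[2], [], [], []]
        ![List.replicate k 1, [], []]) ?_).seq ((Runs.scanAll _ _ 1 (by simp) (by simp) _
        ?_).leads_of_eq ?_)).seq (hcode.seq ((((Runs.scan _ _ 1 (by simp) (by simp)
        (List.replicate m 1) [2] _ ?_ ?_ ?_ (by simp)).leads_of_eq (s'' := Sum.elim
        ![[2], [], [], []] ![List.replicate m 1, [], []]) ?_).seq (Runs.pop.leads_of_eq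
        (s'' := Sum.elim ![[], [], [], []] ![List.replicate m 1, [], []]) ?_)).seq
        (?_ : Leads _ _ _)))
    · funext i; rcases i with i | i <;> fin_cases i <;> simp
    · simp +contextual
    · funext i; rw [hdst]; rcases i with i | i <;> fin_cases i <;> simp [unaryList]
    · simp [unaryList]
    · simp +contextual
    · simp +contextual
    · funext i; rw [hdst]; rcases i with i | i <;> fin_cases i <;> simp
    · funext i; rcases i with i | i <;> fin_cases i <;> simp
    · have := leads_digitsProg hB m []
      rwa [hdig, List.append_nil] at this
  have hq : ∀ k, ∃ t, Exec (p.map e) (single (e (.inr 0)) (List.replicate k 1)) t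
      (single (e (.inr 2)) (h k)) := by
    intro k
    obtain ⟨t, ht⟩ := hp k
    have := ht.map e.injective (fun _ => [])
    rw [extend_single e.injective, extend_single e.injective] at this
    exact ⟨t, this⟩
  choose T hT using hq
  -- The time `T` was merely chosen, but executions are traced by a partial recursive function,
  -- which is defined at all the inputs in question and returns `T`.
  obtain ⟨F, hF, hF'⟩ := exists_partrec_of_exec (p.map e)
  refine ⟨_, e (.inr 0), e (.inr 2), p.map e, T, by simp [e.injective.eq_iff], ?_, hT⟩
  have h1 : Computable fun k => single (e (.inr 0)) (List.replicate k 1) :=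
    (primrec_store_update _ (Primrec.const _) primrec_replicate_one).to_comp
  refine Partrec.of_eq_tot ((hF.comp h1).map (Computable.snd.comp .snd).to₂) fun k => ?_
  exact Part.mem_map _ (hF' _ _ _ (hT k))

end ParamComplexity

/-! ### Letter codes, auxiliary programs and polynomial clocks. -/

namespace ParamComplexity

open Function Turing Computability

section Letters

variable {Γ : Type} [Fintype Γ]

/-- A positive number that stands for a letter of a finite alphabet. -/
noncomputable def letterCode (a : Γ) : ℕ := (Fintype.equivFin Γ a : ℕ) + 1

theorem letterCode_injective : Injective (letterCode : Γ → ℕ) := fun _ _ h =>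
  (Fintype.equivFin Γ).injective (Fin.ext (Nat.succ_injective h))

theorem letterCode_pos (a : Γ) : 0 < letterCode a := Nat.succ_pos _

theorem letterCode_le (a : Γ) : letterCode a ≤ Fintype.card Γ := (Fintype.equivFin Γ a).2

/-- The letter with a given code. -/
noncomputable def letterOf [Nonempty Γ] : ℕ → Γ := invFun letterCode

theorem leftInverse_letterOf [Nonempty Γ] : LeftInverse (letterOf : ℕ → Γ) letterCode :=
  leftInverse_invFun letterCode_injective

@[simp] theorem letterOf_letterCode [Nonempty Γ] (a : Γ) : letterOf (letterCode a) = a :=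
  leftInverse_letterOf a

variable (Γ) in
/-- The codes of all letters. -/
noncomputable def letters : List ℕ := letterCodes (letterCode : Γ → ℕ)

theorem mem_letters_of_mem_map {w : List Γ} {a : ℕ} (h : a ∈ w.map letterCode) : a ∈ letters Γ := by
  obtain ⟨b, -, rfl⟩ := List.mem_map.1 h
  exact mem_letterCodes _ b

end Letters

theorem eval_le_eval_of_le (p : Polynomial ℕ) {m n : ℕ} (h : m ≤ n) : p.eval m ≤ p.eval n := by
  rw [Polynomial.eval_eq_sum_range, Polynomial.eval_eq_sum_range]
  gcongr

section Machines

variable {Γ₀ Γ₁ : Type} [Fintype Γ₀] [Fintype Γ₁]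

/-- The store with a reversed word on stack `i`. -/
noncomputable def wordStore {K : Type} [DecidableEq K] {Γ : Type} [Fintype Γ] (i : K)
    (w : List Γ) : Store K := single i (w.map letterCode).reverse

theorem Runs.length_out_le {K : Type} [DecidableEq K] {p : Prog K} {i o : K} (hio : i ≠ o)
    {w : List Γ₀} {w' : List Γ₁} {T : ℕ} (h : Runs p (wordStore i w) T (wordStore o w')) :
    w'.length ≤ T := by
  simpa [wordStore, single, hio.symm] using h.length_le o

/-- Functions that are computed by programs in polynomial time are computed by machines in
polynomial time. -/
theorem computableInPolyTime_of_runs {α β K : Type} [DecidableEq K] [Fintype K] [Inhabited Γ₁]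
    {ea : α → List Γ₀} {eb : β → List Γ₁} {f : α → β} (p : Prog K) {i o : K} (hio : i ≠ o)
    (T : Polynomial ℕ)
    (h : ∀ a, Runs p (wordStore i (ea a)) (T.eval (ea a).length) (wordStore o (eb (f a)))) :
    Nonempty (TM2ComputableInPolyTime ea eb f) := by
  -- Compilation adds the lengths of input and output and `2`; the output is at most as long as the
  -- running time, whence the factor in `2 * T`.
  refine ⟨⟨ioMachine p i o letterCode letterOf, 2 * T + Polynomial.X + 2, fun a => ?_⟩⟩
  have h1 := (h a).length_out_le hio
  have h2 := ((h a).outputsInTime leftInverse_letterOf).some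
  refine ⟨h2.toEvalsTo, h2.steps_le_m.trans ?_⟩
  simp
  omega

end Machines

section Clear

variable {K : Type} [DecidableEq K]

/-- Clear the stacks of a list. -/
def clearProg (syms : List ℕ) (l : List K) : Prog K :=
  l.foldr (fun k p => .seq (scanAll k syms fun _ => []) p) .skip

theorem runs_clear {syms : List ℕ} {k : K} {s : Store K} (hs : ∀ a ∈ s k, a ∈ syms) :
    Runs (scanAll k syms fun _ => []) s ((s k).length * (syms.length + 3) + 1) (update s k []) := by
  refine (Runs.scanAll _ _ 0 (by simp) (by simp) s hs).congr (by simp) ?_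
  have : (s k).flatMap (fun _ => ([] : List (K × ℕ))) = [] := by simp
  rw [this]
  funext i
  by_cases h : i = k
  · subst h; simp
  · simp [h]

theorem runs_clearProg {syms : List ℕ} {B : ℕ} (l : List K) (s : Store K)
    (hs : ∀ k ∈ l, ∀ a ∈ s k, a ∈ syms) (hB : ∀ k ∈ l, (s k).length ≤ B) :
    Runs (clearProg syms l) s (l.length * (B * (syms.length + 3) + 1) + 1)
      (fun k => if k ∈ l then [] else s k) := by
  induction l generalizing s with
  | nil => exact Runs.skip.congr (by simp) (by simp)
  | cons k l ih =>
    refine ((runs_clear (hs k (by simp))).seq (ih _ ?_ ?_)).congr ?_ ?_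
    · intro i hi a ha
      by_cases h : i = k
      · subst h; simp at ha
      · exact hs i (by simp [hi]) a (by simpa [h] using ha)
    · intro i hi
      by_cases h : i = k
      · subst h; simp
      · simpa [h] using hB i (by simp [hi])
    · have := Nat.mul_le_mul_right (syms.length + 3) (hB k (by simp))
      simp only [List.length_cons]
      rw [Nat.add_mul]
      omega
    · funext i
      by_cases h : i = k
      · subst h; simp
      · simp [h]

end Clear

section Move

variable {K : Type} [DecidableEq K]

/-- Reverse stack `k` onto stack `k'`, translating the symbols. -/
def transferProg (syms : List ℕ) (g : ℕ → ℕ) (k k' : K) : Prog K :=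
  scanAll k syms fun a => [(k', g a)]

theorem runs_transferProg {syms : List ℕ} {g : ℕ → ℕ} {k k' : K} (hk : k' ≠ k) {s : Store K}
    (hs : ∀ a ∈ s k, a ∈ syms) : Runs (transferProg syms g k k') s
      ((s k).length * (syms.length + 4) + 1)
      (update (update s k []) k' (((s k).map g).reverse ++ s k')) := by
  refine (Runs.scanAll _ _ 1 (by simp [hk]) (by simp) s hs).congr ?_ ?_
  · exact le_of_eq (by ring)
  · funext i
    rw [destined_flatMap_single]
    by_cases h : i = k
    · subst h; simp [hk.symm]
    · by_cases h' : i = k'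
      · subst h'; simp [h]
      · simp [h, h', Ne.symm h']

end Move

theorem destined_replicate {K : Type} [DecidableEq K] (k c : K) (x b : ℕ) :
    destined k (List.replicate b (c, x)) = if c = k then List.replicate b x else [] := by
  induction b with
  | zero => simp
  | succ b ih =>
    rw [List.replicate_succ, destined_cons, ih]
    split_ifs <;> simp [List.replicate_succ]

section Clock

variable {K : Type} [DecidableEq K]

/-- Horner's scheme in unary: adding a constant means pushing that many ones, and multiplying by the
argument means replacing each one on `c` by a copy of stack `a`. Stack `t` holds the old value as a
loop counter, and `u` holds `a` during copying, so that `a` is restored each time. -/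
theorem exists_clockProg {a c t u : K} (hac : a ≠ c) (hat : a ≠ t) (hau : a ≠ u) (hct : c ≠ t)
    (hcu : c ≠ u) (htu : t ≠ u) (P : Polynomial ℕ) : ∃ (p : Prog K) (Q : Polynomial ℕ),
    ∀ (n : ℕ) (s : Store K), s a = List.replicate n 1 → s c = [] → s t = [] → s u = [] →
      Runs p s (Q.eval n) (update s c (List.replicate (P.eval n) 1)) := by
  induction P using Polynomial.recOnHorner with
  | M0 =>
    refine ⟨.skip, 1, fun n s _ hc _ _ => Runs.skip.congr (by simp) ?_⟩
    simp [← hc]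
  | MC P b _ _ ih =>
    obtain ⟨p, Q, hp⟩ := ih
    refine ⟨.seq p (pushAll (List.replicate b (c, 1))), Q + Polynomial.C (b + 1),
      fun n s ha hc ht hu => ((hp n s ha hc ht hu).seq (Runs.pushAll _ _)).congr (by simp) ?_⟩
    funext k
    rw [destined_replicate]
    by_cases h : k = c
    · subst h; simp [Nat.add_comm]
    · simp [h, Ne.symm h]
  | MX P _ ih =>
    obtain ⟨p, Q, hp⟩ := ih
    let body : Prog K := .seq (.pop t) (.seq (scanAll a [1] fun _ => [(u, 1), (c, 1)])
      (transferProg [1] id u a))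
    have hbody : ∀ n v m s, s a = List.replicate n 1 → s u = [] → s c = List.replicate m 1 →
        s t = List.replicate (v + 1) 1 → Runs body s (11 * n + 3)
          (update (update s c (List.replicate (m + n) 1)) t (List.replicate v 1)) := by
      intro n v m s ha hu hc ht
      have hd : ∀ k, destined k ((List.replicate n 1).flatMap fun _ => [(u, 1), (c, 1)]) =
          if k = u ∨ k = c then List.replicate n 1 else [] := by
        intro k
        clear ha
        induction n with
        | zero => simp
        | succ n ih =>
          rw [List.replicate_succ, List.flatMap_cons, destined_append, ih]
          by_cases h : k = u
          · subst h; simp [hcu]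
          · by_cases h' : k = c
            · subst h'; simp [Ne.symm h]
            · simp [h, h', Ne.symm h, Ne.symm h']
      have h1 : Runs (.pop t) s 1 (update s t (List.replicate v 1)) :=
        Runs.pop.congr le_rfl (by simp [ht])
      have h2 : Runs (scanAll a [1] fun _ => [(u, 1), (c, 1)]) (update s t (List.replicate v 1))
          (n * 6 + 1) (update (update (update (update s t (List.replicate v 1)) a [])
            u (List.replicate n 1)) c (List.replicate (m + n) 1)) := by
        refine (Runs.scanAll _ _ 2 ?_ (by simp) _ ?_).congr ?_ ?_
        · simp [hau.symm, hac.symm]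
        · simp [hat, ha]
        · simp [hat, ha]
        · funext k
          rw [update_of_ne hat, ha, hd]
          by_cases h : k = c
          · subst h
            simp [hac.symm, hct, hc, Nat.add_comm m]
          · by_cases h' : k = u
            · subst h'; simp [h, hau.symm, htu.symm, hu]
            · by_cases h'' : k = a
              · subst h''; simp [h, h']
              · simp [h, h', h'']
      refine (h1.seq (h2.seq (runs_transferProg hau ?_))).congr ?_ ?_
      · simp [hcu.symm]
      · simp [hcu.symm]; omega
      · funext k
        by_cases h : k = t
        · subst h; simp [hat.symm, htu, hct.symm]
        · by_cases h' : k = c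
          · subst h'; simp [hac.symm, hcu, hct]
          · by_cases h'' : k = u
            · subst h''; simp [h, h', hau.symm, hu]
            · by_cases h3 : k = a
              · subst h3; simp [h, h', ha, hau, hcu.symm]
              · simp [h, h', h'', h3]
    -- Generalised over the current value `m` of the clock, since every pass adds `n` to it.
    have hloop : ∀ n v m s, s a = List.replicate n 1 → s u = [] → s c = List.replicate m 1 →
        s t = List.replicate v 1 → Runs (.loop t false none body) s (v * (11 * n + 4) + 1)
          (update (update s c (List.replicate (m + v * n) 1)) t []) := by
      intro n v
      induction v with
      | zero =>
        intro m s ha hu hc ht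
        refine (Runs.loop_exit (by simp [ht])).congr (by simp) ?_
        funext k
        by_cases h : k = t
        · subst h; simp [ht]
        · by_cases h' : k = c
          · subst h'; simp [h, hc]
          · simp [h, h']
      | succ v ih =>
        intro m s ha hu hc ht
        refine (Runs.loop_step (by simp [ht, List.replicate_succ]) (hbody n v m s ha hu hc ht)
          (ih (m + n) _ ?_ ?_ ?_ ?_)).congr ?_ ?_
        · simp [hat, hac, ha]
        · simp [htu.symm, hcu.symm, hu]
        · simp [hct]
        · simp
        · exact le_of_eq (by ring)
        · funext k
          by_cases h : k = t
          · subst h; simp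
          · by_cases h' : k = c
            · subst h'; simp [h, Nat.add_mul, Nat.add_assoc, Nat.add_comm n]
            · simp [h, h']
    refine ⟨.seq p (.seq (transferProg [1] id c t) (.loop t false none body)),
      Q + (P * 5 + 1 + (P * (11 * Polynomial.X + 4) + 1)), fun n s ha hc ht hu => ?_⟩
    refine ((hp n s ha hc ht hu).seq ((runs_transferProg hct.symm ?_).seq
      (hloop n (P.eval n) 0 _ ?_ ?_ ?_ ?_))).congr ?_ ?_
    · simp +contextual
    · simp [hat, hac, ha]
    · simp [htu.symm, hcu.symm, hu]
    · simp [hct]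
    · simp [hct.symm, ht]
    · simp
    · funext k
      by_cases h : k = t
      · subst h; simp [hct.symm, ht]
      · by_cases h' : k = c
        · subst h'; simp [h]
        · simp [h, h']

end Clock

end ParamComplexity

/-! ### Clocked simulation. -/

namespace ParamComplexity

open Function Turing Computability

section ClockedRun

variable {K Λ σ : Type} {Γ : K → Type} [DecidableEq K] {M : Λ → TM2.Stmt Γ Λ σ} (cd : Coding M)

/-- The next configuration; a halted configuration does not change. -/
def nextCfg (M : Λ → TM2.Stmt Γ Λ σ) (c : TM2.Cfg Γ Λ σ) : TM2.Cfg Γ Λ σ := (TM2.step M c).getD c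

theorem nextCfg_of_halted {c : TM2.Cfg Γ Λ σ} (h : c.l = none) : nextCfg M c = c := by
  rcases c with ⟨_ | l, v, S⟩
  · rfl
  · simp at h

theorem Steps.iterate_nextCfg {t : ℕ} {c c' : TM2.Cfg Γ Λ σ} (h : Steps (TM2.step M) t c c') :
    (nextCfg M)^[t] c = c' := by
  induction t generalizing c with
  | zero => simpa [Steps] using h
  | succ t ih =>
    rw [Steps, iterate_succ_apply] at h
    rcases h1 : TM2.step M c with _ | c1
    · rw [show flip bind (TM2.step M) (some c) = none from h1, iterate_fixed rfl] at h
      simp at h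
    · rw [show flip bind (TM2.step M) (some c) = some c1 from h1] at h
      rw [iterate_succ_apply, nextCfg, h1]
      exact ih h

/-- Halted configurations are fixed points of `nextCfg`, so a clock that is too generous does no
harm. -/
theorem iterate_nextCfg_of_le {c : TM2.Cfg Γ Λ σ} {t m : ℕ} (h : ((nextCfg M)^[t] c).l = none)
    (htm : t ≤ m) : (nextCfg M)^[m] c = (nextCfg M)^[t] c := by
  obtain ⟨d, rfl⟩ := Nat.exists_eq_add_of_le' htm
  rw [iterate_add_apply, iterate_fixed (nextCfg_of_halted h)]

omit [DecidableEq K] in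
theorem Coding.mem_codes_of_mem_cfgStore {c : TM2.Cfg Γ Λ σ} (hc : cd.GoodStk c.stk) {k : Option K}
    {a : ℕ} (ha : a ∈ cd.cfgStore c k) : a ∈ cd.codes := by
  rcases k with _ | k
  · rcases c with ⟨_ | l, v, S⟩
    · simp [Coding.cfgStore, Coding.store] at ha
    · obtain rfl : a = cd.encC (l, v) := by simpa [Coding.cfgStore, Coding.store] using ha
      exact cd.encC_mem _
  · simp only [Coding.cfgStore, Coding.store, List.mem_map] at ha
    obtain ⟨b, hb, rfl⟩ := ha
    exact cd.enc_mem (hc k b hb)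

variable {R : Type} [DecidableEq R]

/-- Simulate as many steps of a machine as there are symbols on stack `clk`. -/
def Coding.clockedProg (clk : R) : Prog (Option K ⊕ R) :=
  .loop (.inr clk) false none (.seq (.pop (.inr clk))
    (.ite (.inl none) none .skip (cd.stepProg.map .inl)))

/-- The clock is always drained completely: once the machine has halted, the remaining ticks do
nothing. Hence the final store is described by a total iteration, whether or not the machine halts
in time. -/
theorem Coding.exists_runs_clockedProg [Finite Λ] (clk : R) : ∃ C, ∀ (m : ℕ) (c : TM2.Cfg Γ Λ σ)
    (r : Store R), cd.GoodStk c.stk → r clk = List.replicate m 1 →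
    Runs (cd.clockedProg clk) (Sum.elim (cd.cfgStore c) r) (m * C + 1)
      (Sum.elim (cd.cfgStore ((nextCfg M)^[m] c)) (update r clk [])) ∧
    cd.GoodStk ((nextCfg M)^[m] c).stk := by
  obtain ⟨C, hC⟩ := cd.exists_runs_stepProg
  refine ⟨C + 4, fun m => ?_⟩
  induction m with
  | zero =>
    intro c r hc hr
    refine ⟨(Runs.loop_exit (by simp [hr])).congr (by simp) ?_, hc⟩
    rw [iterate_zero, id, ← show r clk = [] by simpa using hr, update_eq_self]
  | succ m ih =>
    intro c r hc hr
    have h1 : Runs (.pop (.inr clk)) (Sum.elim (cd.cfgStore c) r) 1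
        (Sum.elim (cd.cfgStore c) (update r clk (List.replicate m 1))) :=
      Runs.pop.congr le_rfl (by
        rw [Sum.update_elim_inr, Sum.elim_inr, hr, List.replicate_succ, List.tail_cons])
    have h2 : Runs (.ite (.inl none) none .skip (cd.stepProg.map .inl))
        (Sum.elim (cd.cfgStore c) (update r clk (List.replicate m 1))) (C + 2)
        (Sum.elim (cd.cfgStore (nextCfg M c)) (update r clk (List.replicate m 1))) ∧
        cd.GoodStk (nextCfg M c).stk := by
      rcases hl : c.l with _ | l
      · rw [nextCfg_of_halted hl]
        exact ⟨(Runs.ite_true (by simp [Coding.cfgStore, Coding.store, hl]) Runs.skip).mono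
          (by omega), hc⟩
      · obtain ⟨c1, h1⟩ : ∃ c1, TM2.step M c = some c1 := by
          rcases c with ⟨_ | l, v, S⟩
          · simp at hl
          · exact ⟨_, rfl⟩
        rw [nextCfg, h1]
        obtain ⟨h2, h3⟩ := hC c c1 hc h1
        have h4 := h2.map (j := (Sum.inl : _ → Option K ⊕ R)) Sum.inl_injective
          (Sum.elim (cd.cfgStore c) (update r clk (List.replicate m 1)))
        rw [extend_inl, extend_inl] at h4
        exact ⟨(Runs.ite_false (by simp [Coding.cfgStore, Coding.store, hl]) h4).mono
          (by omega), h3⟩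
    obtain ⟨h3, h4⟩ := ih _ (update r clk (List.replicate m 1)) h2.2 (by simp)
    refine ⟨(Runs.loop_step (by simp [hr, List.replicate_succ]) (h1.seq h2.1) h3).congr ?_ ?_, h4⟩
    · rw [Nat.add_mul]; omega
    · rw [update_idem, iterate_succ_apply]

end ClockedRun

section Kernel

variable {A : Type} [Fintype A]

omit [Fintype A] in
theorem countP_isLeft_encode (x : List A) (k : ℕ) :
    ((instanceEncoding A).encode (x, k)).countP Sum.isLeft = x.length := by
  simp [instanceEncoding, encodingProd, encodingList, List.countP_eq_length_filter,
    List.filter_map, Function.comp_def]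

/-- The symbols that are pushed when a symbol of the input is read: two copies of the symbol, and a
mark for a letter of the word `x` of an instance `(x, k)`. -/
noncomputable def splitMarks {K : Type} (n : ℕ) : List ((K ⊕ Fin 8) × ℕ) :=
  (.inr 1, n) :: (.inr 2, n) :: if (letterOf n : A ⊕ Bool).isLeft then [(.inr 3, 1)] else []

theorem destined_splitMarks {K : Type} [DecidableEq K] (w : List (A ⊕ Bool)) (i : K ⊕ Fin 8) :
    destined i ((w.map letterCode).flatMap (splitMarks (A := A))) =
      if i = .inr 1 ∨ i = .inr 2 then w.map letterCode else
      if i = .inr 3 then List.replicate (w.countP Sum.isLeft) 1 else [] := by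
  induction w with
  | nil => simp
  | cons a w ih =>
    rw [List.map_cons, List.flatMap_cons, destined_append, ih]
    by_cases h1 : i = .inr 1
    · subst h1; cases a <;> simp [splitMarks]
    · by_cases h2 : i = .inr 2
      · subst h2; cases a <;> simp [splitMarks]
      · by_cases h3 : i = .inr 3
        · subst h3; cases a <;> simp [splitMarks, List.replicate_succ, List.countP_cons]
        · cases a <;> simp [splitMarks, h1, h2, h3, Ne.symm h1, Ne.symm h2, Ne.symm h3]

end Kernel

end ParamComplexity

/-! ### The kernelization program. -/

namespace ParamComplexity

open Function Turing Computability

section Kernel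

variable {A : Type} [Fintype A]

/-- Runs `M` under the clock P(|x|) and outputs `y` or `z` according to the answer, or the untouched
input if the clock runs out first. Neither the correctness of `M` nor `f` enters here; all that is
needed is that a configuration halted by then is a proper output `[b]`. -/
theorem exists_kernelProg (M : TM2ComputableAux (A ⊕ Bool) Bool) (P : Polynomial ℕ)
    (y z : Instance A) : ∃ (p : Prog (Option M.tm.K ⊕ Fin 8)) (T : Polynomial ℕ),
    ∀ (x : List A) (k : ℕ) (b : Bool) (c : TM2.Cfg M.tm.Γ M.tm.Λ M.tm.σ),
      (nextCfg M.tm.m)^[P.eval x.length] (initList M.tm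
        (((instanceEncoding A).encode (x, k)).map M.inputAlphabet.invFun)) = c →
      (c.l = none → c = haltList M.tm ([b].map M.outputAlphabet.invFun)) →
      Runs p (wordStore (.inr 0) ((instanceEncoding A).encode (x, k)))
        (T.eval (x.length + k)) (wordStore (.inr 6) ((instanceEncoding A).encode
          (if c.l = none then bif b then y else z else (x, k)))) := by
  classical
  have := M.tm.ΛFin
  have := M.tm.σFin
  have : Fintype M.tm.K := M.tm.kFin
  have : Finite (M.tm.Γ M.tm.k₀) := Finite.of_equiv _ M.inputAlphabet.symm
  obtain ⟨cd, hcd⟩ := exists_coding M.tm.m M.tm.k₀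
  obtain ⟨Cr, hCr⟩ := cd.exists_runs_clockedProg (4 : Fin 8)
  obtain ⟨pc, Qc, hpc⟩ := exists_clockProg (K := Option M.tm.K ⊕ Fin 8) (a := .inr 3) (c := .inr 4)
    (t := .inr 5) (u := .inr 7) (by simp) (by simp) (by simp) (by simp) (by simp) (by simp) P
  set L := (letters (A ⊕ Bool)).length with hL
  set κ := (Finset.univ : Finset (Option M.tm.K)).toList.map
    (Sum.inl : _ → Option M.tm.K ⊕ Fin 8) with hκ
  set C := cd.codes.length with hC
  let out (a : Instance A) : List ((Option M.tm.K ⊕ Fin 8) × ℕ) :=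
    ((instanceEncoding A).encode a).map fun l => (.inr 6, letterCode l)
  have hj : Injective (Sum.inl : Option M.tm.K → Option M.tm.K ⊕ Fin 8) := Sum.inl_injective
  -- Roles of the auxiliary stacks: `0` input, `1` and `2` copies of it (one to be run, one to be
  -- returned if time runs out), `3` the length of `x` in unary, `4` the clock, `5` and `7` scratch
  -- for the clock, `6` output. Stack `7` later receives the answer of `M`.
  refine ⟨.seq (scanAll (.inr 0) (letters (A ⊕ Bool)) (splitMarks (A := A)))
    (.seq pc (.seq (transferProg (letters (A ⊕ Bool)) id (.inr 1) (.inr 0))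
    (.seq (loadProg M cd .inl letterCode letterOf (.inr 0))
    (.seq (scanAll (.inr 3) [1] fun _ => [])
    (.seq (startProg M cd .inl) (.seq (cd.clockedProg 4)
    (.ite (.inl none) none
      (.seq (unloadProg M cd .inl letterCode (.inr 7))
        (.seq (scanAll (.inr 2) (letters (A ⊕ Bool)) fun _ => [])
        (.ite (.inr 7) (some (letterCode true)) (.seq (.pop (.inr 7)) (pushAll (out y)))
          (.seq (.pop (.inr 7)) (pushAll (out z))))))
      (.seq (clearProg cd.codes κ)
        (transferProg (letters (A ⊕ Bool)) id (.inr 2) (.inr 6)))))))))),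
    (.X * (3 + L + 3) + 1 : Polynomial ℕ) + (Qc + ((.X * (L + 4) + 1) +
      ((.X * (1 + L + 3) + 1) + ((.X * 4 + 1) + (1 + ((P * Cr + 1) +
      (((5 + C) + (.X * (L + 3) + 1) + (1 + (1 + (y.size + 1)) + (1 + (z.size + 1))) + 1) +
      (κ.length * ((.X + 1 + (P * Cr + 1)) * (C + 3) + 1) + 1 + (.X * (L + 4) + 1) + 1)))))))),
    ?_⟩
  intro x k b c hc hcb
  set w := (instanceEncoding A).encode (x, k) with hw
  set n := x.length with hn
  have hwl : w.length = n + k := length_instanceEncoding (x, k)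
  set V := w.map letterCode with hV
  have hVl : V.length = n + k := by simp [hV, hwl]
  have hVm : ∀ a ∈ V, a ∈ letters (A ⊕ Bool) := fun a ha => mem_letters_of_mem_map ha
  let E : Store (Option M.tm.K) := fun _ => []
  have h0 : (wordStore (.inr 0) w : Store (Option M.tm.K ⊕ Fin 8)) =
      Sum.elim E ![V.reverse, [], [], [], [], [], [], []] := by
    funext i
    rcases i with i | i
    · simp [wordStore, single, E]
    · fin_cases i <;> simp [wordStore, single, hV]
  have h1 : Runs (scanAll (.inr 0) (letters (A ⊕ Bool)) (splitMarks (A := A)))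
      (wordStore (.inr 0) w : Store (Option M.tm.K ⊕ Fin 8)) ((n + k) * (3 + L + 3) + 1)
      (Sum.elim E ![[], V, V, List.replicate n 1, [], [], [], []]) := by
    have hd : V.reverse = w.reverse.map letterCode := by simp [hV]
    rw [h0]
    refine (Runs.scanAll _ _ 3 ?_ ?_ _ ?_).congr ?_ ?_
    · intro a _ x hx
      simp only [splitMarks, List.mem_cons] at hx
      rcases hx with rfl | rfl | hx
      · simp
      · simp
      · split_ifs at hx
        · simp at hx; subst hx; simp
        · simp at hx
    · intro a _
      simp only [splitMarks]
      split_ifs <;> simp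
    · simpa using hVm
    · simp [hVl, hL]
    · have hcount : w.countP Sum.isLeft = n := countP_isLeft_encode x k
      funext i
      simp only [Sum.elim_inr, Matrix.cons_val_zero]
      rw [hd, destined_splitMarks]
      rcases i with i | i
      · simp [E]
      · fin_cases i <;> simp [hV, hcount]
  have h2 : Runs pc (Sum.elim E ![[], V, V, List.replicate n 1, [], [], [], []]) (Qc.eval n)
      (Sum.elim E ![[], V, V, List.replicate n 1, List.replicate (P.eval n) 1, [], [], []]) := by
    refine (hpc n _ (by simp) (by simp) (by simp) (by simp)).congr le_rfl ?_
    rw [Sum.update_elim_inr]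
    congr 1
    funext i; fin_cases i <;> simp
  set clk := List.replicate (P.eval n) 1 with hclk
  have h3 : Runs (transferProg (letters (A ⊕ Bool)) id (.inr 1) (.inr 0))
      (Sum.elim E ![[], V, V, List.replicate n 1, clk, [], [], []]) ((n + k) * (L + 4) + 1)
      (Sum.elim E ![V.reverse, [], V, List.replicate n 1, clk, [], [], []]) := by
    refine (runs_transferProg (by simp) (by simpa using hVm)).congr (by simp [hVl, hL]) ?_
    rw [Sum.update_elim_inr, Sum.update_elim_inr]
    congr 1
    funext i; fin_cases i <;> simp
  set S₀ : ∀ i, List (M.tm.Γ i) := update (fun _ => []) M.tm.k₀ (w.map M.inputAlphabet.symm)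
    with hS₀
  have h4 := runs_loadProg (cd := cd) hj leftInverse_letterOf (by simp) w
    (Sum.elim E ![V.reverse, [], V, List.replicate n 1, clk, [], [], []]) (i := .inr 0)
    (by simp [E]) (by simp [hV])
  rw [← hS₀, extend_inl, hwl] at h4
  have h5 : Runs (scanAll (.inr 3) [1] fun _ => [])
      (Sum.elim (cd.store [] S₀) fun i => update (Sum.elim E ![V.reverse, [], V, List.replicate n 1,
        clk, [], [], []]) (.inr 0) [] (.inr i)) (n * 4 + 1)
      (Sum.elim (cd.store [] S₀) ![[], [], V, [], clk, [], [], []]) := by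
    refine (runs_clear ?_).congr (by simp) ?_
    · simp +contextual
    · rw [Sum.update_elim_inr]
      congr 1
      funext i; fin_cases i <;> simp
  set r : Store (Fin 8) := ![[], [], V, [], clk, [], [], []] with hr
  set c₀ : TM2.Cfg M.tm.Γ M.tm.Λ M.tm.σ := ⟨some M.tm.main, M.tm.initialState, S₀⟩ with hc₀
  have h6 := runs_startProg (cd := cd) hj S₀ (Sum.elim E r)
  rw [extend_inl, extend_inl, ← hc₀] at h6
  have hinit : initList M.tm (w.map M.inputAlphabet.invFun) = c₀ := initList_eq _ _
  rw [hinit] at hc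
  have hgood : cd.GoodStk c₀.stk := fun i a ha => by
    by_cases hi : i = M.tm.k₀
    · subst hi; exact hcd a
    · simp [hc₀, hS₀, hi] at ha
  obtain ⟨h7, hgood'⟩ := hCr (P.eval n) c₀ r hgood (by simp [hr, hclk])
  rw [hc] at h7 hgood'
  have hr' : update r 4 [] = ![[], [], V, [], [], [], [], []] := by
    funext i; fin_cases i <;> simp [hr]
  rw [hr'] at h7
  have hfin : ∀ a : Instance A, Runs (pushAll (out a))
      (fun _ => [] : Store (Option M.tm.K ⊕ Fin 8)) (a.size + 1)
      (wordStore (.inr 6) ((instanceEncoding A).encode a)) := fun a => by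
    refine (Runs.pushAll _ _).congr (by simp [out, length_instanceEncoding]) ?_
    have hd : ∀ i (l : List (A ⊕ Bool)), destined i (l.map fun a =>
        ((.inr 6 : Option M.tm.K ⊕ Fin 8), letterCode a)) =
        if i = .inr 6 then l.map letterCode else [] := fun i l => by
      induction l with
      | nil => simp
      | cons a l ih =>
        rw [List.map_cons, destined_cons, ih]
        by_cases h : i = .inr 6
        · subst h; simp
        · simp [h, Ne.symm h]
    funext i
    rw [hd]
    by_cases h : i = .inr 6
    · subst h; simp [wordStore, single]
    · simp [wordStore, single, h]
  have h8 : Runs (.ite (.inl none) none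
      (.seq (unloadProg M cd .inl letterCode (.inr 7))
        (.seq (scanAll (.inr 2) (letters (A ⊕ Bool)) fun _ => [])
        (.ite (.inr 7) (some (letterCode true)) (.seq (.pop (.inr 7)) (pushAll (out y)))
          (.seq (.pop (.inr 7)) (pushAll (out z))))))
      (.seq (clearProg cd.codes κ)
        (transferProg (letters (A ⊕ Bool)) id (.inr 2) (.inr 6))))
      (Sum.elim (cd.cfgStore c) ![[], [], V, [], [], [], [], []])
      (((5 + C) + ((n + k) * (L + 3) + 1) + (1 + (1 + (y.size + 1)) + (1 + (z.size + 1))) + 1) +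
      (κ.length * (((n + k) + 1 + (P.eval n * Cr + 1)) * (C + 3) + 1) + 1 +
        ((n + k) * (L + 4) + 1) + 1))
      (wordStore (.inr 6) ((instanceEncoding A).encode
          (if c.l = none then bif b then y else z else (x, k)))) := by
    by_cases hl : c.l = none
    · rw [if_pos hl]
      have hcb := hcb hl
      rw [haltList_eq] at hcb
      have g1 := runs_unloadProg (cd := cd) hj (e₁ := letterCode) (o := .inr 7) (by simp) [b]
        M.tm.initialState (Sum.elim E ![[], [], V, [], [], [], [], []]) (by simp [E])
        (by rw [hcb] at hgood'; exact hgood')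
      rw [extend_inl] at g1
      have g2 : Runs (scanAll (.inr 2) (letters (A ⊕ Bool)) fun _ => [])
          (update (Sum.elim E ![[], [], V, [], [], [], [], []]) (.inr 7)
            (([b].map letterCode).reverse ++ []))
          ((n + k) * (L + 3) + 1)
          (Sum.elim E ![[], [], [], [], [], [], [], [letterCode b]]) := by
        refine (runs_clear ?_).congr (by simp [hVl, hL]) ?_
        · simpa using hVm
        · rw [Sum.update_elim_inr, Sum.update_elim_inr]
          congr 1
          funext i; fin_cases i <;> simp
      have g3 : Runs (.pop (.inr 7)) (Sum.elim E ![[], [], [], [], [], [], [], [letterCode b]]) 1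
          (fun _ => [] : Store (Option M.tm.K ⊕ Fin 8)) := by
        refine Runs.pop.congr le_rfl ?_
        rw [Sum.update_elim_inr]
        funext i
        rcases i with i | i
        · simp [E]
        · fin_cases i <;> simp
      refine (Runs.ite_true ?_ ((?_ : Runs _ _ (1 * (1 + C + 3) + 1) _).seq (g2.seq (?_ :
        Runs _ _ (1 + (1 + (y.size + 1)) + (1 + (z.size + 1))) _)))).mono ?_
      · rw [hcb]; simp [Coding.cfgStore, Coding.store]
      · rw [hcb]; exact g1
      · cases b
        · exact (Runs.ite_false (by simp [letterCode_injective.eq_iff]) (g3.seq (hfin z))).mono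
            (by omega)
        · exact (Runs.ite_true (by simp) (g3.seq (hfin y))).mono (by omega)
      · omega
    · rw [if_neg hl]
      -- An interrupted machine leaves debris on its stacks, which has to be cleared; its size is at
      -- most the initial length plus the simulation time.
      have hlen : ∀ i, (cd.cfgStore c i).length ≤ n + k + 1 + (P.eval n * Cr + 1) := fun i => by
        refine (h7.length_le (.inl i)).trans (Nat.add_le_add_right ?_ _)
        rcases i with _ | i
        · simp [hc₀, Coding.cfgStore, Coding.store]
        · by_cases hi : i = M.tm.k₀
          · subst hi; simp [hc₀, hS₀, Coding.cfgStore, Coding.store, hwl]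
          · simp [hc₀, hS₀, Coding.cfgStore, Coding.store, hi]
      have g1 := runs_clearProg (syms := cd.codes) (B := n + k + 1 + (P.eval n * Cr + 1)) κ
        (Sum.elim (cd.cfgStore c) ![[], [], V, [], [], [], [], []])
        (by
          simp only [hκ, List.mem_map]
          rintro _ ⟨i, -, rfl⟩ a ha
          exact cd.mem_codes_of_mem_cfgStore hgood' ha)
        (by
          simp only [hκ, List.mem_map]
          rintro _ ⟨i, -, rfl⟩
          exact hlen i)
      replace g1 := g1.congr le_rfl (s'' := Sum.elim E ![[], [], V, [], [], [], [], []]) (by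
        funext i
        rcases i with i | i
        · simp [hκ, E]
        · simp [hκ])
      have g2 : Runs (transferProg (letters (A ⊕ Bool)) id (.inr 2) (.inr 6))
          (Sum.elim E ![[], [], V, [], [], [], [], []]) ((n + k) * (L + 4) + 1)
          (wordStore (.inr 6) w) := by
        refine (runs_transferProg (by simp) (by simpa using hVm)).congr (by simp [hVl, hL]) ?_
        rw [Sum.update_elim_inr, Sum.update_elim_inr]
        funext i
        rcases i with i | i
        · simp [wordStore, single, E]
        · fin_cases i <;> simp [wordStore, single, hV]
      refine (Runs.ite_false ?_ (g1.seq g2)).mono ?_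
      · obtain ⟨l, hl⟩ := Option.ne_none_iff_exists'.1 hl
        simp [Coding.cfgStore, Coding.store, hl]
      · rw [← hC]; omega
  refine (h1.seq (h2.seq (h3.seq (h4.seq (h5.seq (h6.seq (h7.seq h8))))))).mono ?_
  have e1 : Qc.eval n ≤ Qc.eval (n + k) := eval_le_eval_of_le _ (by omega)
  have e2 : P.eval n ≤ P.eval (n + k) := eval_le_eval_of_le _ (by omega)
  have e3 : (letterCodes (letterCode : A ⊕ Bool → ℕ)).length = L := rfl
  rw [e3]
  simp only [Polynomial.eval_add, Polynomial.eval_mul, Polynomial.eval_X, Polynomial.eval_one,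
    Polynomial.eval_natCast, Polynomial.eval_ofNat, Nat.cast_id]
  gcongr
  omega

end Kernel

end ParamComplexity

/-! ### From fixed-parameter tractability to an idempotent kernel. -/

namespace ParamComplexity

open Function Turing Computability

section Kernel

variable {A : Type} [Fintype A] {Q : Set (Instance A)}

theorem steps_of_outputsInTime {M : FinTM2} {l : List (M.Γ M.k₀)} {l' : List (M.Γ M.k₁)} {t : ℕ}
    (h : Nonempty (TM2OutputsInTime M l (some l') t)) :
    ∃ t' ≤ t, Steps (TM2.step M.m) t' (initList M l) (haltList M l') := by
  obtain ⟨⟨t', ht'⟩, htt⟩ := h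
  exact ⟨t', htt, ht'⟩

omit [Fintype A] in
theorem IsStronglyUniformlyFPT.isDecidable (h : IsStronglyUniformlyFPT Q) : IsDecidable Q := by
  obtain ⟨M, f, p, -, h⟩ := h
  exact ⟨⟨M, fun a => (h a.1 a.2).some.toTM2Outputs⟩⟩

/-- Idempotence is not part of (2), but this kernel has it, and the quasi-order of (3) depends on
it. -/
theorem IsStronglyUniformlyFPT.exists_kernel (h : IsStronglyUniformlyFPT Q) :
    ∃ (f : ℕ → ℕ) (K : Instance A → Instance A), Computable f ∧ IsKernel Q f K ∧
      ∀ a, K (K a) = K a := by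
  classical
  obtain ⟨M, f, p, hf, h⟩ := h
  -- A member of `Q` if there is one. If `Q` is empty, the dummy is harmless, since it is only used
  -- for members; the same goes for `z` and the complement.
  obtain ⟨y, hy⟩ : ∃ y : Instance A, ∀ a ∈ Q, y ∈ Q := by
    by_cases h : ∃ y, y ∈ Q
    · exact ⟨h.choose, fun _ _ => h.choose_spec⟩
    · exact ⟨([], 0), fun a ha => (h ⟨a, ha⟩).elim⟩
  obtain ⟨z, hz⟩ : ∃ z : Instance A, ∀ a ∉ Q, z ∉ Q := by
    by_cases h : ∃ z, z ∉ Q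
    · exact ⟨h.choose, fun _ _ => h.choose_spec⟩
    · exact ⟨([], 0), fun a ha => (h ⟨a, ha⟩).elim⟩
  let P : Polynomial ℕ := .X * p
  obtain ⟨prog, T, hT⟩ := exists_kernelProg M P y z
  let c (a : Instance A) : TM2.Cfg M.tm.Γ M.tm.Λ M.tm.σ :=
    (nextCfg M.tm.m)^[P.eval a.1.length] (initList M.tm
      (((instanceEncoding A).encode a).map M.inputAlphabet.invFun))
  let K (a : Instance A) : Instance A :=
    if (c a).l = none then bif decide (a ∈ Q) then y else z else a
  have key : ∀ (x : List A) (k : ℕ), ((c (x, k)).l = none →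
      c (x, k) = haltList M.tm ([decide ((x, k) ∈ Q)].map M.outputAlphabet.invFun)) ∧
      ((c (x, k)).l ≠ none → x.length < f k) := by
    intro x k
    obtain ⟨t, ht, hs⟩ := steps_of_outputsInTime (h x k)
    have hi := hs.iterate_nextCfg
    have hl : ((nextCfg M.tm.m)^[t] (initList M.tm
        (((instanceEncoding A).encode (x, k)).map M.inputAlphabet.invFun))).l = none := by
      rw [hi]; rfl
    have hlt : (c (x, k)).l ≠ none → P.eval x.length < t := fun hc => by
      by_contra! hle
      exact hc (by rw [show c (x, k) = _ from iterate_nextCfg_of_le hl hle]; exact hl)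
    refine ⟨fun hc => ?_, fun hc => ?_⟩
    · rcases le_total t (P.eval x.length) with hle | hle
      · exact (iterate_nextCfg_of_le hl hle).trans hi
      · exact (iterate_nextCfg_of_le hc hle).symm.trans hi
    · have h1 := (hlt hc).trans_le ht
      simp only [P, Polynomial.eval_mul, Polynomial.eval_X] at h1
      -- The factor p(|x|) cancels from |x|·p(|x|) < f(k)·p(|x|). This is the reason for the clock
      -- `X * p`.
      exact lt_of_mul_lt_mul_right h1 (Nat.zero_le _)
  have hKQ : ∀ a, a ∈ Q ↔ K a ∈ Q := by
    intro a
    by_cases hc : (c a).l = none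
    · by_cases ha : a ∈ Q
      · simpa [K, hc, ha] using hy a ha
      · simpa [K, hc, ha] using hz a ha
    · simp [K, hc]
  refine ⟨fun k => f k + k + (y.size + z.size), K, ?_, ⟨?_, fun x k => ?_, hKQ⟩, fun a => ?_⟩
  · exact Primrec.nat_add.to_comp.comp (Primrec.nat_add.to_comp.comp hf .id) (.const _)
  · have : Fintype M.tm.K := M.tm.kFin
    refine computableInPolyTime_of_runs prog (i := .inr 0) (o := .inr 6) (by simp) T ?_
    rintro ⟨x, k⟩
    rw [length_instanceEncoding]
    exact hT x k _ _ rfl (key x k).1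
  · by_cases hc : (c (x, k)).l = none
    · simp only [K, if_pos hc]
      cases decide ((x, k) ∈ Q) <;> simp <;> omega
    · have := (key x k).2 hc
      simp only [K, if_neg hc, Instance.size]
      omega
  -- If `K a` is `y`, then `y` belongs to `Q`, and `K y` is `y` whether or not the clock suffices
  -- for `y`; likewise for `z`. In the remaining case `a` itself is a fixed point.
  · by_cases hc : (c a).l = none
    · have h1 : K a = bif decide (a ∈ Q) then y else z := by simp [K, hc]
      have h2 := hKQ a
      by_cases ha : a ∈ Q
      · have h3 : K a = y := by simpa [ha] using h1
        rw [h3] at h2 ⊢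
        simp [K, h2.1 ha]
      · have h3 : K a = z := by simpa [ha] using h1
        rw [h3] at h2 ⊢
        simp [K, mt h2.2 ha]
    · rw [show K a = a by simp [K, hc]]
      simp [K, hc]

end Kernel

end ParamComplexity

/-! ### From an idempotent kernel to a quasi-order. -/

namespace ParamComplexity

open Function Turing Computability

section Compare

variable {K : Type} [DecidableEq K]

/-- What is left of `r` after its top symbols have been compared with the symbols of a list; a
mismatch leaves a `0`. -/
def residue : List ℕ → List ℕ → List ℕ
  | [], r => r
  | a :: l, r => if r.head? = some a then residue l r.tail else residue l (0 :: r)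

/-- The mark `0` matches no positive symbol, so once it is on top it can never be removed. -/
theorem residue_zero_cons_ne_nil {l : List ℕ} (hl : ∀ a ∈ l, 0 < a) (r : List ℕ) :
    residue l (0 :: r) ≠ [] := by
  induction l generalizing r with
  | nil => simp [residue]
  | cons a l ih =>
    have ha : 0 ≠ a := (hl a (by simp)).ne
    simpa [residue, ha] using ih (fun b hb => hl b (by simp [hb])) _

theorem residue_eq_nil_iff {l : List ℕ} (hl : ∀ a ∈ l, 0 < a) (r : List ℕ) :
    residue l r = [] ↔ l = r := by
  induction l generalizing r with
  | nil => simp [residue, eq_comm]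
  | cons a l ih =>
    have hl' : ∀ b ∈ l, 0 < b := fun b hb => hl b (by simp [hb])
    rcases r with _ | ⟨b, r⟩
    · simpa [residue] using residue_zero_cons_ne_nil hl' []
    · by_cases h : b = a
      · subst h; simpa [residue] using ih hl' r
      · simpa [residue, h, Ne.symm h] using residue_zero_cons_ne_nil hl' (b :: r)

theorem mem_of_mem_residue {l r : List ℕ} {a : ℕ} (h : a ∈ residue l r) : a = 0 ∨ a ∈ r := by
  induction l generalizing r with
  | nil => exact .inr h
  | cons b l ih =>
    rw [residue] at h
    split_ifs at h
    · exact (ih h).imp_right List.mem_of_mem_tail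
    · rcases ih h with h | h
      · exact .inl h
      · simpa using h

theorem length_residue_le (l r : List ℕ) : (residue l r).length ≤ l.length + r.length := by
  induction l generalizing r with
  | nil => simp [residue]
  | cons b l ih =>
    rw [residue]
    split_ifs
    · refine (ih _).trans ?_
      simp; omega
    · refine (ih _).trans ?_
      simp; omega

/-- Compare stack `k` with stack `k'`. -/
def compareProg (syms : List ℕ) (k k' : K) : Prog K :=
  .loop k false none (switch k syms fun a =>
    .seq (.pop k) (.ite k' (some a) (.pop k') (.push k' 0)))

theorem runs_compareProg {syms : List ℕ} {k k' : K} (hk : k' ≠ k) (l : List ℕ) (s : Store K)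
    (hl : s k = l) (hs : ∀ a ∈ l, a ∈ syms) : Runs (compareProg syms k k') s
      (l.length * (syms.length + 4) + 1) (update (update s k []) k' (residue l (s k'))) := by
  induction l generalizing s with
  | nil =>
    refine (Runs.loop_exit (by simp [hl])).congr (by simp) ?_
    rw [residue, ← hl, update_eq_self, update_eq_self]
  | cons a l ih =>
    have h1 : Runs (.pop k) s 1 (update s k l) := Runs.pop.congr le_rfl (by rw [hl]; rfl)
    have h2 : Runs (.ite k' (some a) (.pop k') (.push k' 0)) (update s k l) 2
        (update (update s k l) k'
          (if (s k').head? = some a then (s k').tail else 0 :: s k')) := by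
      by_cases h : (s k').head? = some a
      · exact (Runs.ite_true (by rwa [update_of_ne hk]) Runs.pop).congr le_rfl
          (by rw [if_pos h, update_of_ne hk])
      · exact (Runs.ite_false (by rwa [update_of_ne hk]) Runs.push).congr le_rfl
          (by rw [if_neg h, update_of_ne hk])
    refine (Runs.loop_step (by simp [hl]) (Runs.switch (a := a) (hs a (by simp)) (by simp [hl])
      (h1.seq h2)) (ih _ ?_ fun b hb => hs b (by simp [hb]))).congr ?_ ?_
    · rw [update_of_ne hk.symm, update_self]
    · simp only [List.length_cons]
      rw [Nat.add_mul]; omega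
    · rw [update_self, residue, apply_ite (residue l)]
      funext i
      by_cases h : i = k'
      · subst h; simp only [update_self]
      · by_cases h' : i = k
        · subst h'; simp [h]
        · simp [h, h']

end Compare

section Pairs

variable {A : Type} [Fintype A]

/-- Distribute the letters of a coded pair to two stacks. -/
noncomputable def pairMarks {I : Type} (k k' : I) (n : ℕ) : List (I × ℕ) :=
  Sum.elim (fun a => [(k, letterCode a)]) (fun a => [(k', letterCode a)])
    (letterOf n : (A ⊕ Bool) ⊕ (A ⊕ Bool))

theorem destined_pairMarks {I : Type} [DecidableEq I] {k k' : I} (hk : k ≠ k')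
    (a b : Instance A) (i : I) :
    destined i ((((pairEncoding A).encode (a, b)).map letterCode).flatMap
      (pairMarks (A := A) k k')) =
      if i = k then ((instanceEncoding A).encode a).map letterCode else
      if i = k' then ((instanceEncoding A).encode b).map letterCode else [] := by
  have h1 : ∀ l : List (A ⊕ Bool), destined i (((l.map (Sum.inl : _ → (A ⊕ Bool) ⊕ (A ⊕ Bool))).map letterCode).flatMap
      (pairMarks (A := A) k k')) = if i = k then l.map letterCode else [] := fun l => by
    induction l with
    | nil => simp
    | cons a l ih =>
      rw [List.map_cons, List.map_cons, List.flatMap_cons, destined_append, ih]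
      by_cases h : i = k
      · subst h; simp [pairMarks]
      · simp [pairMarks, h, Ne.symm h]
  have h2 : ∀ l : List (A ⊕ Bool), destined i (((l.map (Sum.inr : _ → (A ⊕ Bool) ⊕ (A ⊕ Bool))).map letterCode).flatMap
      (pairMarks (A := A) k k')) = if i = k' then l.map letterCode else [] := fun l => by
    induction l with
    | nil => simp
    | cons a l ih =>
      rw [List.map_cons, List.map_cons, List.flatMap_cons, destined_append, ih]
      by_cases h : i = k'
      · subst h; simp [pairMarks]
      · simp [pairMarks, h, Ne.symm h]
  have h3 : (pairEncoding A).encode (a, b) = ((instanceEncoding A).encode a).map Sum.inl ++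
      ((instanceEncoding A).encode b).map Sum.inr := rfl
  rw [h3, List.map_append, List.flatMap_append, destined_append, h1, h2]
  by_cases h : i = k
  · subst h; simp [hk]
  · simp [h]

-- Separate the two components, replace each by its image under the machine for `K`, and compare the
-- two words; codes are injective, so equality of words is equality of instances.
open Classical in
theorem polyTime_eq_of_polyTime {K : Instance A → Instance A} (hK : Nonempty
    (TM2ComputableInPolyTime (instanceEncoding A).encode (instanceEncoding A).encode K)) :
    Nonempty (TM2ComputableInPolyTime (pairEncoding A).encode encodeBool
      (fun q => decide (K q.1 = K q.2))) := by
  obtain ⟨M, p, hM⟩ := hK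
  have := M.tm.ΛFin
  have := M.tm.σFin
  have : Fintype M.tm.K := M.tm.kFin
  have : Finite (M.tm.Γ M.tm.k₀) := Finite.of_equiv _ M.inputAlphabet.symm
  obtain ⟨cd, hcd⟩ := exists_coding M.tm.m M.tm.k₀
  obtain ⟨C, hC⟩ := exists_runs_callProg (M := M) (cd := cd)
    (j := (Sum.inl : _ → Option M.tm.K ⊕ Fin 4)) Sum.inl_injective hcd leftInverse_letterOf
    (letterCode : A ⊕ Bool → ℕ)
  set L₂ := (letters ((A ⊕ Bool) ⊕ (A ⊕ Bool))).length with hL₂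
  set L := (letters (A ⊕ Bool)).length with hL
  let B : Polynomial ℕ := C * (p + .X + 1)
  refine computableInPolyTime_of_runs (K := Option M.tm.K ⊕ Fin 4) (i := .inr 0) (o := .inr 3)
    (.seq (transferProg (letters ((A ⊕ Bool) ⊕ (A ⊕ Bool))) id (.inr 0) (.inr 3))
      (.seq (scanAll (.inr 3) (letters ((A ⊕ Bool) ⊕ (A ⊕ Bool)))
        (pairMarks (A := A) (.inr 1) (.inr 2)))
      (.seq (callProg M cd .inl letterCode letterOf letterCode (.inr 1) (.inr 1))
      (.seq (callProg M cd .inl letterCode letterOf letterCode (.inr 2) (.inr 2))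
      (.seq (compareProg (letters (A ⊕ Bool)) (.inr 1) (.inr 2))
      (.ite (.inr 2) none (.push (.inr 3) (letterCode true))
        (.seq (scanAll (.inr 2) (0 :: letters (A ⊕ Bool)) fun _ => [])
          (.push (.inr 3) (letterCode false)))))))))
    (by simp)
    ((.X * (L₂ + 4) + 1 : Polynomial ℕ) + ((.X * (1 + L₂ + 3) + 1) + (B + (B +
      (((.X + B) * (L + 4) + 1) + ((2 * (.X + B) * (L + 1 + 3) + 1) + 1 + 1)))))) ?_
  rintro ⟨a, b⟩
  rw [length_pairEncoding]
  set N := a.size + b.size with hN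
  set W := ((pairEncoding A).encode (a, b)).map letterCode with hW
  have hWl : W.length = N := by simp [hW, length_pairEncoding, hN]
  have hWm : ∀ c ∈ W, c ∈ letters ((A ⊕ Bool) ⊕ (A ⊕ Bool)) :=
    fun c hc => mem_letters_of_mem_map hc
  let E : Store (Option M.tm.K) := fun _ => []
  let V (a : Instance A) : List ℕ := (((instanceEncoding A).encode a).map letterCode).reverse
  have hVl : ∀ a, (V a).length = a.size := fun a => by simp [V, length_instanceEncoding]
  have h1 : Runs (transferProg (letters ((A ⊕ Bool) ⊕ (A ⊕ Bool))) id (.inr 0) (.inr 3))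
      (wordStore (.inr 0) ((pairEncoding A).encode (a, b)) : Store (Option M.tm.K ⊕ Fin 4))
      (N * (L₂ + 4) + 1) (Sum.elim E ![[], [], [], W]) := by
    refine (runs_transferProg (by simp) ?_).congr ?_ ?_
    · simpa [wordStore, single, ← hW] using hWm
    · simp [wordStore, single, length_pairEncoding, ← hN, hL₂]
    · funext i
      rcases i with i | i
      · simp [wordStore, single, E]
      · fin_cases i <;> simp [wordStore, single, hW]
  have h2 : Runs (scanAll (.inr 3) (letters ((A ⊕ Bool) ⊕ (A ⊕ Bool)))
      (pairMarks (A := A) (.inr 1) (.inr 2))) (Sum.elim E ![[], [], [], W])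
      (N * (1 + L₂ + 3) + 1) (Sum.elim E ![[], V a, V b, []]) := by
    refine (Runs.scanAll _ _ 1 ?_ ?_ _ ?_).congr ?_ ?_
    · intro c _ x hx
      simp only [pairMarks] at hx
      generalize (letterOf c : (A ⊕ Bool) ⊕ (A ⊕ Bool)) = d at hx
      rcases d with d | d <;> simp at hx <;> simp [hx]
    · intro c _
      simp only [pairMarks]
      rcases (letterOf c : (A ⊕ Bool) ⊕ (A ⊕ Bool)) with d | d <;> simp
    · simpa using hWm
    · simp [hWl, hL₂]
    · funext i
      simp only [Sum.elim_inr, show (![[], [], [], W] : Fin 4 → List ℕ) 3 = W from rfl]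
      rw [hW, destined_pairMarks (by simp)]
      rcases i with i | i
      · simp [E]
      · fin_cases i <;> simp [V]
  have hcall : ∀ a : Instance A, Nonempty (TM2OutputsInTime M.tm
      (((instanceEncoding A).encode a).map M.inputAlphabet.invFun)
      (some (((instanceEncoding A).encode (K a)).map M.outputAlphabet.invFun))
      (p.eval a.size)) := fun a => by
    have := hM a
    rw [length_instanceEncoding] at this
    exact ⟨this⟩
  have h3 := hC (i := .inr 1) (o := .inr 1) (by simp) (by simp) _ _ _ (hcall a)
    (Sum.elim E ![[], V a, V b, []]) (by simp [E]) rfl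
  have h4 := hC (i := .inr 2) (o := .inr 2) (by simp) (by simp) _ _ _ (hcall b)
    (Sum.elim E ![[], V (K a), V b, []]) (by simp [E]) rfl
  have e3 : ∀ X Y : List ℕ, update (update (Sum.elim E ![[], X, Y, []]) (.inr 1) []) (.inr 1)
      (V (K a) ++ update (Sum.elim E ![[], X, Y, []]) (.inr 1) [] (.inr 1)) =
      Sum.elim E ![[], V (K a), Y, []] := fun X Y => by
    rw [update_self, Sum.update_elim_inr, Sum.update_elim_inr]
    congr 1
    funext i; fin_cases i <;> simp
  have e4 : ∀ X Y : List ℕ, update (update (Sum.elim E ![[], X, Y, []]) (.inr 2) []) (.inr 2)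
      (V (K b) ++ update (Sum.elim E ![[], X, Y, []]) (.inr 2) [] (.inr 2)) =
      Sum.elim E ![[], X, V (K b), []] := fun X Y => by
    rw [update_self, Sum.update_elim_inr, Sum.update_elim_inr]
    congr 1
    funext i; fin_cases i <;> simp
  rw [length_instanceEncoding] at h3 h4
  replace h3 := h3.congr le_rfl (e3 _ _)
  replace h4 := h4.congr le_rfl (e4 _ _)
  have hVm : ∀ a, ∀ c ∈ V a, c ∈ letters (A ⊕ Bool) := fun a c hc =>
    mem_letters_of_mem_map (List.mem_reverse.1 hc)
  have h5 := runs_compareProg (syms := letters (A ⊕ Bool)) (k := .inr 1) (k' := .inr 2) (by simp)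
    (V (K a)) (Sum.elim E ![[], V (K a), V (K b), []]) rfl (hVm _)
  replace h5 := h5.congr le_rfl
    (s'' := Sum.elim E ![[], [], residue (V (K a)) (V (K b)), []]) (by
      rw [Sum.update_elim_inr, Sum.update_elim_inr]
      congr 1
      funext i; fin_cases i <;> simp)
  have hlen : ∀ a : Instance A, a.size ≤ N → C * (p.eval a.size + a.size + 1) ≤ B.eval N :=
    fun a ha => by
      have := eval_le_eval_of_le p ha
      simp only [B, Polynomial.eval_add, Polynomial.eval_mul, Polynomial.eval_X,
        Polynomial.eval_one, Polynomial.eval_natCast, Nat.cast_id]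
      gcongr
  have ha : a.size ≤ N := by omega
  have hb : b.size ≤ N := by omega
  -- The size of `K a` is polynomially bounded because it is written in polynomial time, by the
  -- growth bound for stacks.
  have l3 : (V (K a)).length ≤ N + B.eval N := by
    have := h3.length_le (.inr 1)
    simp only [Sum.elim_inr, Matrix.cons_val_one, Matrix.cons_val_zero, hVl] at this
    rw [hVl]
    have := hlen a ha
    omega
  have l4 : (V (K b)).length ≤ N + B.eval N := by
    have := h4.length_le (.inr 2)
    simp only [Sum.elim_inr, Matrix.cons_val, hVl] at this
    rw [hVl]
    have := hlen b hb
    omega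
  have hres : residue (V (K a)) (V (K b)) = [] ↔ K a = K b := by
    rw [residue_eq_nil_iff]
    · simp only [V, List.reverse_inj]
      rw [(List.map_injective_iff.2 letterCode_injective).eq_iff]
      exact (instanceEncoding A).encode_injective.eq_iff
    · simp only [V, List.mem_reverse, List.mem_map]
      rintro _ ⟨c, -, rfl⟩
      exact letterCode_pos c
  have h6 : Runs (.ite (.inr 2) none (.push (.inr 3) (letterCode true))
        (.seq (scanAll (.inr 2) (0 :: letters (A ⊕ Bool)) fun _ => [])
          (.push (.inr 3) (letterCode false))))
      (Sum.elim E ![[], [], residue (V (K a)) (V (K b)), []])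
      ((2 * (N + B.eval N) * (L + 1 + 3) + 1) + 1 + 1)
      (wordStore (.inr 3) [decide (K a = K b)]) := by
    by_cases h : K a = K b
    · rw [hres.2 h]
      refine (Runs.ite_true (by simp) Runs.push).congr (by omega) ?_
      rw [Sum.update_elim_inr]
      funext i
      rcases i with i | i
      · simp [wordStore, single, E]
      · fin_cases i <;> simp [wordStore, single, h]
    · refine (Runs.ite_false ?_ ((runs_clear ?_).seq Runs.push)).congr ?_ ?_
      · simpa [hres] using h
      · intro c hc
        rcases mem_of_mem_residue hc with rfl | hc
        · simp
        · exact List.mem_cons_of_mem _ (hVm _ _ hc)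
      · have := length_residue_le (V (K a)) (V (K b))
        simp only [Sum.elim_inr, Matrix.cons_val, List.length_cons, ← hL]
        gcongr
        omega
      · rw [Sum.update_elim_inr, Sum.update_elim_inr]
        funext i
        rcases i with i | i
        · simp [wordStore, single, E]
        · fin_cases i <;> simp [wordStore, single, h]
  refine (h1.seq (h2.seq (h3.seq (h4.seq (h5.seq h6))))).mono ?_
  have := hlen a ha
  have := hlen b hb
  simp only [Polynomial.eval_add, Polynomial.eval_mul, Polynomial.eval_X, Polynomial.eval_one,
    Polynomial.eval_natCast, Polynomial.eval_ofNat, Nat.cast_id]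
  gcongr

/-- Take the kernel of `K` as a map: r a b means K a = K b. Members and non-members are never
related, as `K` preserves membership. The witness below (x,k) is K(x,k), and K(K(x,k)) = K(x,k) is
precisely idempotence. -/
theorem IsKernel.exists_quasiOrder {Q : Set (Instance A)} {f : ℕ → ℕ} {K : Instance A → Instance A}
    (h : IsKernel Q f K) (hK : ∀ a, K (K a) = K a) :
    ∃ r : Instance A → Instance A → Prop, IsPolyTimeQuasiOrder r ∧ IsLowerIdeal r Q ∧
      ∀ (x : List A) (k : ℕ), (x, k) ∉ Q →
        ∃ a : Instance A, a ∉ Q ∧ a.size ≤ f k ∧ r a (x, k) := by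
  classical
  refine ⟨fun a b => K a = K b, ⟨fun _ => rfl, fun _ _ _ => Eq.trans, ?_⟩, fun a b ha hr => ?_,
    fun x k hx => ⟨K (x, k), fun hq => hx ((h.mem_iff _).2 hq), h.size_le x k, hK _⟩⟩
  · convert polyTime_eq_of_polyTime h.polyTime
  · rw [h.mem_iff, show K b = K a from hr, ← h.mem_iff]
    exact ha

end Pairs

end ParamComplexity

/-! ### Product time bounds and enumeration of small instances. -/

namespace ParamComplexity

open Function Turing Computability

section Bound

theorem eval_le_mul_pow (P : Polynomial ℕ) (m : ℕ) :
    P.eval m ≤ P.eval 1 * (m + 1) ^ P.natDegree := by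
  rw [Polynomial.eval_eq_sum_range, Polynomial.eval_eq_sum_range, Finset.sum_mul]
  refine Finset.sum_le_sum fun i hi => ?_
  rw [one_pow, mul_one]
  refine Nat.mul_le_mul_left _ ((Nat.pow_le_pow_left (Nat.le_succ m) i).trans ?_)
  exact Nat.pow_le_pow_right (Nat.succ_pos _) (Nat.lt_succ_iff.1 (Finset.mem_range.1 hi))

theorem primrec_pow (d : ℕ) : Primrec fun n : ℕ => n ^ d := by
  induction d with
  | zero => exact Primrec.const 1
  | succ d ih => exact Primrec.nat_mul.comp ih .id

variable {A : Type} [Fintype A] {Q : Set (Instance A)}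

-- A bound polynomial in |x| + g(k) becomes a product by way of |x| + h + 1 ≤ (h + 1)(|x| + 1),
-- raised to the degree of the polynomial.
open Classical in
theorem isStronglyUniformlyFPT_of_runs {K : Type} [DecidableEq K] [Fintype K] (p : Prog K) (i o : K)
    {g : ℕ → ℕ} (hg : Computable g) (P : Polynomial ℕ)
    (h : ∀ (x : List A) (k : ℕ), Runs p (wordStore i ((instanceEncoding A).encode (x, k)))
      (P.eval (x.length + g k)) (wordStore o [decide ((x, k) ∈ Q)])) :
    IsStronglyUniformlyFPT Q := by
  -- The compiled machine additionally reads |x| + k symbols and writes a single one; with the two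
  -- extra steps this makes `X + 3`, and `k` is absorbed into the argument.
  set P' : Polynomial ℕ := P + .X + 3 with hP'
  set d := P'.natDegree with hd
  refine ⟨ioMachine p i o letterCode letterOf,
    fun k => P'.eval 1 * (g k + k + 1) ^ d, (.X + 1) ^ d, ?_, fun x k => ?_⟩
  · exact Primrec.nat_mul.to_comp.comp (.const _) ((primrec_pow d).to_comp.comp
      (Computable.succ.comp (Primrec.nat_add.to_comp.comp hg .id)))
  · have h1 := ((h x k).outputsInTime leftInverse_letterOf).some
    refine ⟨⟨h1.toEvalsTo, h1.steps_le_m.trans ?_⟩⟩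
    have h2 := eval_le_mul_pow P' (x.length + (g k + k))
    rw [← hd] at h2
    have h3 : P.eval (x.length + g k) ≤ P.eval (x.length + (g k + k)) :=
      eval_le_eval_of_le _ (by omega)
    have h4 : (x.length + (g k + k) + 1) ^ d ≤ (g k + k + 1) ^ d * (x.length + 1) ^ d := by
      rw [← mul_pow]
      refine Nat.pow_le_pow_left ?_ _
      nlinarith
    have h5 : P'.eval (x.length + (g k + k)) = P.eval (x.length + (g k + k)) +
      (x.length + (g k + k)) + 3 := by simp [hP']
    have h6 := Nat.mul_le_mul_left (P'.eval 1) h4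
    rw [length_instanceEncoding, Instance.size]
    simp only [Polynomial.eval_pow, Polynomial.eval_add, Polynomial.eval_X, Polynomial.eval_one,
      List.length_singleton, mul_assoc]
    omega

end Bound

section Enumeration

/-- Recursion on the length of the prefix already processed, with access to the list by index; the
default `[]` is never used within range. -/
theorem computable_list_flatMap {α β : Type} [Primcodable α] [Primcodable β] {g : α → List β}
    (hg : Computable g) : Computable fun l : List α => l.flatMap g := by
  have h1 : Computable₂ fun (l : List α) (x : ℕ × List β) =>
      x.2 ++ ((l[x.1]?).map g).getD [] := by
    refine Computable.list_append.comp (Computable.snd.comp .snd) ?_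
    refine Computable.option_getD ?_ (.const [])
    exact Computable.option_map (Computable.list_getElem?.comp .fst (Computable.fst.comp .snd))
      (hg.comp .snd).to₂
  refine (Computable.nat_rec Computable.list_length (.const []) h1).of_eq fun l => ?_
  have h2 : ∀ n ≤ l.length, Nat.rec (motive := fun _ => List β) []
      (fun i acc => acc ++ ((l[i]?).map g).getD []) n = (l.take n).flatMap g := by
    intro n hn
    induction n with
    | zero => simp
    | succ n ih =>
      have ih := ih (by omega)
      simp only at ih ⊢
      rw [ih, List.take_add_one, List.flatMap_append, List.getElem?_eq_getElem (by omega)]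
      simp
  simpa using h2 l.length le_rfl

variable (A : Type) [Fintype A]

/-- All words of length at most `n`. -/
noncomputable def words : ℕ → List (List A)
  | 0 => [[]]
  | n + 1 => [] :: (words n).flatMap fun w => (Finset.univ : Finset A).toList.map (· :: w)

/-- All instances `(x, k)` with `|x| ≤ n` and `k ≤ n`. -/
noncomputable def instances (n : ℕ) : List (Instance A) :=
  (words A n).flatMap fun w => (List.range (n + 1)).map fun k => (w, k)

variable {A}

theorem mem_words {x : List A} {n : ℕ} (h : x.length ≤ n) : x ∈ words A n := by
  induction n generalizing x with
  | zero => simpa [words] using h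
  | succ n ih =>
    rcases x with _ | ⟨a, x⟩
    · simp [words]
    · simp only [words, List.mem_cons, List.mem_flatMap]
      exact .inr ⟨x, ih (by simpa using h), by simp⟩

theorem mem_instances {a : Instance A} {n : ℕ} (h : a.size ≤ n) : a ∈ instances A n := by
  obtain ⟨x, k⟩ := a
  simp only [Instance.size] at h
  simp only [instances, List.mem_flatMap, List.mem_map, List.mem_range]
  exact ⟨x, mem_words (by omega), k, by omega, rfl⟩

variable [Primcodable A]

theorem primrec_words : Primrec (words A) := by
  have h : Primrec₂ fun (_ : ℕ) (l : List (List A)) =>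
      [] :: l.flatMap fun w => (Finset.univ : Finset A).toList.map (· :: w) :=
    Primrec.list_cons.comp (.const []) (Primrec.list_flatMap .snd
      (Primrec.list_map (.const _) (Primrec.list_cons.comp .snd (Primrec.snd.comp .fst)).to₂).to₂)
  refine (Primrec.nat_rec₁ [[]] h).of_eq fun n => ?_
  induction n with
  | zero => rfl
  | succ n ih => simp only [words] at ih ⊢; rw [ih]

theorem primrec_instances : Primrec (instances A) :=
  Primrec.list_flatMap primrec_words (Primrec.list_map
    (Primrec.list_range.comp (Primrec.succ.comp .fst))
    (Primrec.pair (Primrec.snd.comp .fst) .snd).to₂).to₂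

omit [Fintype A] in
theorem primrec_map_encode [Finite A] (c : A ⊕ Bool → ℕ) :
    Primrec fun a : Instance A => ((instanceEncoding A).encode a).map c := by
  have h : ∀ a : Instance A, ((instanceEncoding A).encode a).map c =
      (a.1.map fun l => c (.inl l)) ++ (List.range a.2).map fun _ => c (.inr true) := by
    rintro ⟨x, k⟩
    have : unaryEncodeNat k = List.replicate k true := by
      induction k with
      | zero => rfl
      | succ k ih => rw [unaryEncodeNat, ih, List.replicate_succ]
    simp [instanceEncoding, encodingProd, encodingList, unaryEncodingNat, this, Function.comp_def]
  refine Primrec.of_eq ?_ fun a => (h a).symm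
  exact Primrec.list_append.comp (Primrec.list_map .fst
    ((Primrec.dom_finite fun l => c (.inl l)).comp .snd).to₂)
    (Primrec.list_map (Primrec.list_range.comp .snd) (Primrec.const _).to₂)

/-- The sum of `T` over a finite computable list containing all instances of size at most `n`
dominates each value. It is expressed as the length of a concatenation of unary words. -/
theorem exists_computable_bound {T : Instance A → ℕ} (hT : Computable T) :
    ∃ G : ℕ → ℕ, Computable G ∧ ∀ n a, a.size ≤ n → T a ≤ G n := by
  have h : Computable fun a : Instance A => List.replicate (T a) 1 :=
    primrec_replicate_one.to_comp.comp hT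
  refine ⟨_, Computable.list_length.comp ((computable_list_flatMap h).comp
    (primrec_instances (A := A)).to_comp), fun n a ha => ?_⟩
  obtain ⟨l, l', hl⟩ := List.append_of_mem (mem_instances ha)
  simp [hl]
  omega

end Enumeration

end ParamComplexity

/-! ### From a kernel to fixed-parameter tractability. -/

namespace ParamComplexity

open Function Turing Computability

variable {A : Type} [Fintype A] {Q : Set (Instance A)}

-- Passes from machine decidability to recursion theory: simulate the machine by a program, whose
-- final store and step count are partial recursive in the input. Thus both membership and the
-- running time are `Computable`.
open Classical in
theorem IsDecidable.exists_prog [Primcodable A] (h : IsDecidable Q) :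
    ∃ (n : ℕ) (i o : Fin n) (p : Prog (Fin n)) (T : Instance A → ℕ), i ≠ o ∧ Computable T ∧
      (Computable fun a => decide (a ∈ Q)) ∧
      ∀ a, Runs p (wordStore i ((instanceEncoding A).encode a)) (T a)
        (wordStore o [decide (a ∈ Q)]) := by
  obtain ⟨M, hM⟩ := h
  have := M.tm.ΛFin
  have := M.tm.σFin
  have : Fintype M.tm.K := M.tm.kFin
  have : Finite (M.tm.Γ M.tm.k₀) := Finite.of_equiv _ M.inputAlphabet.symm
  obtain ⟨cd, hcd⟩ := exists_coding M.tm.m M.tm.k₀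
  obtain ⟨C, hC⟩ := exists_runs_callProg (M := M) (cd := cd)
    (j := (Sum.inl : _ → Option M.tm.K ⊕ Fin 2)) Sum.inl_injective hcd leftInverse_letterOf
    (letterCode : Bool → ℕ)
  -- Stacks are renumbered by `Fin` so that stores carry a `Primcodable` structure.
  let e := Fintype.equivFin (Option M.tm.K ⊕ Fin 2)
  set p := (callProg M cd (Sum.inl : _ → Option M.tm.K ⊕ Fin 2) letterCode letterOf letterCode
    (.inr 0) (.inr 1)).map e with hp
  have hio : e (.inr 0) ≠ e (.inr 1) := by simp [e.injective.eq_iff]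
  have hex : ∀ a, ∃ t, Exec p (wordStore (e (.inr 0)) ((instanceEncoding A).encode a)) t
      (wordStore (e (.inr 1)) [decide (a ∈ Q)]) := fun a => by
    obtain ⟨t, -, ht⟩ := (hC (i := .inr 0) (o := .inr 1) (by simp) (by simp) _ _ _
      ⟨⟨hM a, le_rfl⟩⟩ (wordStore (.inr 0) ((instanceEncoding A).encode a))
      (by simp [wordStore, single]) (by simp [wordStore, single])).congr le_rfl
        (s'' := wordStore (.inr 1) [decide (a ∈ Q)]) (by
      funext i
      rcases i with i | i
      · simp [wordStore, single]
      · fin_cases i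
        · simp [wordStore, single]
        · simp [wordStore, single, encodeBool])
    have h1 := ht.map e.injective (fun _ => [])
    rw [wordStore, wordStore, extend_single e.injective, extend_single e.injective] at h1
    exact ⟨t, h1⟩
  choose T hT using hex
  obtain ⟨F, hF, hF'⟩ := exists_partrec_of_exec p
  have h1 : Computable fun a : Instance A =>
      wordStore (e (.inr 0)) ((instanceEncoding A).encode a) :=
    (primrec_store_update _ (Primrec.const _) (Primrec.list_reverse.comp (primrec_map_encode _))).to_comp
  have h2 := hF.comp h1
  refine ⟨_, _, _, p, T, hio, ?_, ?_, fun a => (hT a).runs⟩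
  · exact Partrec.of_eq_tot (h2.map (Computable.snd.comp .snd).to₂) fun a =>
      Part.mem_map _ (hF' _ _ _ (hT a))
  · have h3 : Computable₂ fun (_ : Instance A) (x : Store (Fin _) × ℕ) =>
        decide ((x.1 (e (.inr 1))).head? = some (letterCode true)) := by
      have h4 : Primrec fun s : Store (Fin _) =>
          decide ((s (e (.inr 1))).head? = some (letterCode true)) :=
        (Primrec.eq.decide).comp (Primrec.list_head?.comp (primrec_store_apply _)) (.const _)
      exact (h4.to_comp.comp (Computable.fst.comp .snd)).to₂
    refine Partrec.of_eq_tot (h2.map h3) fun a => ?_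
    refine (Part.mem_map_iff _).2 ⟨_, hF' _ _ _ (hT a), ?_⟩
    by_cases ha : a ∈ Q <;> simp [wordStore, single, ha, letterCode_injective.eq_iff]

/-- After kernelization in time polynomial in |x| + k, the decision program runs on an instance of
size at most f(k), hence for at most G(f(k)) steps. -/
theorem IsKernel.isStronglyUniformlyFPT {f : ℕ → ℕ} {K : Instance A → Instance A}
    (hQ : IsDecidable Q) (hf : Computable f) (hK : IsKernel Q f K) :
    IsStronglyUniformlyFPT Q := by
  classical
  let _ : Primcodable A := Primcodable.ofEquiv _ (Fintype.equivFin A)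
  obtain ⟨n, i, o, p, T, hio, hT, -, hp⟩ := hQ.exists_prog
  obtain ⟨G, hG, hTG⟩ := exists_computable_bound hT
  obtain ⟨M, q, hM⟩ := hK.polyTime
  have := M.tm.ΛFin
  have := M.tm.σFin
  have : Fintype M.tm.K := M.tm.kFin
  have : Finite (M.tm.Γ M.tm.k₀) := Finite.of_equiv _ M.inputAlphabet.symm
  obtain ⟨cd, hcd⟩ := exists_coding M.tm.m M.tm.k₀
  obtain ⟨C, hC⟩ := exists_runs_callProg (M := M) (cd := cd)
    (j := (Sum.inl : _ → Option M.tm.K ⊕ Fin n)) Sum.inl_injective hcd leftInverse_letterOf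
    (letterCode : A ⊕ Bool → ℕ)
  -- The kernel overwrites the input on stack `i`, exactly where the decision program expects its
  -- own input, and all other stacks are empty by then.
  refine isStronglyUniformlyFPT_of_runs (.seq (callProg M cd (Sum.inl : _ → Option M.tm.K ⊕ Fin n)
    letterCode letterOf letterCode (.inr i) (.inr i)) (p.map .inr)) (.inr i) (.inr o)
    (g := fun k => k + G (f k)) (Primrec.nat_add.to_comp.comp .id (hG.comp hf))
    (C * (q + .X + 1) + .X) fun x k => ?_
  have h1 := hC (i := .inr i) (o := .inr i) (by simp) (by simp) _ _ _
    ⟨hM (x, k)⟩ (wordStore (.inr i) ((instanceEncoding A).encode (x, k)))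
    (by simp [wordStore, single]) (by simp [wordStore, single])
  have h2 := (hp (K (x, k))).map (j := (Sum.inr : _ → Option M.tm.K ⊕ Fin n)) Sum.inr_injective
    (fun _ => [])
  rw [wordStore, wordStore, extend_single Sum.inr_injective,
    extend_single Sum.inr_injective] at h2
  rw [length_instanceEncoding] at h1
  refine ((h1.congr le_rfl ?_).seq h2).congr ?_ ?_
  · simp [wordStore, single]
  · have h3 := hTG _ _ (hK.size_le x k)
    have h4 : Instance.size (x, k) ≤ x.length + (k + G (f k)) := by simp [Instance.size]
    have h5 := eval_le_eval_of_le q h4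
    simp only [Polynomial.eval_add, Polynomial.eval_mul, Polynomial.eval_X, Polynomial.eval_one,
      Polynomial.eval_natCast, Nat.cast_id]
    gcongr
    omega
  · simp only [wordStore, hK.mem_iff (x, k)]

end ParamComplexity

/-! ### From a quasi-order to fixed-parameter tractability. -/

namespace ParamComplexity

open Function Turing Computability

theorem destined_flatMap_pair {K : Type} [DecidableEq K] {k k' : K} (hk : k ≠ k') (i : K)
    (l : List ℕ) : destined i (l.flatMap fun n => [(k, n), (k', n)]) =
      if i = k ∨ i = k' then l else [] := by
  induction l with
  | nil => simp
  | cons a l ih =>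
    rw [List.flatMap_cons, destined_append, ih]
    by_cases h : i = k
    · subst h; simp [hk.symm]
    · by_cases h' : i = k'
      · subst h'; simp [hk]
      · simp [h, h', Ne.symm h, Ne.symm h']

theorem flatMap_filter_eq {α β : Type} (p : α → Bool) (F : α → List β) (l : List α) :
    (l.filter p).flatMap F = l.flatMap fun a => bif p a then F a else [] := by
  induction l with
  | nil => rfl
  | cons a l ih => by_cases h : p a <;> simp [h, ih]

section Test

variable {A : Type} [Fintype A]

/-- The code of the first component of a pair of instances. -/
noncomputable def leftCodes (a : Instance A) : List ℕ :=
  ((instanceEncoding A).encode a).map fun l => letterCode (.inl l : (A ⊕ Bool) ⊕ (A ⊕ Bool))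

/-- The code of the second component of a pair of instances. -/
noncomputable def rightCodes (a : Instance A) : List ℕ :=
  ((instanceEncoding A).encode a).map fun l => letterCode (.inr l : (A ⊕ Bool) ⊕ (A ⊕ Bool))

variable (A) in
/-- A symbol that is not the code of a letter of a pair of instances. -/
def separator : ℕ := Fintype.card ((A ⊕ Bool) ⊕ (A ⊕ Bool)) + 1

theorem map_pairEncoding (a b : Instance A) :
    ((pairEncoding A).encode (a, b)).map letterCode = leftCodes a ++ rightCodes b := by
  have h : (pairEncoding A).encode (a, b) = ((instanceEncoding A).encode a).map Sum.inl ++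
      ((instanceEncoding A).encode b).map Sum.inr := rfl
  simp [h, leftCodes, rightCodes, Function.comp_def]

theorem length_leftCodes (a : Instance A) : (leftCodes a).length = a.size := by
  simp [leftCodes, length_instanceEncoding]

theorem length_rightCodes (a : Instance A) : (rightCodes a).length = a.size := by
  simp [rightCodes, length_instanceEncoding]

theorem mem_letters_of_mem_leftCodes {a : Instance A} {n : ℕ} (h : n ∈ leftCodes a) :
    n ∈ letters ((A ⊕ Bool) ⊕ (A ⊕ Bool)) := by
  obtain ⟨l, -, rfl⟩ := List.mem_map.1 h
  exact mem_letterCodes _ _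

theorem mem_letters_of_mem_rightCodes {a : Instance A} {n : ℕ} (h : n ∈ rightCodes a) :
    n ∈ letters ((A ⊕ Bool) ⊕ (A ⊕ Bool)) := by
  obtain ⟨l, -, rfl⟩ := List.mem_map.1 h
  exact mem_letterCodes _ _

theorem ne_separator_of_mem_leftCodes {a : Instance A} {n : ℕ} (h : n ∈ leftCodes a) :
    n ≠ separator A := by
  obtain ⟨l, -, rfl⟩ := List.mem_map.1 h
  exact (Nat.lt_succ_of_le (letterCode_le _)).ne

omit [Fintype A] in
theorem countP_isRight_encode (x : List A) (k : ℕ) :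
    ((instanceEncoding A).encode (x, k)).countP Sum.isRight = k := by
  have h : ∀ n : ℕ, (unaryEncodeNat n).length = n := unary_decode_encode_nat
  simp [instanceEncoding, encodingProd, unaryEncodingNat, List.countP_eq_length_filter,
    List.filter_map, Function.comp_def, h]

open Classical in
/-- For a machine that decides a relation `r`, and a list of instances, a program that counts the
instances `a` of the list with `r a b`. -/
theorem exists_runs_testLoop {r : Instance A → Instance A → Prop}
    (M : TM2ComputableInPolyTime (pairEncoding A).encode encodeBool
      (fun q => decide (r q.1 q.2))) (R : Type) [DecidableEq R] (o : R) :
    ∃ (p : Prog (Option M.tm.K ⊕ (R ⊕ Fin 5))) (B : Polynomial ℕ), ∀ (b : Instance A) (m : ℕ)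
      (as : List (Instance A)), (∀ a ∈ as, a.size + b.size ≤ m) → ∀ v : ℕ,
      Runs p (Sum.elim (fun _ => []) (Sum.elim
        (single o (as.flatMap fun a => leftCodes a ++ [separator A]))
          ![[], rightCodes b, [], List.replicate v (letterCode true), []]))
        (as.length * B.eval m + 1)
        (Sum.elim (fun _ => []) (Sum.elim (fun _ => []) ![[], rightCodes b, [],
          List.replicate (as.countP (fun a => decide (r a b)) + v) (letterCode true), []])) := by
  obtain ⟨M, q, hM⟩ := M
  have := M.tm.ΛFin
  have := M.tm.σFin
  have : Fintype M.tm.K := M.tm.kFin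
  have : Finite (M.tm.Γ M.tm.k₀) := Finite.of_equiv _ M.inputAlphabet.symm
  obtain ⟨cd, hcd⟩ := exists_coding M.tm.m M.tm.k₀
  obtain ⟨C, hC⟩ := exists_runs_callProg (M := M) (cd := cd)
    (j := (Sum.inl : _ → Option M.tm.K ⊕ (R ⊕ Fin 5))) Sum.inl_injective hcd leftInverse_letterOf
    (letterCode : Bool → ℕ)
  set syms := letters ((A ⊕ Bool) ⊕ (A ⊕ Bool)) with hsyms
  set S := syms.length with hS
  -- Stack `o` holds the list, `0` the next query, `1` the instance `b`, `2` a scratch copy that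
  -- restores `b`, and `3` the count; `4` is left free for the final output. The answer of `M` is
  -- pushed on `3`: a positive answer stays there as one more unit, a negative one is popped.
  let body : Prog (Option M.tm.K ⊕ (R ⊕ Fin 5)) :=
    .seq (scan (.inr (.inl o)) false (some (separator A)) syms fun n => [(.inr (.inr 0), n)])
    (.seq (.pop (.inr (.inl o)))
    (.seq (scanAll (.inr (.inr 1)) syms fun n => [(.inr (.inr 0), n), (.inr (.inr 2), n)])
    (.seq (transferProg syms id (.inr (.inr 2)) (.inr (.inr 1)))
    (.seq (callProg M cd .inl letterCode letterOf letterCode (.inr (.inr 0)) (.inr (.inr 3)))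
      (.ite (.inr (.inr 3)) (some (letterCode true)) .skip (.pop (.inr (.inr 3))))))))
  let B : Polynomial ℕ := (.X * (1 + S + 3) + 1 : Polynomial ℕ) + (1 + ((.X * (2 + S + 3) + 1) +
    ((.X * (S + 4) + 1) + (C * (q + .X + 1) + 2)))) + 1
  refine ⟨.loop (.inr (.inl o)) false none body, B, fun b m as => ?_⟩
  let E : Store (Option M.tm.K) := fun _ => []
  set V := rightCodes b with hV
  have hVl : V.length = b.size := length_rightCodes b
  induction as with
  | nil =>
    intro _ v
    refine (Runs.loop_exit (by simp [single])).congr (by simp) ?_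
    simp [single]
  | cons a as ih =>
    intro ha v
    set rest := as.flatMap fun a => leftCodes a ++ [separator A] with hrest
    set vs := List.replicate v (letterCode true) with hvs
    have ham : a.size + b.size ≤ m := ha a (by simp)
    have h0 : (a :: as).flatMap (fun a => leftCodes a ++ [separator A]) =
        leftCodes a ++ separator A :: rest := by simp [hrest]
    have h1 : Runs (scan (.inr (.inl o)) false (some (separator A)) syms
        fun n => [(.inr (.inr 0), n)])
        (Sum.elim E (Sum.elim (single o (leftCodes a ++ separator A :: rest)) ![[], V, [], vs, []]))
        (a.size * (1 + S + 3) + 1)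
        (Sum.elim E (Sum.elim (single o (separator A :: rest))
          ![(leftCodes a).reverse, V, [], vs, []])) := by
      refine (Runs.scan syms _ 1 (by simp) (by simp) (leftCodes a) (separator A :: rest) _ ?_
        (fun n hn => mem_letters_of_mem_leftCodes hn) ?_ (by simp)).congr ?_ ?_
      · simp [-Sum.elim_update_left, single]
      · intro n hn
        simpa using ne_separator_of_mem_leftCodes hn
      · rw [length_leftCodes]
      · funext i
        have hd := destined_flatMap_single
          (.inr (.inr 0) : Option M.tm.K ⊕ (R ⊕ Fin 5)) i id (leftCodes a)
        simp only [id] at hd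
        rw [hd]
        rcases i with i | i | i
        · simp [E]
        · by_cases hi : i = o
          · subst hi; simp [-Sum.elim_update_left, single]
          · simp [-Sum.elim_update_left, single, hi]
        · fin_cases i <;> simp
    have h2 : Runs (.pop (.inr (.inl o))) (Sum.elim E (Sum.elim (single o (separator A :: rest))
          ![(leftCodes a).reverse, V, [], vs, []])) 1
        (Sum.elim E (Sum.elim (single o rest) ![(leftCodes a).reverse, V, [], vs, []])) := by
      refine Runs.pop.congr le_rfl ?_
      rw [Sum.update_elim_inr, Sum.update_elim_inl]
      simp [-Sum.elim_update_left, single]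
    have h3 : Runs (scanAll (.inr (.inr 1)) syms fun n =>
          [(.inr (.inr 0), n), (.inr (.inr 2), n)])
        (Sum.elim E (Sum.elim (single o rest) ![(leftCodes a).reverse, V, [], vs, []]))
        (b.size * (2 + S + 3) + 1)
        (Sum.elim E (Sum.elim (single o rest)
          ![V.reverse ++ (leftCodes a).reverse, [], V.reverse, vs, []])) := by
      refine (Runs.scanAll _ _ 2 (by simp) (by simp) _ ?_).congr ?_ ?_
      · simpa using fun n hn => mem_letters_of_mem_rightCodes hn
      · simp [hVl, hS]
      · funext i
        rw [destined_flatMap_pair (by simp)]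
        rcases i with i | i | i
        · simp [E]
        · simp
        · fin_cases i <;> simp
    have h4 : Runs (transferProg syms id (.inr (.inr 2)) (.inr (.inr 1)))
        (Sum.elim E (Sum.elim (single o rest)
          ![V.reverse ++ (leftCodes a).reverse, [], V.reverse, vs, []]))
        (b.size * (S + 4) + 1)
        (Sum.elim E (Sum.elim (single o rest)
          ![V.reverse ++ (leftCodes a).reverse, V, [], vs, []])) := by
      refine (runs_transferProg (by simp) ?_).congr (by simp [hVl, hS]) ?_
      · simpa using fun n hn => mem_letters_of_mem_rightCodes hn
      · rw [Sum.update_elim_inr, Sum.update_elim_inr, Sum.update_elim_inr, Sum.update_elim_inr]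
        congr 2
        funext i; fin_cases i <;> simp
    have h5 : Runs (callProg M cd .inl letterCode letterOf letterCode (.inr (.inr 0))
          (.inr (.inr 3)))
        (Sum.elim E (Sum.elim (single o rest)
          ![V.reverse ++ (leftCodes a).reverse, V, [], vs, []]))
        (C * (q.eval (a.size + b.size) + (a.size + b.size) + 1))
        (Sum.elim E (Sum.elim (single o rest)
          ![[], V, [], letterCode (decide (r a b)) :: vs, []])) := by
      have := hC (i := .inr (.inr 0)) (o := .inr (.inr 3)) (by simp) (by simp) _ _ _
        ⟨hM (a, b)⟩ (Sum.elim E (Sum.elim (single o rest)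
          ![V.reverse ++ (leftCodes a).reverse, V, [], vs, []])) (by simp [E])
          (by rw [map_pairEncoding]; simp [hV])
      rw [length_pairEncoding] at this
      refine this.congr le_rfl ?_
      simp only [Sum.update_elim_inr, Sum.elim_inr]
      congr 2
      funext i; fin_cases i <;> simp [encodeBool]
    have h6 : Runs (.ite (.inr (.inr 3)) (some (letterCode true)) .skip (.pop (.inr (.inr 3))))
        (Sum.elim E (Sum.elim (single o rest)
          ![[], V, [], letterCode (decide (r a b)) :: vs, []])) 2
        (Sum.elim E (Sum.elim (single o rest) ![[], V, [],
          List.replicate ((if r a b then 1 else 0) + v) (letterCode true), []])) := by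
      by_cases hr : r a b
      · refine (Runs.ite_true (by simp [hr]) Runs.skip).congr le_rfl ?_
        simp [hr, hvs, Nat.add_comm 1, List.replicate_succ]
      · refine (Runs.ite_false (by simp [hr, letterCode_injective.eq_iff]) Runs.pop).congr
          le_rfl ?_
        rw [Sum.update_elim_inr, Sum.update_elim_inr]
        congr 2
        funext i; fin_cases i <;> simp [hr, hvs]
    have h7 := ih (fun a' ha' => ha a' (by simp [ha'])) ((if r a b then 1 else 0) + v)
    rw [h0]
    refine (Runs.loop_step ?_ (h1.seq (h2.seq (h3.seq (h4.seq (h5.seq h6))))) h7).congr ?_ ?_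
    · rcases leftCodes a with _ | ⟨c, l⟩ <;> simp [-Sum.elim_update_left, single]
    · have e1 := eval_le_eval_of_le q ham
      have e2 : a.size * (1 + S + 3) + 1 + (1 + ((b.size * (2 + S + 3) + 1) +
          ((b.size * (S + 4) + 1) + (C * (q.eval (a.size + b.size) + (a.size + b.size) + 1) +
            2)))) + 1 ≤ B.eval m := by
        simp only [B, Polynomial.eval_add, Polynomial.eval_mul, Polynomial.eval_X,
          Polynomial.eval_one, Polynomial.eval_natCast, Polynomial.eval_ofNat, Nat.cast_id]
        gcongr <;> omega
      rw [List.length_cons, Nat.add_mul, one_mul]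
      omega
    · simp [List.countP_cons, Nat.add_assoc]

-- The list of non-members of size at most f(k) depends only on k and is computable since `Q` is
-- decidable; the time to produce it and its length go into the parameter part. Each test is
-- polynomial in the size of the list entry plus |x| + k.
open Classical in
theorem IsPolyTimeQuasiOrder.isStronglyUniformlyFPT {Q : Set (Instance A)}
    {r : Instance A → Instance A → Prop} {f : ℕ → ℕ} (hQ : IsDecidable Q)
    (hr : IsPolyTimeQuasiOrder r) (hf : Computable f) (hrQ : IsLowerIdeal r Q)
    (h : ∀ (x : List A) (k : ℕ), (x, k) ∉ Q →
      ∃ a : Instance A, a ∉ Q ∧ a.size ≤ f k ∧ r a (x, k)) : IsStronglyUniformlyFPT Q := by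
  let _ : Primcodable A := Primcodable.ofEquiv _ (Fintype.equivFin A)
  obtain ⟨-, -, -, -, -, -, -, hdec, -⟩ := hQ.exists_prog
  let no (k : ℕ) : List (Instance A) := (instances A (f k)).filter fun a => !decide (a ∈ Q)
  let list (k : ℕ) : List ℕ := (no k).flatMap fun a => leftCodes a ++ [separator A]
  have hlist : Computable list := by
    have h1 : Computable fun a : Instance A =>
        bif !decide (a ∈ Q) then leftCodes a ++ [separator A] else [] :=
      Computable.cond (Primrec.not.to_comp.comp hdec) (Computable.list_append.comp
        (primrec_map_encode _).to_comp (.const _)) (.const [])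
    refine ((computable_list_flatMap h1).comp (primrec_instances.to_comp.comp hf)).of_eq
      fun k => ?_
    rw [← flatMap_filter_eq]
  -- The separator is the largest symbol in use and all letter codes are positive, as the digit
  -- representation to the base `separator A + 1` demands.
  obtain ⟨n, i, o, pl, T, hio, hT, hpl⟩ := exists_prog_of_computable hlist
    (B := separator A + 1) (by simp [separator]) (by
      intro k c hc
      simp only [list, List.mem_flatMap, List.mem_append, List.mem_singleton] at hc
      obtain ⟨a, -, hc | rfl⟩ := hc
      · obtain ⟨l, -, rfl⟩ := List.mem_map.1 hc
        exact ⟨letterCode_pos _, (letterCode_le _).trans_lt (by simp [separator])⟩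
      · simp [separator])
  obtain ⟨M⟩ := hr.polyTime
  have : Fintype M.tm.K := M.tm.kFin
  obtain ⟨pt, B, hpt⟩ := exists_runs_testLoop M (Fin n) o
  set syms := letters ((A ⊕ Bool) ⊕ (A ⊕ Bool)) with hsyms
  set S := syms.length with hS
  set L := (letters (A ⊕ Bool)).length with hL
  -- The input is recoded as the second component of a pair; its letters for `k` also leave a mark
  -- each, which puts `k` in unary on the input stack of `pl`.
  let marks (c : ℕ) : List ((Option M.tm.K ⊕ (Fin n ⊕ Fin 5)) × ℕ) :=
    (.inr (.inr 1), letterCode (.inr (letterOf c) : (A ⊕ Bool) ⊕ (A ⊕ Bool))) ::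
      if (letterOf c : A ⊕ Bool).isRight then [(.inr (.inl i), 1)] else []
  have hmarks : ∀ (w : List (A ⊕ Bool)) (i' : Option M.tm.K ⊕ (Fin n ⊕ Fin 5)),
      destined i' ((w.map letterCode).flatMap marks) =
      if i' = .inr (.inr 1) then
        w.map fun l => letterCode (.inr l : (A ⊕ Bool) ⊕ (A ⊕ Bool)) else
      if i' = .inr (.inl i) then List.replicate (w.countP Sum.isRight) 1 else [] := by
    intro w i'
    induction w with
    | nil => simp
    | cons a w ih =>
      rw [List.map_cons, List.flatMap_cons, destined_append, ih]
      by_cases h1 : i' = .inr (.inr 1)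
      · subst h1; cases a <;> simp [marks]
      · by_cases h2 : i' = .inr (.inl i)
        · subst h2; cases a <;> simp [marks, List.replicate_succ, List.countP_cons]
        · cases a <;> simp [marks, h1, h2, Ne.symm h1, Ne.symm h2]
  refine isStronglyUniformlyFPT_of_runs
    (.seq (scanAll (.inr (.inr 0)) (letters (A ⊕ Bool)) marks) (.seq ((pl.map .inl).map .inr)
      (.seq pt (.seq (scanAll (.inr (.inr 1)) syms fun _ => [])
        (.ite (.inr (.inr 3)) none (.push (.inr (.inr 4)) (letterCode true))
          (.seq (scanAll (.inr (.inr 3)) [letterCode true] fun _ => [])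
            (.push (.inr (.inr 4)) (letterCode false))))))))
    (.inr (.inr 0)) (.inr (.inr 4)) (g := fun k => k + (T k + (list k).length))
    (Primrec.nat_add.to_comp.comp .id (Primrec.nat_add.to_comp.comp hT
      (Computable.list_length.comp hlist)))
    ((.X * (2 + L + 3) + 1 : Polynomial ℕ) + (.X + ((.X * B + 1) + ((.X * (S + 3) + 1) +
      ((.X * (1 + 3) + 1) + 1 + 1))))) fun x k => ?_
  set b : Instance A := (x, k) with hb
  set N := x.length + (k + (T k + (list k).length)) with hN
  have hbN : b.size + (list k).length ≤ N := by simp [hb, hN, Instance.size]; omega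
  let E : Store (Option M.tm.K) := fun _ => []
  let E' : Store (Fin n) := fun _ => []
  set V := rightCodes b with hV
  have h1 : Runs (scanAll (.inr (.inr 0)) (letters (A ⊕ Bool)) marks)
      (wordStore (.inr (.inr 0)) ((instanceEncoding A).encode b)) (b.size * (2 + L + 3) + 1)
      (Sum.elim E (Sum.elim (single i (List.replicate k 1)) ![[], V, [], [], []])) := by
    refine (Runs.scanAll _ _ 2 ?_ ?_ _ ?_).congr ?_ ?_
    · intro c _ x hx
      simp only [marks, List.mem_cons] at hx
      rcases hx with rfl | hx
      · simp
      · split_ifs at hx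
        · simp at hx; subst hx; simp
        · simp at hx
    · intro c _
      simp only [marks]
      split_ifs <;> simp
    · simp only [wordStore, single, update_self, List.mem_reverse]
      exact fun c hc => mem_letters_of_mem_map hc
    · simp [wordStore, single, length_instanceEncoding, hL]
    · have hc : ((instanceEncoding A).encode b).countP Sum.isRight = k :=
        countP_isRight_encode x k
      funext l
      rw [wordStore, single, update_self, ← List.map_reverse, hmarks]
      rcases l with l | l | l
      · simp [E]
      · by_cases hl : l = i
        · subst hl; simp [-Sum.elim_update_left, single, hc]
        · simp [-Sum.elim_update_left, single, hl]
      · fin_cases l <;> simp [hV, rightCodes]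
  have h2 : Runs ((pl.map .inl).map .inr)
      (Sum.elim E (Sum.elim (single i (List.replicate k 1)) ![[], V, [], [], []])) (T k)
      (Sum.elim E (Sum.elim (single o (list k)) ![[], V, [], [], []])) := by
    have := (((hpl k).runs).map (j := (Sum.inl : _ → Fin n ⊕ Fin 5)) Sum.inl_injective
      (Sum.elim E' ![[], V, [], [], []])).map (j := (Sum.inr : _ → Option M.tm.K ⊕ (Fin n ⊕ Fin 5)))
      Sum.inr_injective (Sum.elim E (Sum.elim E' ![[], V, [], [], []]))
    rw [extend_inl, extend_inl, extend_inr, extend_inr] at this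
    exact this
  have hno : ∀ a ∈ no k, a.size + b.size ≤ N := fun a ha => by
    obtain ⟨l, l', hl⟩ := List.append_of_mem ha
    have : a.size ≤ (list k).length := by
      simp [list, hl, length_leftCodes]
      omega
    omega
  -- Every entry contributes at least its separator.
  have hnol : (no k).length ≤ (list k).length := by
    simp only [list, List.length_flatMap]
    refine (le_of_eq (by simp)).trans (List.sum_le_sum (f := fun _ => 1) fun a _ => by simp)
  have h3 := hpt b N (no k) hno 0
  rw [List.replicate_zero, Nat.add_zero] at h3
  set v := (no k).countP (fun a => decide (r a b)) with hv
  have hvN : v ≤ N := (List.countP_le_length).trans (by omega)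
  -- Correctness of the test: if an entry precedes a member of `Q`, it belongs to `Q` by the lower
  -- ideal property, which is absurd; and for a non-member the hypothesis `h` supplies an entry that
  -- precedes it.
  have hvQ : v = 0 ↔ b ∈ Q := by
    rw [hv, List.countP_eq_zero]
    simp only [no, List.mem_filter, Bool.not_eq_true', decide_eq_true_eq, decide_eq_false_iff_not]
    refine ⟨fun hall => ?_, fun hbQ a ha hrab => ha.2 (hrQ b a hbQ hrab)⟩
    by_contra hbQ
    obtain ⟨a, ha, has, hrab⟩ := h x k hbQ
    exact hall a ⟨mem_instances has, ha⟩ hrab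
  have h4 : Runs (scanAll (.inr (.inr 1)) syms fun _ => [])
      (Sum.elim E (Sum.elim E' ![[], V, [], List.replicate v (letterCode true), []]))
      (b.size * (S + 3) + 1)
      (Sum.elim E (Sum.elim E' ![[], [], [], List.replicate v (letterCode true), []])) := by
    refine (runs_clear ?_).congr (by simp [hV, length_rightCodes, hS]) ?_
    · simpa using fun n hn => mem_letters_of_mem_rightCodes hn
    · rw [Sum.update_elim_inr, Sum.update_elim_inr]
      congr 2
      funext i; fin_cases i <;> simp
  have h5 : Runs (.ite (.inr (.inr 3)) none (.push (.inr (.inr 4)) (letterCode true))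
          (.seq (scanAll (.inr (.inr 3)) [letterCode true] fun _ => [])
            (.push (.inr (.inr 4)) (letterCode false))))
      (Sum.elim E (Sum.elim E' ![[], [], [], List.replicate v (letterCode true), []]))
      ((N * (1 + 3) + 1) + 1 + 1) (wordStore (.inr (.inr 4)) [decide (b ∈ Q)]) := by
    by_cases hbQ : b ∈ Q
    · rw [hvQ.2 hbQ]
      refine (Runs.ite_true (by simp) Runs.push).congr (by omega) ?_
      rw [Sum.update_elim_inr, Sum.update_elim_inr]
      funext l
      rcases l with l | l | l
      · simp [-Sum.elim_update_right, wordStore, single, E]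
      · simp [-Sum.elim_update_right, wordStore, single, E']
      · fin_cases l <;> simp [-Sum.elim_update_right, wordStore, single, hbQ]
    · have hv0 : v ≠ 0 := fun hv0 => hbQ (hvQ.1 hv0)
      refine (Runs.ite_false (by simpa using hv0) ((runs_clear ?_).seq Runs.push)).congr ?_ ?_
      · simp
      · simp; omega
      · rw [Sum.update_elim_inr, Sum.update_elim_inr, Sum.update_elim_inr, Sum.update_elim_inr]
        funext l
        rcases l with l | l | l
        · simp [-Sum.elim_update_right, wordStore, single, E]
        · simp [-Sum.elim_update_right, wordStore, single, E']
        · fin_cases l <;> simp [-Sum.elim_update_right, wordStore, single, hbQ]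
  refine (h1.seq (h2.seq (h3.seq (h4.seq h5)))).mono ?_
  have hTN : T k ≤ N := by omega
  have hbN' : b.size ≤ N := by omega
  have hnoN : (no k).length ≤ N := by omega
  simp only [Polynomial.eval_add, Polynomial.eval_mul, Polynomial.eval_X, Polynomial.eval_one,
    Polynomial.eval_natCast, Polynomial.eval_ofNat, Nat.cast_id]
  gcongr

end Test

end ParamComplexity

/-! ### The equivalence. -/

theorem theorem1 {A : Type} [Fintype A] (Q : Set (ParamComplexity.Instance A)) :
    List.TFAE [
      ParamComplexity.IsStronglyUniformlyFPT Q,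
      ParamComplexity.IsDecidable Q ∧
        ∃ (f : ℕ → ℕ) (K : ParamComplexity.Instance A → ParamComplexity.Instance A),
          Computable f ∧ ParamComplexity.IsKernel Q f K,
      ParamComplexity.IsDecidable Q ∧
        ∃ (r : ParamComplexity.Instance A → ParamComplexity.Instance A → Prop) (f : ℕ → ℕ),
          ParamComplexity.IsPolyTimeQuasiOrder r ∧ Computable f ∧
          ParamComplexity.IsLowerIdeal r Q ∧
          ∀ (x : List A) (k : ℕ), (x, k) ∉ Q →
            ∃ a : ParamComplexity.Instance A, a ∉ Q ∧ a.size ≤ f k ∧ r a (x, k)] := by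
  tfae_have 1 → 2 := fun h =>
    let ⟨f, K, hf, hK, _⟩ := h.exists_kernel
    ⟨h.isDecidable, f, K, hf, hK⟩
  -- This starts from (1) because the kernel in (2) need not be idempotent, whereas the one built
  -- from (1) is.
  tfae_have 1 → 3 := fun h =>
    let ⟨f, _, hf, hK, hKK⟩ := h.exists_kernel
    let ⟨r, hr, hrQ, hrf⟩ := hK.exists_quasiOrder hKK
    ⟨h.isDecidable, r, f, hr, hf, hrQ, hrf⟩
  tfae_have 2 → 1 := fun ⟨hQ, _, _, hf, hK⟩ => hK.isStronglyUniformlyFPT hQ hf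
  tfae_have 3 → 1 := fun ⟨hQ, _, _, hr, hf, hrQ, h⟩ => hr.isStronglyUniformlyFPT hQ hf hrQ h
  tfae_finish
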